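/- **Setting.** A directed graph $G=(V,E,c,t)$ has $n=|V|$ vertices, $m=|E|$ edges $e=(u,v)$ (self-loops allowed, no parallel edges), and for each edge a real cost $c(e)$ and a real transit time $t(e)$, such that $\sum_{e\in C}t(e)>0$ for every directed cycle $C$. A *minimum ratio cycle* is a simple directed cycle $C$ minimizing $\sum_{e\in C}c(e)\big/\sum_{e\in C}t(e)$ among all simple directed cycles of $G$. The input is $n$, $m$ and the list of the edges with their costs and transit times. The machine is a unit-cost real RAM with exact operations $+,-,\times,\div,<$ on reals, the usual integer operations on words of $O(\log(n+m+2))$ bits, and unit-cost tosses of independent fair coins. **Theorem.** For every $k\in\mathbb N$ there is a randomized one-sided-error Monte Carlo algorithm for computing a minimum ratio cycle with running time $O(n^{3/2}m^{3/4}\log^2 n)$ and success probability at least $1-n^{-k}$. Precisely, there are a program and constants depending only on $k$ (the running-time constant $K$ and the word size factor) such that for every such graph $G$: 1. for every outcome of the coin tosses, the program halts after at most $K\,(n^{3/2}m^{3/4}\log^2 n+1)$ steps; 2. for every outcome of the coin tosses, the output is a simple directed cycle of $G$ (as the list of its edges in order), so that its ratio is never smaller than the minimum ratio, or, if and only if $G$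 has no cycle, the empty list; 3. if $G$ has a cycle, then the probability that the output is not a minimum ratio cycle is at most $n^{-k}$. Moreover, the program consists of two phases run one after the other: a first phase in which all coins are tossed and which never accesses the costs or the transit times (so the random sampling is independent of them and of every weight $c(e)-\lambda t(e)$), followed by a deterministic second phase. -/

import Mathlib

/-! A unit-cost real RAM with fair coins, given as a structured programming language.

A program works on finitely many word variables and word arrays (holding natural numbers) and on
finitely many real variables and real arrays. Variables and arrays are named by constants of the
program; array cells are addressed by words. Word operations are performed modulo a word bound `W`,
which will be polynomial in the size of the input, so that a word has logarithmically many bits.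
Real operations are exact, and a real number influences the control flow only through
comparisons `<`; there is no rounding and no conversion from reals to words. Every constant, every
memory access, every arithmetic operation, comparison, connective, assignment and coin toss
costs one step. -/

namespace RealRAM

/-- Word expressions. -/
inductive WExp where
  | const (k : ℕ)
  | var (x : ℕ)
  | get (a : ℕ) (i : WExp)
  | add (e f : WExp)
  | sub (e f : WExp)
  | mul (e f : WExp)
  | div (e f : WExp)

/-- Real expressions. The only constants are natural numbers. -/
inductive RExp where
  | const (k : ℕ)
  | var (x : ℕ)
  | get (a : ℕ) (i : WExp)
  | add (e f : RExp)
  | sub (e f : RExp)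
  | mul (e f : RExp)
  | div (e f : RExp)

/-- Tests. -/
inductive BExp where
  | wlt (e f : WExp)
  | rlt (e f : RExp)
  | not (b : BExp)
  | and (b d : BExp)

/-- Programs. -/
inductive Cmd where
  | skip
  | wset (x : ℕ) (e : WExp)
  | wput (a : ℕ) (i e : WExp)
  | rset (x : ℕ) (e : RExp)
  | rput (a : ℕ) (i : WExp) (e : RExp)
  | flip (x : ℕ)
  | seq (p q : Cmd)
  | ite (b : BExp) (p q : Cmd)
  | loop (b : BExp) (p : Cmd)

/-- The content of the memory, and the outcomes of the coin tosses still to come. -/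
structure State where
  wvar : ℕ → ℕ
  warr : ℕ → ℕ → ℕ
  rvar : ℕ → ℝ
  rarr : ℕ → ℕ → ℝ
  coins : ℕ → Bool

/-- Value of a word expression: arithmetic modulo `W`; `sub` is truncated at `0`, `div` is
integer division. -/
def WExp.eval (W : ℕ) (s : State) : WExp → ℕ
  | const k => k % W
  | var x => s.wvar x
  | get a i => s.warr a (i.eval W s)
  | add e f => (e.eval W s + f.eval W s) % W
  | sub e f => (e.eval W s - f.eval W s) % W
  | mul e f => (e.eval W s * f.eval W s) % W
  | div e f => (e.eval W s / f.eval W s) % W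

/-- Value of a real expression (with `x / 0 = 0`). -/
noncomputable def RExp.eval (W : ℕ) (s : State) : RExp → ℝ
  | const k => k
  | var x => s.rvar x
  | get a i => s.rarr a (i.eval W s)
  | add e f => e.eval W s + f.eval W s
  | sub e f => e.eval W s - f.eval W s
  | mul e f => e.eval W s * f.eval W s
  | div e f => e.eval W s / f.eval W s

/-- Truth of a test. -/
def BExp.Holds (W : ℕ) (s : State) : BExp → Prop
  | wlt e f => e.eval W s < f.eval W s
  | rlt e f => e.eval W s < f.eval W s
  | not b => ¬ b.Holds W s
  | and b d => b.Holds W s ∧ d.Holds W s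

/-- Number of steps needed to evaluate a word expression. -/
def WExp.cost : WExp → ℕ
  | const _ => 1
  | var _ => 1
  | get _ i => i.cost + 1
  | add e f => e.cost + f.cost + 1
  | sub e f => e.cost + f.cost + 1
  | mul e f => e.cost + f.cost + 1
  | div e f => e.cost + f.cost + 1

/-- Number of steps needed to evaluate a real expression. -/
def RExp.cost : RExp → ℕ
  | const _ => 1
  | var _ => 1
  | get _ i => i.cost + 1
  | add e f => e.cost + f.cost + 1
  | sub e f => e.cost + f.cost + 1
  | mul e f => e.cost + f.cost + 1
  | div e f => e.cost + f.cost + 1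

/-- Number of steps needed to evaluate a test. -/
def BExp.cost : BExp → ℕ
  | wlt e f => e.cost + f.cost + 1
  | rlt e f => e.cost + f.cost + 1
  | not b => b.cost + 1
  | and b d => b.cost + d.cost + 1

/-- `Exec W p s T s'`: with word bound `W`, the program `p` started in state `s` halts
after exactly `T` steps in state `s'`. -/
inductive Exec (W : ℕ) : Cmd → State → ℕ → State → Prop
  | skip (s : State) : Exec W .skip s 1 s
  | wset (s : State) (x : ℕ) (e : WExp) :
      Exec W (.wset x e) s (e.cost + 1)
        { s with wvar := Function.update s.wvar x (e.eval W s) }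
  | wput (s : State) (a : ℕ) (i e : WExp) :
      Exec W (.wput a i e) s (i.cost + e.cost + 1)
        { s with warr := Function.update s.warr a
                  (Function.update (s.warr a) (i.eval W s) (e.eval W s)) }
  | rset (s : State) (x : ℕ) (e : RExp) :
      Exec W (.rset x e) s (e.cost + 1)
        { s with rvar := Function.update s.rvar x (e.eval W s) }
  | rput (s : State) (a : ℕ) (i : WExp) (e : RExp) :
      Exec W (.rput a i e) s (i.cost + e.cost + 1)
        { s with rarr := Function.update s.rarr a
                  (Function.update (s.rarr a) (i.eval W s) (e.eval W s)) }
  | flip (s : State) (x : ℕ) :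
      Exec W (.flip x) s 1
        { s with wvar := Function.update s.wvar x (s.coins 0).toNat
                 coins := fun j => s.coins (j + 1) }
  | seq {p q : Cmd} {s s₁ s₂ : State} {T₁ T₂ : ℕ} :
      Exec W p s T₁ s₁ → Exec W q s₁ T₂ s₂ → Exec W (.seq p q) s (T₁ + T₂) s₂
  | iteTrue {b : BExp} {p q : Cmd} {s s' : State} {T : ℕ} :
      b.Holds W s → Exec W p s T s' → Exec W (.ite b p q) s (b.cost + T) s'
  | iteFalse {b : BExp} {p q : Cmd} {s s' : State} {T : ℕ} :
      ¬ b.Holds W s → Exec W q s T s' → Exec W (.ite b p q) s (b.cost + T) s'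
  | loopDone {b : BExp} {p : Cmd} {s : State} :
      ¬ b.Holds W s → Exec W (.loop b p) s b.cost s
  | loopStep {b : BExp} {p : Cmd} {s s₁ s₂ : State} {T₁ T₂ : ℕ} :
      b.Holds W s → Exec W p s T₁ s₁ → Exec W (.loop b p) s₁ T₂ s₂ →
      Exec W (.loop b p) s (b.cost + T₁ + T₂) s₂

/-- The test does not access the real memory. -/
def BExp.RealFree : BExp → Prop
  | wlt _ _ => True
  | rlt _ _ => False
  | not b => b.RealFree
  | and b d => b.RealFree ∧ d.RealFree

/-- The program never accesses the real memory. -/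
def Cmd.RealFree : Cmd → Prop
  | skip => True
  | wset _ _ => True
  | wput _ _ _ => True
  | rset _ _ => False
  | rput _ _ _ => False
  | flip _ => True
  | seq p q => p.RealFree ∧ q.RealFree
  | ite b p q => b.RealFree ∧ p.RealFree ∧ q.RealFree
  | loop b p => b.RealFree ∧ p.RealFree

/-- The program never tosses a coin, that is, it is deterministic. -/
def Cmd.CoinFree : Cmd → Prop
  | skip => True
  | wset _ _ => True
  | wput _ _ _ => True
  | rset _ _ => True
  | rput _ _ _ => True
  | flip _ => False
  | seq p q => p.CoinFree ∧ q.CoinFree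
  | ite _ p q => p.CoinFree ∧ q.CoinFree
  | loop _ p => p.CoinFree

/-- The law of an infinite sequence of independent fair coin tosses. -/
noncomputable def coinMeasure : MeasureTheory.Measure (ℕ → Bool) :=
  MeasureTheory.Measure.infinitePi fun _ => (PMF.uniformOfFintype Bool).toMeasure

end RealRAM

/-- A directed graph with vertex set `Fin n` and `m` edges (self-loops allowed, no two edges with
the same tail and the same head), in which every edge has a real cost and a real transit time. -/
structure RatioGraph (n m : ℕ) where
  src : Fin m → Fin n
  dst : Fin m → Fin n
  cost : Fin m → ℝ
  time : Fin m → ℝ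
  simple : Function.Injective fun e => (src e, dst e)

namespace RatioGraph

variable {n m : ℕ}

/-- `l` lists the edges of a (simple, directed) cycle in the order in which they are traversed:
the head of every edge is the tail of the cyclically next one, and no vertex is repeated. -/
def IsCycle (G : RatioGraph n m) (l : List (Fin m)) : Prop :=
  l ≠ [] ∧ l.map G.dst = (l.map G.src).rotate 1 ∧ (l.map G.src).Nodup

/-- Total transit time of a list of edges. -/
def totalTime (G : RatioGraph n m) (l : List (Fin m)) : ℝ := (l.map G.time).sum

/-- Cost-to-time ratio of a list of edges. -/
noncomputable def ratio (G : RatioGraph n m) (l : List (Fin m)) : ℝ :=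
  (l.map G.cost).sum / G.totalTime l

/-- `l` is a cycle of minimum cost-to-time ratio. -/
def IsMinRatioCycle (G : RatioGraph n m) (l : List (Fin m)) : Prop :=
  G.IsCycle l ∧ ∀ l', G.IsCycle l' → G.ratio l ≤ G.ratio l'

/-- The initial state: `n` and `m` in the word variables `0` and `1`, the tails and the heads of the
edges in the word arrays `0` and `1`, the costs and the transit times of the edges in the real
arrays `0` and `1`, and `0` in all other cells; the coins will show `ω`. -/
noncomputable def init (G : RatioGraph n m) (ω : ℕ → Bool) : RealRAM.State where
  wvar x := if x = 0 then n else if x = 1 then m else 0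
  warr a i := if h : i < m then
      (if a = 0 then (G.src ⟨i, h⟩ : ℕ) else if a = 1 then (G.dst ⟨i, h⟩ : ℕ) else 0) else 0
  rvar _ := 0
  rarr a i := if h : i < m then
      (if a = 0 then G.cost ⟨i, h⟩ else if a = 1 then G.time ⟨i, h⟩ else 0) else 0
  coins := ω

/-- On input `G` with coin tosses `ω` and words below `(n + m + 2) ^ κ`, the program `p` halts
after exactly `T` steps and outputs the list `l` of edges: the length of the list is in the word
variable `2` and its entries are in the first cells of the word array `2`. -/
def Computes (G : RatioGraph n m) (κ : ℕ) (p : RealRAM.Cmd) (ω : ℕ → Bool) (T : ℕ)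
    (l : List (Fin m)) : Prop :=
  ∃ s : RealRAM.State, RealRAM.Exec ((n + m + 2) ^ κ) p (G.init ω) T s ∧
    (List.range (s.wvar 2)).map (s.warr 2) = l.map Fin.val

end RatioGraph

/-!
The algorithm is Megiddo's parametric search for the largest parameter `x` for which the edge weights
`cost - x * time` admit no negative cycle; because every cycle has positive transit time, this is the
minimum ratio (`Net.neg_iff`). A single parameter can be tested by the algorithm of Bellman and Ford in
time `O(n * m)`. The search maintains an interval with no negative cycle at its left end and a negative
cycle at its right end (`RealRAM.Bracket`), and computes minimal walks as if the parameter were known. The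
weight of a walk is a line `x ↦ a - x * b`. Whenever the minimum within groups of lines is needed, prune
and search shrinks the interval until in each group one line is minimal on the whole interval
(`RealRAM.runs_groupMin`): the candidates of a group are paired, the median of all crossing points is
tested, and at least half of the pairs lose a member, so that logarithmically many tests suffice for
all groups together.

The minimal walks with at most `h` edges between all pairs of vertices are computed edge by edge. Then
only `L` random vertices are kept, and the matrix of minimal walks between them is squared `lg` times
with respect to minimum and addition. If every `h` consecutive vertices of some minimum ratio cycle contain a sample,
this cycle is a chain of short walks between samples and is among the closed walks that have been taken
into account (`RealRAM.covered_of_hits`); this is the only place where chance matters. The last minimum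
is taken over all closed walks found, among them the empty walk, whose line is zero. The winning line
therefore is not above zero on the interval; up to the minimum ratio it is not below zero, as there are no
negative closed walks; and at the right end it is negative, as it is not above the line of the minimum
ratio cycle. Hence the left end of the interval is the minimum ratio itself
(`RealRAM.lo_eq_ratio`). For the Bellman–Ford potential at this parameter the edges of minimum ratio cycles
are tight, and every cycle of tight edges has minimum ratio, so a search for a cycle among them
finishes the computation (`RealRAM.runs_finish`). If there is no such cycle, some cycle of the graph is
returned, which makes the error one-sided.

With `h * L` about `2 * (c + 1) * n * log n`, each of the at most `n` windows of `h` consecutive vertices of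
the cycle is avoided by all samples with probability at most `n⁻¹ ^ (c + 1)`, and the union bound gives
the failure probability (`RealRAM.coinMeasure_not_covered`). With `h = h₀ * lg` and `L` about `n / h₀`, the
two main parts of the search take time `h₀ * n * m` and `(n / h₀) ^ 3`, up to two logarithmic factors; they
are balanced for `h₀` about `n ^ (1 / 2) / m ^ (1 / 4)` (`RealRAM.Setup.balance_le`). All vertices without
edges are removed beforehand, since otherwise `n` need not be bounded by a multiple of `m`.

The correctness of the program is proved with the judgement `RealRAM.Runs`, which combines a
postcondition with a bound on the number of steps. Loop-free code is evaluated by its denotation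
`RealRAM.Cmd.den`, loops are handled by the invariant rule `RealRAM.Runs.forUp`, and
`RealRAM.Agree` provides that memory not assigned by a program is unchanged.
-/

/-! ### Reasoning about programs -/

namespace RealRAM

namespace State

/-- The state after writing `v` into the word variable `x`. -/
def setW (s : State) (x v : ℕ) : State := { s with wvar := Function.update s.wvar x v }

/-- The state after writing `v` into the cell `i` of the word array `a`. -/
def putW (s : State) (a i v : ℕ) : State :=
  { s with warr := Function.update s.warr a (Function.update (s.warr a) i v) }

/-- The state after writing `v` into the real variable `x`. -/
noncomputable def setR (s : State) (x : ℕ) (v : ℝ) : State :=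
  { s with rvar := Function.update s.rvar x v }

/-- The state after writing `v` into the cell `i` of the real array `a`. -/
noncomputable def putR (s : State) (a i : ℕ) (v : ℝ) : State :=
  { s with rarr := Function.update s.rarr a (Function.update (s.rarr a) i v) }

/-- The state after tossing a coin and storing its outcome in the word variable `x`. -/
def toss (s : State) (x : ℕ) : State :=
  { s with wvar := Function.update s.wvar x (s.coins 0).toNat, coins := fun j => s.coins (j + 1) }

variable (s : State) (x a i v y b j : ℕ) (r : ℝ)

@[simp] theorem setW_wvar : (s.setW x v).wvar y = if y = x then v else s.wvar y := by
  simp [setW, Function.update_apply]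
@[simp] theorem setW_warr : (s.setW x v).warr = s.warr := rfl
@[simp] theorem setW_rvar : (s.setW x v).rvar = s.rvar := rfl
@[simp] theorem setW_rarr : (s.setW x v).rarr = s.rarr := rfl
@[simp] theorem setW_coins : (s.setW x v).coins = s.coins := rfl
@[simp] theorem putW_wvar : (s.putW a i v).wvar = s.wvar := rfl
@[simp] theorem putW_warr : (s.putW a i v).warr b =
    if b = a then Function.update (s.warr a) i v else s.warr b := by
  simp [putW, Function.update_apply]
@[simp] theorem putW_rvar : (s.putW a i v).rvar = s.rvar := rfl
@[simp] theorem putW_rarr : (s.putW a i v).rarr = s.rarr := rfl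
@[simp] theorem putW_coins : (s.putW a i v).coins = s.coins := rfl
@[simp] theorem setR_wvar : (s.setR x r).wvar = s.wvar := rfl
@[simp] theorem setR_warr : (s.setR x r).warr = s.warr := rfl
@[simp] theorem setR_rvar : (s.setR x r).rvar y = if y = x then r else s.rvar y := by
  simp [setR, Function.update_apply]
@[simp] theorem setR_rarr : (s.setR x r).rarr = s.rarr := rfl
@[simp] theorem setR_coins : (s.setR x r).coins = s.coins := rfl
@[simp] theorem putR_wvar : (s.putR a i r).wvar = s.wvar := rfl
@[simp] theorem putR_warr : (s.putR a i r).warr = s.warr := rfl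
@[simp] theorem putR_rvar : (s.putR a i r).rvar = s.rvar := rfl
@[simp] theorem putR_rarr : (s.putR a i r).rarr b =
    if b = a then Function.update (s.rarr a) i r else s.rarr b := by
  simp [putR, Function.update_apply]
@[simp] theorem putR_coins : (s.putR a i r).coins = s.coins := rfl
@[simp] theorem toss_wvar :
    (s.toss x).wvar y = if y = x then (s.coins 0).toNat else s.wvar y := by
  simp [toss, Function.update_apply]
@[simp] theorem toss_warr : (s.toss x).warr = s.warr := rfl
@[simp] theorem toss_rvar : (s.toss x).rvar = s.rvar := rfl
@[simp] theorem toss_rarr : (s.toss x).rarr = s.rarr := rfl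
@[simp] theorem toss_coins : (s.toss x).coins = fun j => s.coins (j + 1) := rfl

end State

namespace Cmd

/-- The program contains no loop. -/
def LoopFree : Cmd → Bool
  | loop _ _ => false
  | seq p q => p.LoopFree && q.LoopFree
  | ite _ p q => p.LoopFree && q.LoopFree
  | _ => true

/-- The total cost of all parts of the program, a bound on the running time of loop-free code. It
counts both branches of a case distinction. -/
def sz : Cmd → ℕ
  | skip => 1
  | wset _ e => e.cost + 1
  | wput _ i e => i.cost + e.cost + 1
  | rset _ e => e.cost + 1
  | rput _ i e => i.cost + e.cost + 1
  | flip _ => 1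
  | seq p q => p.sz + q.sz
  | ite b p q => b.cost + (p.sz + q.sz)
  | loop b p => b.cost + p.sz

open Classical in
/-- The effect of a loop-free program on the state. -/
noncomputable def den (W : ℕ) : Cmd → State → State
  | skip, s => s
  | wset x e, s => s.setW x (e.eval W s)
  | wput a i e, s => s.putW a (i.eval W s) (e.eval W s)
  | rset x e, s => s.setR x (e.eval W s)
  | rput a i e, s => s.putR a (i.eval W s) (e.eval W s)
  | flip x, s => s.toss x
  | seq p q, s => q.den W (p.den W s)
  | ite b p q, s => if b.Holds W s then p.den W s else q.den W s
  | loop _ _, s => s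

/-- The program may write the word variable `x`. -/
def writesW (x : ℕ) : Cmd → Bool
  | wset y _ => x == y
  | flip y => x == y
  | seq p q => p.writesW x || q.writesW x
  | ite _ p q => p.writesW x || q.writesW x
  | loop _ p => p.writesW x
  | _ => false

/-- The program may write the word array `a`. -/
def putsW (a : ℕ) : Cmd → Bool
  | wput b _ _ => a == b
  | seq p q => p.putsW a || q.putsW a
  | ite _ p q => p.putsW a || q.putsW a
  | loop _ p => p.putsW a
  | _ => false

/-- The program may write the real variable `x`. -/
def writesR (x : ℕ) : Cmd → Bool
  | rset y _ => x == y
  | seq p q => p.writesR x || q.writesR x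
  | ite _ p q => p.writesR x || q.writesR x
  | loop _ p => p.writesR x
  | _ => false

/-- The program may write the real array `a`. -/
def putsR (a : ℕ) : Cmd → Bool
  | rput b _ _ => a == b
  | seq p q => p.putsR a || q.putsR a
  | ite _ p q => p.putsR a || q.putsR a
  | loop _ p => p.putsR a
  | _ => false

/-- The program may toss a coin. -/
def tosses : Cmd → Bool
  | flip _ => true
  | seq p q => p.tosses || q.tosses
  | ite _ p q => p.tosses || q.tosses
  | loop _ p => p.tosses
  | _ => false

end Cmd

/-- `s'` agrees with `s` on all parts of the memory that the program `p` does not write. -/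
structure Agree (p : Cmd) (s s' : State) : Prop where
  w : ∀ x, p.writesW x = false → s'.wvar x = s.wvar x
  wa : ∀ a, p.putsW a = false → s'.warr a = s.warr a
  r : ∀ x, p.writesR x = false → s'.rvar x = s.rvar x
  ra : ∀ a, p.putsR a = false → s'.rarr a = s.rarr a
  coins : p.tosses = false → s'.coins = s.coins

theorem Agree.refl (p : Cmd) (s : State) : Agree p s s :=
  ⟨fun _ _ => rfl, fun _ _ => rfl, fun _ _ => rfl, fun _ _ => rfl, fun _ => rfl⟩

theorem Agree.trans {p : Cmd} {s s' s'' : State} (h : Agree p s s') (h' : Agree p s' s'') :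
    Agree p s s'' :=
  ⟨fun x hx => (h'.w x hx).trans (h.w x hx), fun x hx => (h'.wa x hx).trans (h.wa x hx),
    fun x hx => (h'.r x hx).trans (h.r x hx), fun x hx => (h'.ra x hx).trans (h.ra x hx),
    fun hx => (h'.coins hx).trans (h.coins hx)⟩

/-- The memory written by `p` is also written by `q`. -/
def Cmd.WritesLE (p q : Cmd) : Prop :=
  (∀ x, q.writesW x = false → p.writesW x = false) ∧ (∀ a, q.putsW a = false → p.putsW a = false) ∧
  (∀ x, q.writesR x = false → p.writesR x = false) ∧ (∀ a, q.putsR a = false → p.putsR a = false) ∧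
  (q.tosses = false → p.tosses = false)

theorem Agree.mono {p q : Cmd} {s s' : State} (h : Agree p s s') (hpq : p.WritesLE q) :
    Agree q s s' :=
  ⟨fun x hx => h.w x (hpq.1 x hx), fun x hx => h.wa x (hpq.2.1 x hx),
    fun x hx => h.r x (hpq.2.2.1 x hx), fun x hx => h.ra x (hpq.2.2.2.1 x hx),
    fun hx => h.coins (hpq.2.2.2.2 hx)⟩

theorem Cmd.WritesLE.seq_left (p q : Cmd) : p.WritesLE (.seq p q) := by
  simp +contextual [Cmd.WritesLE, Cmd.writesW, Cmd.putsW, Cmd.writesR, Cmd.putsR, Cmd.tosses]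
theorem Cmd.WritesLE.seq_right (p q : Cmd) : q.WritesLE (.seq p q) := by
  simp +contextual [Cmd.WritesLE, Cmd.writesW, Cmd.putsW, Cmd.writesR, Cmd.putsR, Cmd.tosses]
theorem Cmd.WritesLE.ite_left (b : BExp) (p q : Cmd) : p.WritesLE (.ite b p q) := by
  simp +contextual [Cmd.WritesLE, Cmd.writesW, Cmd.putsW, Cmd.writesR, Cmd.putsR, Cmd.tosses]
theorem Cmd.WritesLE.ite_right (b : BExp) (p q : Cmd) : q.WritesLE (.ite b p q) := by
  simp +contextual [Cmd.WritesLE, Cmd.writesW, Cmd.putsW, Cmd.writesR, Cmd.putsR, Cmd.tosses]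
theorem Cmd.WritesLE.loop (b : BExp) (p : Cmd) : p.WritesLE (.loop b p) := by
  simp +contextual [Cmd.WritesLE, Cmd.writesW, Cmd.putsW, Cmd.writesR, Cmd.putsR, Cmd.tosses]

/-- Memory that does not occur on the left of an assignment is unchanged. -/
theorem Exec.agree {W : ℕ} {p : Cmd} {s s' : State} {T : ℕ} (h : Exec W p s T s') :
    Agree p s s' := by
  induction h with
  | skip s => exact Agree.refl _ _
  | wset s x e =>
    refine ⟨fun y hy => ?_, fun _ _ => rfl, fun _ _ => rfl, fun _ _ => rfl, fun _ => rfl⟩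
    have : y ≠ x := by simpa [Cmd.writesW] using hy
    simp [Function.update_of_ne this]
  | wput s a i e =>
    refine ⟨fun _ _ => rfl, fun y hy => ?_, fun _ _ => rfl, fun _ _ => rfl, fun _ => rfl⟩
    have : y ≠ a := by simpa [Cmd.putsW] using hy
    simp [Function.update_of_ne this]
  | rset s x e =>
    refine ⟨fun _ _ => rfl, fun _ _ => rfl, fun y hy => ?_, fun _ _ => rfl, fun _ => rfl⟩
    have : y ≠ x := by simpa [Cmd.writesR] using hy
    simp [Function.update_of_ne this]
  | rput s a i e =>
    refine ⟨fun _ _ => rfl, fun _ _ => rfl, fun _ _ => rfl, fun y hy => ?_, fun _ => rfl⟩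
    have : y ≠ a := by simpa [Cmd.putsR] using hy
    simp [Function.update_of_ne this]
  | flip s x =>
    refine ⟨fun y hy => ?_, fun _ _ => rfl, fun _ _ => rfl, fun _ _ => rfl, fun h => ?_⟩
    · have : y ≠ x := by simpa [Cmd.writesW] using hy
      simp [Function.update_of_ne this]
    · simp [Cmd.tosses] at h
  | seq _ _ ih₁ ih₂ => exact (ih₁.mono (.seq_left _ _)).trans (ih₂.mono (.seq_right _ _))
  | iteTrue _ _ ih => exact ih.mono (.ite_left _ _ _)
  | iteFalse _ _ ih => exact ih.mono (.ite_right _ _ _)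
  | loopDone _ => exact Agree.refl _ _
  | loopStep _ _ _ ih₁ ih₂ => exact (ih₁.mono (.loop _ _)).trans ih₂

/-- Started in the state `s`, the program `p` halts after at most `T` steps in a state
satisfying `Q`. -/
def Runs (W : ℕ) (p : Cmd) (s : State) (T : ℕ) (Q : State → Prop) : Prop :=
  ∃ t s', Exec W p s t s' ∧ t ≤ T ∧ Q s'

namespace Runs

variable {W : ℕ} {p q : Cmd} {s : State} {T T' : ℕ} {Q Q' : State → Prop}

theorem mono (h : Runs W p s T Q) (hT : T ≤ T') (hQ : ∀ s', Agree p s s' → Q s' → Q' s') :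
    Runs W p s T' Q' := by
  obtain ⟨t, s', he, ht, hq⟩ := h
  exact ⟨t, s', he, ht.trans hT, hQ s' he.agree hq⟩

theorem seq {T₁ T₂ : ℕ}
    (h : Runs W p s T₁ fun s₁ => Agree p s s₁ → Runs W q s₁ T₂ Q) :
    Runs W (.seq p q) s (T₁ + T₂) Q := by
  obtain ⟨t, s₁, he, ht, hq⟩ := h
  obtain ⟨t', s', he', ht', hq'⟩ := hq he.agree
  exact ⟨t + t', s', .seq he he', by omega, hq'⟩

theorem ite {b : BExp} (h₁ : b.Holds W s → Runs W p s T Q) (h₂ : ¬ b.Holds W s → Runs W q s T Q) :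
    Runs W (.ite b p q) s (b.cost + T) Q := by
  by_cases hb : b.Holds W s
  · obtain ⟨t, s', he, ht, hq⟩ := h₁ hb
    exact ⟨_, s', .iteTrue hb he, by omega, hq⟩
  · obtain ⟨t, s', he, ht, hq⟩ := h₂ hb
    exact ⟨_, s', .iteFalse hb he, by omega, hq⟩

/-- Loop-free code always halts, within its size and in the state given by `Cmd.den`. -/
theorem exec_den (hp : p.LoopFree = true) : ∃ t ≤ p.sz, Exec W p s t (p.den W s) := by
  induction p generalizing s with
  | skip => exact ⟨_, le_rfl, .skip s⟩
  | wset x e => exact ⟨_, le_rfl, .wset s x e⟩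
  | wput a i e => exact ⟨_, le_rfl, .wput s a i e⟩
  | rset x e => exact ⟨_, le_rfl, .rset s x e⟩
  | rput a i e => exact ⟨_, le_rfl, .rput s a i e⟩
  | flip x => exact ⟨_, le_rfl, .flip s x⟩
  | seq p q ihp ihq =>
    simp only [Cmd.LoopFree, Bool.and_eq_true] at hp
    obtain ⟨t, ht, h⟩ := ihp (s := s) hp.1
    obtain ⟨t', ht', h'⟩ := ihq (s := p.den W s) hp.2
    exact ⟨_, Nat.add_le_add ht ht', .seq h h'⟩
  | ite b p q ihp ihq =>
    simp only [Cmd.LoopFree, Bool.and_eq_true] at hp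
    by_cases hb : b.Holds W s
    · obtain ⟨t, ht, h⟩ := ihp (s := s) hp.1
      refine ⟨b.cost + t, by simp only [Cmd.sz]; omega, ?_⟩
      rw [Cmd.den, if_pos hb]
      exact .iteTrue hb h
    · obtain ⟨t, ht, h⟩ := ihq (s := s) hp.2
      refine ⟨b.cost + t, by simp only [Cmd.sz]; omega, ?_⟩
      rw [Cmd.den, if_neg hb]
      exact .iteFalse hb h
  | loop b p => simp [Cmd.LoopFree] at hp

theorem flat (hp : p.LoopFree = true) (hQ : Q (p.den W s)) : Runs W p s p.sz Q := by
  obtain ⟨t, ht, h⟩ := exec_den (W := W) (s := s) hp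
  exact ⟨t, _, h, ht, hQ⟩

end Runs

/-- Increment of a word variable. -/
def Cmd.inc (x : ℕ) : Cmd := .wset x (.add (.var x) (.const 1))

/-- The loop `for i = 0, …, b - 1 do p`; here `i` and `b` are the word variables with these
numbers. -/
def Cmd.forUp (i b : ℕ) (p : Cmd) : Cmd :=
  .seq (.wset i (.const 0)) (.loop (.wlt (.var i) (.var b)) (.seq p (.inc i)))

/-- The invariant rule for `for` loops, with a separate time bound for every iteration. The
conditions `hi` and `hb` say that the counter and the bound are not assigned in the body; they hold by
`rfl` for concrete programs. -/
theorem Runs.forUp_sum {W i b : ℕ} {p : Cmd} {s : State} {N : ℕ} {Q : State → Prop}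
    (T : ℕ → ℕ) (I : ℕ → State → Prop) (hi : p.writesW i = false)
    (hb : (Cmd.forUp i b p).writesW b = false)
    (hN : s.wvar b = N) (hW : N < W) (h0 : I 0 (s.setW i 0))
    (hs : ∀ k s', k < N → Agree (.forUp i b p) s s' → s'.wvar i = k → I k s' →
      Runs W p s' (T k) fun s'' => I (k + 1) (s''.setW i (k + 1)))
    (hq : ∀ s', Agree (.forUp i b p) s s' → I N s' → Q s') :
    Runs W (.forUp i b p) s (∑ k ∈ Finset.range N, (T k + 8) + 8) Q := by
  have hib : b ≠ i := by
    rintro rfl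
    simp [Cmd.forUp, Cmd.writesW] at hb
  have hpb : p.writesW b = false := by
    simp [Cmd.forUp, Cmd.writesW, Cmd.inc] at hb
    exact hb.2.1
  have hle : p.WritesLE (.forUp i b p) := by
    simp +contextual [Cmd.WritesLE, Cmd.forUp, Cmd.inc, Cmd.writesW, Cmd.putsW, Cmd.writesR,
      Cmd.putsR, Cmd.tosses]
  have hset : ∀ s' v, Agree (.forUp i b p) s' (s'.setW i v) := fun s' v => by
    refine ⟨fun x hx => ?_, fun _ _ => rfl, fun _ _ => rfl, fun _ _ => rfl, fun _ => rfl⟩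
    simp only [Cmd.forUp, Cmd.writesW, Bool.or_eq_false_iff, beq_eq_false_iff_ne] at hx
    simp [hx.1]
  -- the remaining part of the loop, by induction on the number `d` of remaining iterations
  have key : ∀ d k s', k + d = N → Agree (.forUp i b p) s s' → s'.wvar i = k → I k s' →
      ∃ t s'', Exec W (.loop (.wlt (.var i) (.var b)) (.seq p (.inc i))) s' t s'' ∧
        t ≤ ∑ j ∈ Finset.Ico k N, (T j + 8) + 3 ∧ Agree (.forUp i b p) s s'' ∧ I N s'' := by
    intro d
    induction d with
    | zero =>
      intro k s' hk ha hki hI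
      obtain rfl : k = N := by omega
      have hbN : s'.wvar b = k := (ha.w b hb).trans hN
      refine ⟨_, s', .loopDone ?_, ?_, ha, hI⟩
      · simp [BExp.Holds, WExp.eval, hbN, hki]
      · simp [BExp.cost, WExp.cost]
    | succ d ih =>
      intro k s' hk ha hki hI
      have hkN : k < N := by omega
      have hbN : s'.wvar b = N := (ha.w b hb).trans hN
      obtain ⟨t, s₁, he, ht, hI₁⟩ := hs k s' hkN ha hki hI
      have hk₁ : s₁.wvar i = k := (he.agree.w i hi).trans hki
      have ha₁ : Agree (.forUp i b p) s (s₁.setW i (k + 1)) :=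
        (ha.trans (he.agree.mono hle)).trans (hset s₁ _)
      obtain ⟨t', s₂, he', ht', ha', hI'⟩ := ih (k + 1) (s₁.setW i (k + 1)) (by omega) ha₁
        (by simp) hI₁
      have hinc : Exec W (.inc i) s₁ 4 (s₁.setW i (k + 1)) := by
        have := Exec.wset (W := W) s₁ i (.add (.var i) (.const 1))
        have hev : (WExp.add (.var i) (.const 1)).eval W s₁ = k + 1 := by
          have h1 : 1 % W = 1 := Nat.mod_eq_of_lt (by omega)
          simp only [WExp.eval, hk₁, h1]
          exact Nat.mod_eq_of_lt (by omega)
        rw [hev] at this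
        exact this
      refine ⟨_, s₂, .loopStep ?_ (.seq he hinc) he', ?_, ha', hI'⟩
      · simp [BExp.Holds, WExp.eval, hbN, hki, hkN]
      · have hI : ∑ j ∈ Finset.Ico k N, (T j + 8) =
            (T k + 8) + ∑ j ∈ Finset.Ico (k + 1) N, (T j + 8) := by
          rw [Finset.sum_eq_sum_Ico_succ_bot hkN]
        rw [hI]
        simp only [BExp.cost, WExp.cost]
        omega
  have hz : Exec W (.wset i (.const 0)) s 2 (s.setW i 0) := by
    have := Exec.wset (W := W) s i (.const 0)
    simpa [WExp.eval, WExp.cost, State.setW] using this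
  obtain ⟨t, s', he, ht, ha, hI⟩ := key N 0 (s.setW i 0) (by omega) (hset s 0) (by simp) h0
  refine ⟨_, s', .seq hz he, ?_, hq s' ha hI⟩
  rw [← Finset.range_eq_Ico] at ht
  omega

/-- The invariant rule for `for` loops, with a common time bound for all iterations. -/
theorem Runs.forUp {W i b : ℕ} {p : Cmd} {s : State} {N T : ℕ} {Q : State → Prop}
    (I : ℕ → State → Prop) (hi : p.writesW i = false)
    (hb : (Cmd.forUp i b p).writesW b = false)
    (hN : s.wvar b = N) (hW : N < W) (h0 : I 0 (s.setW i 0))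
    (hs : ∀ k s', k < N → Agree (.forUp i b p) s s' → s'.wvar i = k → I k s' →
      Runs W p s' T fun s'' => I (k + 1) (s''.setW i (k + 1)))
    (hq : ∀ s', Agree (.forUp i b p) s s' → I N s' → Q s') :
    Runs W (.forUp i b p) s (N * (T + 8) + 8) Q := by
  have := Runs.forUp_sum (W := W) (Q := Q) (fun _ => T) I hi hb hN hW h0 hs hq
  simpa using this

end RealRAM

/-! ### The program -/

namespace RealRAM

/- Word variables: the input, the parameters computed by the first phase, and the results of the
procedures. Loop counters and auxiliary variables are written as numerals. -/
notation "wn" => 0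
notation "wm" => 1
notation "wLen" => 2
notation "wN" => 3
notation "wLg" => 4
notation "wH" => 5
notation "wL" => 6
notation "wLgB" => 7
notation "wJ" => 8
notation "wB" => 9
notation "wNN" => 10
notation "wG" => 11
notation "wN1" => 12
notation "wNN1" => 13
notation "wLL" => 14
notation "wHas" => 15
notation "wNeg" => 16
notation "wS" => 17
notation "wNx" => 18
notation "wGr" => 19

/- Word arrays. -/
notation "aSrc₀" => 0
notation "aDst₀" => 1
notation "aOut" => 2
notation "aSrc" => 3
notation "aDst" => 4
notation "aId" => 5
notation "aC" => 6
notation "aMask" => 7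
notation "aNxt" => 8
notation "aPos" => 9
notation "aEs" => 10
notation "aCg" => 11
notation "aAl" => 12
notation "aPend" => 13
notation "aTree" => 14
notation "aWF" => 15

/- Real variables and real arrays. -/
notation "rLo" => 0
notation "rHi" => 1
notation "rQ" => 2
notation "rX" => 3
notation "rY" => 4
notation "fC" => 0
notation "fT" => 1
notation "fP" => 2
notation "fCa" => 3
notation "fCb" => 4
notation "fX" => 5
notation "fWA" => 6
notation "fWB" => 7

namespace Prog

open Cmd

/-- Sequential composition of a list of programs. -/
def block : List Cmd → Cmd
  | [] => .skip
  | [p] => p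
  | p :: q :: l => .seq p (block (q :: l))

/-- The vertices that are incident with an edge are renumbered `0, …, N - 1`. -/
def relabelBody : Cmd := block [
  .ite (.wlt (.get aId (.get aSrc₀ (.var 20))) (.const 1))
    (.seq (.inc wN) (.wput aId (.get aSrc₀ (.var 20)) (.var wN))) .skip,
  .ite (.wlt (.get aId (.get aDst₀ (.var 20))) (.const 1))
    (.seq (.inc wN) (.wput aId (.get aDst₀ (.var 20)) (.var wN))) .skip,
  .wput aSrc (.var 20) (.sub (.get aId (.get aSrc₀ (.var 20))) (.const 1)),
  .wput aDst (.var 20) (.sub (.get aId (.get aDst₀ (.var 20))) (.const 1))]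

/-- Writes the edges of the renumbered graph to the arrays `aSrc` and `aDst`; the cell `v` of `aId`
holds one more than the new number of the vertex `v`, and `0` as long as `v` has no number. -/
def relabel : Cmd := .forUp 20 wm relabelBody

def logBody : Cmd :=
  .ite (.wlt (.var 23) (.var 21))
    (.seq (.wset 23 (.mul (.const 2) (.var 23))) (.inc 24)) .skip

/-- Computes in the variable `24` the binary logarithm, rounded up, of the variable `21`. -/
def logLoop : Cmd := block [.wset 23 (.const 1), .wset 24 (.const 0), .forUp 22 21 logBody]

def rootBody : Cmd :=
  .ite (.wlt (.mul (.mul (.mul (.var 25) (.var 25)) (.mul (.var 25) (.var 25))) (.var wm))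
      (.mul (.var wN) (.var wN)))
    (.inc 25) .skip

/-- Computes in the variable `25` the least `h₀ ≥ 1` with `N ^ 2 ≤ h₀ ^ 4 * m`. -/
def rootLoop : Cmd := .seq (.wset 25 (.const 1)) (.forUp 26 wN rootBody)

/-- Computes the remaining parameters from `h₀`, which is in the variable `25`, and from `wLg`: the
length `h` of the short walks, the number `L` of samples, and the sizes of the tables. The numbers of
candidates are less than `2 ^ wLgB`, and `wJ` rounds of pruning are sufficient. -/
def setParams (q : ℕ) : Cmd := block [
  .wset wH (.mul (.var 25) (.var wLg)),
  .wset wL (.mul (.const q) (.add (.div (.var wN) (.var 25)) (.const 1))),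
  .wset wLgB (.add (.mul (.const 3) (.var wLg)) (.const (3 * q + 5))),
  .wset wJ (.mul (.const 3) (.var wLgB)),
  .wset wNN (.mul (.var wN) (.var wN)),
  .wset wLL (.mul (.var wL) (.var wL)),
  .wset wG (.add (.var wLL) (.const 1)),
  .wset wN1 (.add (.var wN) (.const 1)),
  .wset wNN1 (.mul (.var wN1) (.var wN))]

/-- Computes `wLg` with `2 * n ≤ 2 ^ wLg ≤ 4 * n` and the number `wB` of bits of a vertex. -/
def logs : Cmd := block [
  .wset 21 (.var wn), logLoop, .wset wLg (.add (.var 24) (.const 1)),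
  .wset 21 (.var wN), logLoop, .wset wB (.var 24)]

def bitBody : Cmd :=
  .seq (.flip 30) (.wset 28 (.add (.mul (.const 2) (.var 28)) (.var 30)))

def drawBody : Cmd := block [
  .wset 28 (.const 0),
  .forUp 29 wB bitBody,
  .ite (.wlt (.var 28) (.var wN)) (.wput aC (.var 27) (.var 28)) (.wput aC (.var 27) (.const 0))]

/-- Draws `L` random vertices: each one is a number with `b` random bits if that is a vertex, and
the vertex `0` otherwise. -/
def draw : Cmd := .forUp 27 wL drawBody

/-- The deterministic part of the first phase. -/
def prepare (q : ℕ) : Cmd := block [relabel, logs, rootLoop, setParams q]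

/-- The first phase: it only accesses the word memory. -/
def sample (q : ℕ) : Cmd :=
  .ite (.wlt (.const 0) (.var wm)) (.seq (prepare q) draw) .skip

/-- An edge is put in front of a walk with `k` edges. -/
def nxtBody : Cmd :=
  .ite (.and (.wlt (.const 0) (.get aMask (.var 33)))
      (.wlt (.const 0) (.get aNxt (.add (.mul (.var 32) (.var wN)) (.get aDst (.var 33))))))
    (.wput aNxt (.add (.mul (.add (.var 32) (.const 1)) (.var wN)) (.get aSrc (.var 33)))
      (.add (.var 33) (.const 1))) .skip

/-- `aNxt[k * N + v]` becomes positive if and only if `k` selected edges can be traversed from `v`,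
and then it is one more than the number of the first edge of such a walk. -/
def layers : Cmd := block [
  .forUp 31 wNN1 (.wput aNxt (.var 31) (.const 0)),
  .forUp 31 wN (.wput aNxt (.var 31) (.const 1)),
  .forUp 32 wN (.forUp 33 wm nxtBody)]

/-- Selects a vertex from which a walk with `N` edges starts; such a walk repeats a vertex. -/
def pickBody : Cmd :=
  .ite (.wlt (.const 0) (.get aNxt (.add (.mul (.var wN) (.var wN)) (.var 35))))
    (.wset 34 (.var 35)) .skip

/-- One step along the walk: at a repeated vertex the range of positions of the cycle is stored in
the variables `38` and `39`, and the search is over. -/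
def followBody : Cmd :=
  .ite (.wlt (.var 36) (.const 1))
    (.ite (.wlt (.const 0) (.get aPos (.var 34)))
      (block [.wset 38 (.sub (.get aPos (.var 34)) (.const 1)), .wset 39 (.var 37),
        .wset 36 (.const 1)])
      (block [.wput aPos (.var 34) (.add (.var 37) (.const 1)),
        .wput aEs (.var 37) (.sub (.get aNxt (.add (.mul (.sub (.var wN) (.var 37)) (.var wN))
          (.var 34))) (.const 1)),
        .wset 34 (.get aDst (.get aEs (.var 37)))]))
    .skip

/-- Follows the edges stored in `aNxt` from the vertex in the variable `34` until a vertex is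
repeated. -/
def follow : Cmd := block [
  .forUp 35 wN (.wput aPos (.var 35) (.const 0)),
  .wset 36 (.const 0),
  .forUp 37 wN1 followBody,
  .wset wLen (.sub (.var 39) (.var 38)),
  .forUp 40 wLen (.wput aOut (.var 40) (.get aEs (.add (.var 38) (.var 40))))]

/-- Outputs a simple cycle of edges `e` with `aMask[e] > 0`, or the empty list if there is none. -/
def findCycle : Cmd := block [
  layers,
  .wset 34 (.var wN),
  .forUp 35 wN pickBody,
  .wset wLen (.const 0),
  .ite (.wlt (.var 34) (.var wN)) follow .skip]

/-- Selects all edges. -/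
def fullMask : Cmd := .forUp 41 wm (.wput aMask (.var 41) (.const 1))

/-- `fP[tail] + cost - rQ * time` for the edge in the variable `43`. -/
def relaxed : RExp :=
  .add (.get fP (.get aSrc (.var 43)))
    (.sub (.get fC (.var 43)) (.mul (.var rQ) (.get fT (.var 43))))

/-- Improves the value of the head of an edge, if possible. -/
def relaxBody : Cmd :=
  .ite (.rlt relaxed (.get fP (.get aDst (.var 43))))
    (.rput fP (.get aDst (.var 43)) relaxed) .skip

/-- An edge that can still be used for an improvement reveals a negative cycle. -/
def negBody : Cmd :=
  .ite (.rlt relaxed (.get fP (.get aDst (.var 43)))) (.wset wNeg (.const 1)) .skip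

/-- The algorithm of Bellman and Ford for the weights `cost - rQ * time`: `wNeg` becomes `1` if
there is a negative cycle, and `0` if not; in the latter case `fP` becomes a potential. -/
def bellmanFord : Cmd := block [
  .forUp 42 wN (.rput fP (.var 42) (.const 0)),
  .forUp 42 wN (.forUp 43 wm relaxBody),
  .wset wNeg (.const 0),
  .forUp 43 wm negBody]

/-- The node in the variable `44` of the tournament tree receives the better one of its two
children. -/
def fixNode : Cmd := block [
  .wset 45 (.get aTree (.mul (.const 2) (.var 44))),
  .wset 46 (.get aTree (.add (.mul (.const 2) (.var 44)) (.const 1))),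
  .ite (.wlt (.var 45) (.const 1)) (.wput aTree (.var 44) (.var 46))
    (.ite (.wlt (.var 46) (.const 1)) (.wput aTree (.var 44) (.var 45))
      (.ite (.rlt (.get fX (.sub (.var 46) (.const 1))) (.get fX (.sub (.var 45) (.const 1))))
        (.wput aTree (.var 44) (.var 46)) (.wput aTree (.var 44) (.var 45))))]

/-- The inner nodes of the tournament tree are computed in the order of decreasing numbers. -/
def buildBody : Cmd := block [
  .wset 44 (.sub (.sub (.var wNx) (.const 1)) (.var 47)),
  .ite (.wlt (.const 0) (.var 44)) fixNode .skip]

/-- The parent of the node in the variable `44` is recomputed; above the root nothing is done. -/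
def climbBody : Cmd := block [
  .wset 44 (.div (.var 44) (.const 2)),
  .ite (.wlt (.const 0) (.var 44)) fixNode .skip]

/-- Moves the least number to `rQ`, clears its leaf, and updates the nodes above this leaf. -/
def extractBody : Cmd := block [
  .wset 49 (.sub (.get aTree (.const 1)) (.const 1)),
  .rset rQ (.get fX (.var 49)),
  .wset 44 (.add (.var wNx) (.var 49)),
  .wput aTree (.var 44) (.const 0),
  .forUp 50 wLgB climbBody]

/-- Stores a median of `fX[0], …, fX[wNx - 1]` in `rQ`. The numbers are the leaves of a tournament
tree, from which the least one is removed `wNx / 2 + 1` times. -/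
def median : Cmd := block [
  .forUp 47 wNx (.wput aTree (.add (.var wNx) (.var 47)) (.add (.var 47) (.const 1))),
  .forUp 47 wNx buildBody,
  .wset 51 (.add (.div (.var wNx) (.const 2)) (.const 1)),
  .forUp 48 51 extractBody]

/-- For each live candidate in turn: if its group has a pending candidate, the two form a pair and
`act` is performed, otherwise the candidate becomes pending. -/
def pairBody (act : Cmd) : Cmd :=
  .ite (.wlt (.const 0) (.get aAl (.var 53)))
    (.ite (.wlt (.get aPend (.get aCg (.var 53))) (.const 1))
      (.wput aPend (.get aCg (.var 53)) (.add (.var 53) (.const 1)))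
      (block [
        .wset 54 (.sub (.get aPend (.get aCg (.var 53))) (.const 1)),
        .wput aPend (.get aCg (.var 53)) (.const 0),
        .rset rX (.div (.sub (.get fCa (.var 53)) (.get fCa (.var 54)))
          (.sub (.get fCb (.var 53)) (.get fCb (.var 54)))),
        act]))
    .skip

def clearPend : Cmd := .forUp 52 wGr (.wput aPend (.var 52) (.const 0))

def recordAct : Cmd := .seq (.rput fX (.var wNx) (.var rX)) (.inc wNx)

/-- Discards from the pair consisting of the candidates in the variables `53` and `54` one that is
not smaller than the other on the whole current interval, if the crossing point `rX` of the two
lines is not inside the interval. -/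
def resolveAct : Cmd :=
  .ite (.rlt (.get fCb (.var 53)) (.get fCb (.var 54)))
    (.ite (.and (.wlt (.const 0) (.var wHas)) (.not (.rlt (.var rLo) (.var rX))))
      (.wput aAl (.var 53) (.const 0))
      (.ite (.rlt (.var rX) (.var rHi)) .skip (.wput aAl (.var 54) (.const 0))))
    (.ite (.rlt (.get fCb (.var 54)) (.get fCb (.var 53)))
      (.ite (.and (.wlt (.const 0) (.var wHas)) (.not (.rlt (.var rLo) (.var rX))))
        (.wput aAl (.var 54) (.const 0))
        (.ite (.rlt (.var rX) (.var rHi)) .skip (.wput aAl (.var 53) (.const 0))))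
      (.ite (.rlt (.get fCa (.var 53)) (.get fCa (.var 54)))
        (.wput aAl (.var 54) (.const 0)) (.wput aAl (.var 53) (.const 0))))

/-- Collects the crossing points of all pairs in `fX[0], …, fX[wNx - 1]`. -/
def recordPass : Cmd := block [clearPend, .wset wNx (.const 0), .forUp 53 wS (pairBody recordAct)]

/-- Forms the same pairs again and discards the losers of those that the current interval decides. -/
def resolvePass : Cmd := block [clearPend, .forUp 53 wS (pairBody resolveAct)]

/-- If `rQ` is inside the current interval, the interval is shrunk to the part of it, to the left or
to the right of `rQ`, that contains the minimum ratio. -/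
def shrink : Cmd :=
  .ite (.and (.not (.and (.wlt (.const 0) (.var wHas)) (.not (.rlt (.var rLo) (.var rQ)))))
      (.rlt (.var rQ) (.var rHi)))
    (.seq bellmanFord
      (.ite (.wlt (.const 0) (.var wNeg)) (.rset rHi (.var rQ))
        (.seq (.rset rLo (.var rQ)) (.wset wHas (.const 1)))))
    .skip

/-- One round of prune and search: the test at the median crossing point decides at least half of
the pairs. -/
def pruneBody : Cmd := block [
  recordPass,
  .ite (.wlt (.const 0) (.var wNx)) (.seq median shrink) .skip,
  resolvePass]

def storeBody : Cmd :=
  .ite (.wlt (.const 0) (.get aAl (.var 56)))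
    (block [
      .wput aWF (.get aCg (.var 56)) (.const 1),
      .rput fWA (.get aCg (.var 56)) (.get fCa (.var 56)),
      .rput fWB (.get aCg (.var 56)) (.get fCb (.var 56))])
    .skip

def store : Cmd := block [
  .forUp 57 wGr (.wput aWF (.var 57) (.const 0)),
  .forUp 56 wS storeBody]

/-- Shrinks the interval until each group of candidates has a member that is minimal on the whole
interval, and stores these members in `aWF`, `fWA`, `fWB`. -/
def groupMin : Cmd := block [
  .forUp 56 wS (.wput aAl (.var 56) (.const 1)),
  .forUp 55 wJ pruneBody,
  store]

/-- Appends the line `x ↦ a - x * b` to the list of candidates, as a member of the group `g`. -/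
def push (g : WExp) (a b : RExp) : Cmd := block [
  .wput aCg (.var wS) g, .rput fCa (.var wS) a, .rput fCb (.var wS) b, .inc wS]

/-- Appends the line stored in the cell `i`, if there is one. -/
def pushCell (g i : WExp) : Cmd :=
  .ite (.wlt (.const 0) (.get aWF i)) (push g (.get fWA i) (.get fWB i)) .skip

/-- The cell in the row `x` and the column `y` of a matrix with `l` columns. -/
def cell (x l : ℕ) (y : WExp) : WExp := .add (.mul (.var x) (.var l)) y

/-- The minimal walks without edges. -/
def startStage : Cmd := block [
  .wset wS (.const 0),
  .forUp 58 wN (push (cell 58 wN (.var 58)) (.const 0) (.const 0)),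
  .wset wGr (.var wNN),
  groupMin]

def extendBody : Cmd :=
  .ite (.wlt (.const 0) (.get aWF (cell 58 wN (.get aSrc (.var 59)))))
    (push (cell 58 wN (.get aDst (.var 59)))
      (.add (.get fWA (cell 58 wN (.get aSrc (.var 59)))) (.get fC (.var 59)))
      (.add (.get fWB (cell 58 wN (.get aSrc (.var 59)))) (.get fT (.var 59))))
    .skip

/-- From the minimal walks with at most `k` edges to those with at most `k + 1` edges. -/
def extendStage : Cmd := block [
  .wset wS (.const 0),
  .forUp 58 wNN (pushCell (.var 58) (.var 58)),
  .forUp 58 wN (.forUp 59 wm extendBody),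
  .wset wGr (.var wNN),
  groupMin]

def restrictBody : Cmd :=
  pushCell (cell 58 wL (.var 59))
    (.add (.mul (.get aC (.var 58)) (.var wN)) (.get aC (.var 59)))

/-- Keeps the minimal walks between the sampled vertices, and in the last cell the minimal one of
all closed walks. -/
def restrictStage : Cmd := block [
  .wset wS (.const 0),
  .forUp 58 wL (.forUp 59 wL restrictBody),
  .forUp 58 wN (pushCell (.var wLL) (cell 58 wN (.var 58))),
  .wset wGr (.var wG),
  groupMin]

def squareBody : Cmd :=
  .ite (.and (.wlt (.const 0) (.get aWF (cell 58 wL (.var 60))))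
      (.wlt (.const 0) (.get aWF (cell 60 wL (.var 59)))))
    (push (cell 58 wL (.var 59))
      (.add (.get fWA (cell 58 wL (.var 60))) (.get fWA (cell 60 wL (.var 59))))
      (.add (.get fWB (cell 58 wL (.var 60))) (.get fWB (cell 60 wL (.var 59)))))
    .skip

/-- Replaces the matrix of the walks between the sampled vertices by its square with respect to
minimum and addition. -/
def squareStage : Cmd := block [
  .wset wS (.const 0),
  .forUp 58 wL (.forUp 59 wL (.forUp 60 wL squareBody)),
  pushCell (.var wLL) (.var wLL),
  .wset wGr (.var wG),
  groupMin]

/-- The minimal one of all closed walks found. -/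
def closeStage : Cmd := block [
  .wset wS (.const 0),
  .forUp 58 wL (pushCell (.const 0) (cell 58 wL (.var 58))),
  pushCell (.const 0) (.var wLL),
  .wset wGr (.var wG),
  groupMin]

def ratioBody : Cmd :=
  .seq (.rset rX (.add (.var rX) (.get fC (.get aOut (.var 61)))))
    (.rset rY (.add (.var rY) (.get fT (.get aOut (.var 61)))))

/-- The initial interval: it is unbounded to the left, and its right end point is greater than
the ratio of a known cycle. -/
def initInterval : Cmd := block [
  .rset rX (.const 0), .rset rY (.const 0),
  .forUp 61 wLen ratioBody,
  .rset rHi (.add (.div (.var rX) (.var rY)) (.const 1)),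
  .wset wHas (.const 0)]

/-- Selects an edge if and only if it is tight. -/
def tightBody : Cmd :=
  .ite (.rlt (.get fP (.get aDst (.var 43))) relaxed)
    (.wput aMask (.var 43) (.const 0)) (.wput aMask (.var 43) (.const 1))

/-- Outputs a cycle of edges that are tight with respect to the potential for the left end point of
the interval, or any cycle if there is no such cycle. -/
def finish : Cmd := block [
  .rset rQ (.var rLo),
  bellmanFord,
  .forUp 43 wm tightBody,
  findCycle,
  .ite (.wlt (.var wLen) (.const 1)) (.seq fullMask findCycle) .skip]

/-- All stages of the parametric search: minimal walks with at most `h` edges between any two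
vertices, then walks between sampled vertices with at most `2 ^ lg` short pieces, and at last closed
walks. -/
def stages : Cmd := block [
  startStage,
  .forUp 62 wH extendStage,
  restrictStage,
  .forUp 62 wLg squareStage,
  closeStage]

/-- The second phase: it is deterministic. -/
def search : Cmd :=
  .ite (.wlt (.const 0) (.var wm))
    (block [
      fullMask,
      findCycle,
      .ite (.wlt (.const 0) (.var wLen)) (block [initInterval, stages, finish]) .skip])
    .skip

end Prog

end RealRAM

/-! ### Walks and cycles -/

/-- A directed graph with vertices `0, …, N - 1` and edges `0, …, m - 1`, as it is stored in
arrays. The values of the functions at other numbers are irrelevant. -/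
structure Net where
  N : ℕ
  m : ℕ
  src : ℕ → ℕ
  dst : ℕ → ℕ
  c : ℕ → ℝ
  t : ℕ → ℝ
  src_lt : ∀ e < m, src e < N
  dst_lt : ∀ e < m, dst e < N

namespace Net

variable (G : Net)

/-- `l` is the list of the edges of a walk from `u` to `v`. -/
def Walk (u : ℕ) (l : List ℕ) (v : ℕ) : Prop :=
  (∀ e ∈ l, e < G.m) ∧ u :: l.map G.dst = l.map G.src ++ [v]

/-- `l` is the list of the edges of a simple cycle. -/
def Cyc (l : List ℕ) : Prop :=
  l ≠ [] ∧ (∃ u, G.Walk u l u) ∧ (l.map G.src).Nodup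

/-- Total cost. -/
def costSum (l : List ℕ) : ℝ := (l.map G.c).sum

/-- Total transit time. -/
def timeSum (l : List ℕ) : ℝ := (l.map G.t).sum

/-- The weight of an edge for the parameter `x`. -/
def w (x : ℝ) (e : ℕ) : ℝ := G.c e - x * G.t e

/-- The weight of a list of edges for the parameter `x`. -/
def wt (x : ℝ) (l : List ℕ) : ℝ := G.costSum l - x * G.timeSum l

/-- There is a simple cycle of negative weight. -/
def Neg (x : ℝ) : Prop := ∃ l, G.Cyc l ∧ G.wt x l < 0

/-- `p` is a feasible potential for the parameter `x`. -/
def Feasible (x : ℝ) (p : ℕ → ℝ) : Prop := ∀ e < G.m, p (G.dst e) ≤ p (G.src e) + G.w x e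

variable {G}

@[simp] theorem costSum_nil : G.costSum [] = 0 := rfl
@[simp] theorem timeSum_nil : G.timeSum [] = 0 := rfl
@[simp] theorem costSum_cons (e l) : G.costSum (e :: l) = G.c e + G.costSum l := by simp [costSum]
@[simp] theorem timeSum_cons (e l) : G.timeSum (e :: l) = G.t e + G.timeSum l := by simp [timeSum]
@[simp] theorem costSum_append (l l') : G.costSum (l ++ l') = G.costSum l + G.costSum l' := by
  simp [costSum]
@[simp] theorem timeSum_append (l l') : G.timeSum (l ++ l') = G.timeSum l + G.timeSum l' := by
  simp [timeSum]
@[simp] theorem wt_nil (x) : G.wt x [] = 0 := by simp [wt, costSum, timeSum]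
@[simp] theorem wt_cons (x e l) : G.wt x (e :: l) = G.w x e + G.wt x l := by
  simp only [wt, w, costSum_cons, timeSum_cons]; ring
@[simp] theorem wt_append (x l l') : G.wt x (l ++ l') = G.wt x l + G.wt x l' := by
  simp only [wt, costSum_append, timeSum_append]; ring

theorem walk_nil {u v : ℕ} : G.Walk u [] v ↔ u = v := by simp [Walk]

theorem walk_cons {u e v : ℕ} {l : List ℕ} :
    G.Walk u (e :: l) v ↔ e < G.m ∧ u = G.src e ∧ G.Walk (G.dst e) l v := by
  simp only [Walk, List.mem_cons, forall_eq_or_imp, List.map_cons, List.cons_append,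
    List.cons.injEq]
  tauto

theorem Walk.append {u v x : ℕ} {l l' : List ℕ} (h : G.Walk u l v) (h' : G.Walk v l' x) :
    G.Walk u (l ++ l') x := by
  induction l generalizing u with
  | nil => rw [walk_nil] at h; subst h; exact h'
  | cons e l ih =>
    rw [walk_cons] at h
    rw [List.cons_append, walk_cons]
    exact ⟨h.1, h.2.1, ih h.2.2⟩

theorem walk_append {u x : ℕ} {l l' : List ℕ} :
    G.Walk u (l ++ l') x ↔ ∃ v, G.Walk u l v ∧ G.Walk v l' x := by
  refine ⟨fun h => ?_, fun ⟨v, h, h'⟩ => h.append h'⟩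
  induction l generalizing u with
  | nil => exact ⟨u, walk_nil.2 rfl, h⟩
  | cons e l ih =>
    rw [List.cons_append, walk_cons] at h
    obtain ⟨v, h₁, h₂⟩ := ih h.2.2
    exact ⟨v, walk_cons.2 ⟨h.1, h.2.1, h₁⟩, h₂⟩

theorem walk_single {e : ℕ} (he : e < G.m) : G.Walk (G.src e) [e] (G.dst e) :=
  walk_cons.2 ⟨he, rfl, walk_nil.2 rfl⟩

theorem walk_concat {u v e : ℕ} {l : List ℕ} :
    G.Walk u (l ++ [e]) v ↔ e < G.m ∧ v = G.dst e ∧ G.Walk u l (G.src e) := by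
  rw [walk_append]
  constructor
  · rintro ⟨x, h, h'⟩
    rw [walk_cons, walk_nil] at h'
    obtain ⟨he, rfl, rfl⟩ := h'
    exact ⟨he, rfl, h⟩
  · rintro ⟨he, rfl, h⟩
    exact ⟨_, h, walk_single he⟩

theorem Walk.le_of_feasible {x : ℝ} {p : ℕ → ℝ} (hp : G.Feasible x p) {u v : ℕ} {l : List ℕ}
    (h : G.Walk u l v) : p v ≤ p u + G.wt x l := by
  induction l generalizing u with
  | nil => rw [walk_nil] at h; simp [h]
  | cons e l ih =>
    rw [walk_cons] at h
    obtain ⟨he, rfl, h⟩ := h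
    have := ih h
    have := hp e he
    simp only [wt_cons]
    linarith

/-- A simple path: no vertex is repeated, including the last one. -/
def SimplePath (u : ℕ) (l : List ℕ) (v : ℕ) : Prop :=
  G.Walk u l v ∧ (l.map G.src ++ [v]).Nodup

theorem SimplePath.length_lt {u v : ℕ} {l : List ℕ} (h : G.SimplePath u l v) (hv : v < G.N) :
    l.length < G.N := by
  have hsub : (l.map G.src ++ [v]).toFinset ⊆ Finset.range G.N := by
    intro x hx
    simp only [List.mem_toFinset, List.mem_append, List.mem_map, List.mem_singleton] at hx
    rcases hx with ⟨e, he, rfl⟩ | rfl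
    · exact Finset.mem_range.2 (G.src_lt e (h.1.1 e he))
    · exact Finset.mem_range.2 hv
  have := Finset.card_le_card hsub
  rw [List.toFinset_card_of_nodup h.2] at this
  simp at this
  omega

/-- If there is no negative simple cycle, then every walk is at least as long as some simple path
with the same ends: when an appended edge closes a cycle, this cycle is removed. -/
theorem exists_simplePath {x : ℝ} (hx : ¬ G.Neg x) {u v : ℕ} {l : List ℕ} (h : G.Walk u l v) :
    ∃ l', G.SimplePath u l' v ∧ G.wt x l' ≤ G.wt x l := by
  induction l using List.reverseRecOn generalizing v with
  | nil => exact ⟨[], ⟨h, by simp⟩, le_rfl⟩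
  | append_singleton l e ih =>
    rw [walk_concat] at h
    obtain ⟨he, rfl, h⟩ := h
    obtain ⟨l', ⟨hl', hnd⟩, hle⟩ := ih h
    have hw : G.Walk u (l' ++ [e]) (G.dst e) := walk_concat.2 ⟨he, rfl, hl'⟩
    by_cases hmem : G.dst e ∈ l'.map G.src ++ [G.src e]
    · -- the path up to the first visit of the head of `e`, and the cycle closed by `e`
      have hmem' : G.dst e ∈ (l' ++ [e]).map G.src := by simpa using hmem
      obtain ⟨f, hf, hfe⟩ := List.mem_map.1 hmem'
      obtain ⟨l₁, l₂, hl⟩ := List.append_of_mem hf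
      have hnd' : ((l' ++ [e]).map G.src).Nodup := by simpa using hnd
      rw [hl] at hnd' hw
      obtain ⟨y, hy₁, hy₂⟩ := walk_append.1 hw
      have hy : y = G.dst e := by rw [(walk_cons.1 hy₂).2.1, hfe]
      subst hy
      have hcyc : G.Cyc (f :: l₂) := by
        refine ⟨by simp, ⟨_, hy₂⟩, ?_⟩
        rw [List.map_append] at hnd'
        exact hnd'.of_append_right
      have hwt : 0 ≤ G.wt x (f :: l₂) := by
        by_contra hneg
        exact hx ⟨_, hcyc, not_le.1 hneg⟩
      refine ⟨l₁, ⟨hy₁, ?_⟩, ?_⟩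
      · refine hnd'.sublist ?_
        rw [List.map_append, List.map_cons, hfe]
        exact (List.Sublist.refl _).append (by simp)
      · have : G.wt x (l' ++ [e]) = G.wt x l₁ + G.wt x (f :: l₂) := by rw [hl, wt_append]
        rw [wt_append] at this ⊢
        linarith
    · refine ⟨l' ++ [e], ⟨hw, ?_⟩, ?_⟩
      · rw [List.map_append, List.map_singleton, List.nodup_append]
        refine ⟨hnd, by simp, ?_⟩
        intro a ha b hb hab
        rw [List.mem_singleton] at hb
        subst hb
        exact hmem (hab ▸ ha)
      · simp only [wt_append]; linarith

/-- The values found by the algorithm of Bellman and Ford after sufficiently many rounds are a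
feasible potential, unless there is a negative cycle. -/
theorem feasible_of_rounds {x : ℝ} (hx : ¬ G.Neg x) {p : ℕ → ℝ}
    (h₁ : ∀ v < G.N, ∃ u l, G.Walk u l v ∧ p v = G.wt x l)
    (h₂ : ∀ v < G.N, ∀ u l, G.Walk u l v → l.length ≤ G.N → p v ≤ G.wt x l) :
    G.Feasible x p := by
  intro e he
  obtain ⟨u, l, hl, hp⟩ := h₁ _ (G.src_lt e he)
  obtain ⟨l', hl', hle⟩ := exists_simplePath hx (walk_concat.2 ⟨he, rfl, hl⟩)
  have := h₂ _ (G.dst_lt e he) u l' hl'.1 (hl'.length_lt (G.dst_lt e he)).le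
  simp only [wt_append, wt_cons, wt_nil] at hle
  linarith

/-- If there is no negative simple cycle, then there is no negative closed walk. -/
theorem Walk.wt_nonneg {x : ℝ} (hx : ¬ G.Neg x) {u : ℕ} {l : List ℕ} (h : G.Walk u l u) :
    0 ≤ G.wt x l := by
  obtain ⟨l', ⟨hl', hnd⟩, hle⟩ := exists_simplePath hx h
  cases l' with
  | nil => simpa using hle
  | cons e l' =>
    simp [← (walk_cons.1 hl').2.1] at hnd

theorem not_neg_of_feasible {x : ℝ} {p : ℕ → ℝ} (hp : G.Feasible x p) : ¬ G.Neg x := by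
  rintro ⟨l, ⟨_, ⟨u, hu⟩, _⟩, hl⟩
  have := hu.le_of_feasible hp
  linarith

theorem Cyc.lt {l : List ℕ} (h : G.Cyc l) : ∀ e ∈ l, e < G.m := by
  obtain ⟨_, ⟨u, hu⟩, _⟩ := h
  exact hu.1

theorem Cyc.length_le {l : List ℕ} (h : G.Cyc l) : l.length ≤ G.N := by
  have hsub : (l.map G.src).toFinset ⊆ Finset.range G.N := by
    intro x hx
    simp only [List.mem_toFinset, List.mem_map] at hx
    obtain ⟨e, he, rfl⟩ := hx
    exact Finset.mem_range.2 (G.src_lt e (h.lt e he))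
  have := Finset.card_le_card hsub
  rw [List.toFinset_card_of_nodup h.2.2] at this
  simpa using this

/-- All edges of a walk are tight if the potential grows by at least its weight; in particular this
holds for a closed walk of weight zero. -/
theorem tight_of_feasible {x : ℝ} {p : ℕ → ℝ} (hp : G.Feasible x p) {u v : ℕ} {l : List ℕ}
    (h : G.Walk u l v) (h0 : p u + G.wt x l ≤ p v) :
    ∀ e ∈ l, p (G.dst e) = p (G.src e) + G.w x e := by
  induction l generalizing u with
  | nil => simp
  | cons e l ih =>
    rw [walk_cons] at h
    obtain ⟨he, rfl, h⟩ := h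
    have h₁ := hp e he
    have h₂ := h.le_of_feasible hp
    simp only [wt_cons] at h0
    intro f hf
    rcases List.mem_cons.1 hf with rfl | hf
    · linarith
    · exact ih h (by linarith) f hf

/-- In particular a closed walk of tight edges has weight zero. -/
theorem wt_of_tight {x : ℝ} {p : ℕ → ℝ} {u v : ℕ} {l : List ℕ} (h : G.Walk u l v)
    (ht : ∀ e ∈ l, p (G.dst e) = p (G.src e) + G.w x e) : G.wt x l = p v - p u := by
  induction l generalizing u with
  | nil => rw [walk_nil] at h; simp [h]
  | cons e l ih =>
    rw [walk_cons] at h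
    obtain ⟨he, rfl, h⟩ := h
    have h₁ := ht e (by simp)
    have h₂ := ih h fun f hf => ht f (by simp [hf])
    simp only [wt_cons]
    linarith

end Net

/-! ### The negative cycle test -/

namespace RealRAM

/-- The parameters computed in the first phase: the exponent `lg` of a power of two above the number
of vertices, the length `h` of the short walks, the number `L` of samples, a bound `lgB` for the
logarithms of the numbers of candidates, and the samples `C 0, …, C (L - 1)`. -/
structure Params where
  lg : ℕ
  h : ℕ
  L : ℕ
  lgB : ℕ
  C : ℕ → ℕ

/-- The bounds on the parameters that exclude overflows, for words below `W`. -/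
structure Params.Ok (W : ℕ) (G : Net) (P : Params) : Prop where
  N_pos : 0 < G.N
  m_pos : 0 < G.m
  C_lt : ∀ a < P.L, P.C a < G.N
  lg_lt : P.lg < W
  h_lt : P.h < W
  J_lt : 3 * P.lgB < W
  edges_lt : (G.N + 1) * (G.N + G.m) < 2 ^ P.lgB
  samples_lt : P.L * P.L * P.L + P.L * P.L + P.L + 1 < 2 ^ P.lgB
  pow_le : 4 * 2 ^ P.lgB ≤ W

/-- The graph `G` and the parameters `P` are stored in the memory. -/
structure Env (G : Net) (P : Params) (s : State) : Prop where
  N : s.wvar wN = G.N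
  m : s.wvar wm = G.m
  src : s.warr aSrc = G.src
  dst : s.warr aDst = G.dst
  c : s.rarr fC = G.c
  t : s.rarr fT = G.t
  C : s.warr aC = P.C
  lg : s.wvar wLg = P.lg
  h : s.wvar wH = P.h
  L : s.wvar wL = P.L
  lgB : s.wvar wLgB = P.lgB
  J : s.wvar wJ = 3 * P.lgB
  NN : s.wvar wNN = G.N * G.N
  cells : s.wvar wG = P.L * P.L + 1
  N1 : s.wvar wN1 = G.N + 1
  NN1 : s.wvar wNN1 = (G.N + 1) * G.N
  LL : s.wvar wLL = P.L * P.L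

/-- The program does not write the memory described by `Env`. -/
def Cmd.keeps (p : Cmd) : Bool :=
  [wN, wm, wLg, wH, wL, wLgB, wJ, wNN, wG, wN1, wNN1, wLL].all (fun x => !p.writesW x) &&
    [aSrc, aDst, aC].all (fun a => !p.putsW a) && [fC, fT].all (fun a => !p.putsR a)

theorem Env.agree {G : Net} {P : Params} {p : Cmd} {s s' : State} (h : Env G P s)
    (ha : Agree p s s') (hp : p.keeps = true) : Env G P s' := by
  simp only [Cmd.keeps, List.all_cons, List.all_nil, Bool.and_true, Bool.and_eq_true,
    Bool.not_eq_true'] at hp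
  obtain ⟨⟨⟨h1, h2, h3, h4, h5, h6, h7, h8, h9, h10, h11, h12⟩, h13, h14, h15⟩, h16, h17⟩ := hp
  exact ⟨(ha.w _ h1).trans h.N, (ha.w _ h2).trans h.m, (ha.wa _ h13).trans h.src,
    (ha.wa _ h14).trans h.dst, (ha.ra _ h16).trans h.c, (ha.ra _ h17).trans h.t,
    (ha.wa _ h15).trans h.C, (ha.w _ h3).trans h.lg, (ha.w _ h4).trans h.h,
    (ha.w _ h5).trans h.L, (ha.w _ h6).trans h.lgB, (ha.w _ h7).trans h.J,
    (ha.w _ h8).trans h.NN, (ha.w _ h9).trans h.cells, (ha.w _ h10).trans h.N1,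
    (ha.w _ h11).trans h.NN1, (ha.w _ h12).trans h.LL⟩

section

variable {W : ℕ} {G : Net} {P : Params}

theorem Params.Ok.N_lt (hP : P.Ok W G) : G.N < W := by
  have := hP.edges_lt; have := hP.pow_le; nlinarith [hP.m_pos]

theorem Params.Ok.m_lt (hP : P.Ok W G) : G.m < W := by
  have := hP.edges_lt; have := hP.pow_le; nlinarith [hP.m_pos]

theorem Params.Ok.one_mod (hP : P.Ok W G) : 1 % W = 1 :=
  Nat.mod_eq_of_lt (by have := hP.N_lt; have := hP.N_pos; omega)

open Prog

theorem eval_relaxed (hE : Env G P s) :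
    relaxed.eval W s = s.rarr fP (G.src (s.wvar 43)) + G.w (s.rvar rQ) (s.wvar 43) := by
  simp [relaxed, RExp.eval, WExp.eval, hE.src, hE.c, hE.t, Net.w]

/-- After `k` rounds the value of a vertex is the weight of some walk to it, and not more than the
weight of any walk to it with at most `k` edges. -/
theorem runs_bellmanFord {s : State} (hP : P.Ok W G) (hE : Env G P s) :
    Runs W bellmanFord s ((relaxBody.sz + negBody.sz + 100) * (G.N * G.m + G.N + G.m + 1))
      fun s' => (s'.wvar wNeg = 1 ∧ G.Neg (s.rvar rQ)) ∨
        (s'.wvar wNeg = 0 ∧ G.Feasible (s.rvar rQ) (s'.rarr fP)) := by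
  set x := s.rvar rQ with hx
  refine Runs.mono (Runs.seq (T₂ := G.N * (G.m * (relaxBody.sz + 8) + 8 + 8) + 8 +
    (2 + (G.m * (negBody.sz + 8) + 8))) (Runs.forUp (T := 3)
    (fun k s' => ∀ v < k, s'.rarr fP v = 0) rfl rfl hE.N hP.N_lt (by simp) ?_
    fun s₁ _ hI ha₁ => ?_)) ?_ fun _ _ h => h
  rotate_left
  · -- the rounds
    have hE₁ : Env G P s₁ := hE.agree ha₁ rfl
    have hx₁ : s₁.rvar rQ = x := ha₁.r _ rfl
    refine Runs.seq (Runs.forUp (T := G.m * (relaxBody.sz + 8) + 8) (fun k s' =>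
      (∀ v < G.N, ∃ u l, G.Walk u l v ∧ s'.rarr fP v = G.wt x l) ∧
      ∀ v < G.N, ∀ u l, G.Walk u l v → l.length ≤ k → s'.rarr fP v ≤ G.wt x l) rfl rfl hE₁.N
      hP.N_lt ⟨fun v hv => ⟨v, [], Net.walk_nil.2 rfl, by simpa using hI v hv⟩, ?_⟩ ?_
      fun s₂ ha₂ hI₂ ha₂' => ?_)
    · intro v hv u l hl h0
      rw [Nat.le_zero, List.length_eq_zero_iff] at h0
      simp [h0, hI v hv]
    · intro k s' hk ha' _ ⟨h₁, h₂⟩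
      have hE' : Env G P s' := hE₁.agree ha' rfl
      have hx' : s'.rvar rQ = x := (ha'.r _ rfl).trans hx₁
      -- within a round the values only decrease, and the first `j` edges have been relaxed with
      -- respect to the values before the round
      refine Runs.forUp (fun j s'' =>
        (∀ v < G.N, ∃ u l, G.Walk u l v ∧ s''.rarr fP v = G.wt x l) ∧
        (∀ v, s''.rarr fP v ≤ s'.rarr fP v) ∧
        ∀ e < j, s''.rarr fP (G.dst e) ≤ s'.rarr fP (G.src e) + G.w x e) rfl rfl hE'.m hP.m_lt
        ⟨by simpa using h₁, by simp, by simp⟩ ?_ ?_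
      · intro j s'' hj ha'' hj'' ⟨i₁, i₂, i₃⟩
        have hE'' : Env G P s'' := hE'.agree ha'' rfl
        have hx'' : s''.rvar rQ = x := (ha''.r _ rfl).trans hx'
        refine Runs.flat rfl ?_
        have hev := eval_relaxed (W := W) hE''
        rw [hj'', hx''] at hev
        simp only [relaxBody, Cmd.den, BExp.Holds, hev, RExp.eval, WExp.eval, hj'', hE''.dst]
        split_ifs with hlt
        · simp only [State.setW_rarr, State.putR_rarr, if_true, Function.update_apply]
          obtain ⟨u, l, hl, hp⟩ := i₁ _ (G.src_lt j hj)
          have hle : s''.rarr fP (G.src j) + G.w x j ≤ s'.rarr fP (G.src j) + G.w x j := by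
            have := i₂ (G.src j); linarith
          refine ⟨fun v hv => ?_, fun v => ?_, fun e he => ?_⟩
          · split_ifs with hv'
            · exact ⟨u, l ++ [j], Net.walk_concat.2 ⟨hj, hv', hl⟩, by simp [hp]⟩
            · exact i₁ v hv
          · split_ifs with hv'
            · rw [hv']; exact hlt.le.trans (i₂ _)
            · exact i₂ v
          · rcases Nat.lt_succ_iff_lt_or_eq.1 he with he | rfl
            · split_ifs with hv'
              · have := i₃ e he
                rw [hv'] at this
                linarith
              · exact i₃ e he
            · simpa using hle
        · refine ⟨by simpa using i₁, by simpa using i₂, fun e he => ?_⟩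
          simp only [State.setW_rarr]
          rcases Nat.lt_succ_iff_lt_or_eq.1 he with he | rfl
          · exact i₃ e he
          · have := i₂ (G.src e); linarith
      · rintro s'' ha'' ⟨i₁, i₂, i₃⟩
        refine ⟨by simpa using i₁, fun v hv u l hl hk => ?_⟩
        simp only [State.setW_rarr]
        rcases List.eq_nil_or_concat' l with rfl | ⟨l', e, rfl⟩
        · exact (i₂ v).trans (h₂ v hv u _ hl (by simp))
        · obtain ⟨he, rfl, hl'⟩ := Net.walk_concat.1 hl
          have := h₂ _ (G.src_lt e he) u l' hl' (by simpa using hk)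
          have := i₃ e he
          simp only [Net.wt_append, Net.wt_cons, Net.wt_nil]
          linarith
    · have hE₂ : Env G P s₂ := hE₁.agree ha₂ rfl
      have hx₂ : s₂.rvar rQ = x := (ha₂.r _ rfl).trans hx₁
      refine Runs.seq (Runs.flat rfl fun ha₃ => ?_)
      have hE₃ := hE₂.agree ha₃ rfl
      set s₃ := (Cmd.wset wNeg (.const 0)).den W s₂ with hs₃
      -- the final pass checks feasibility
      refine Runs.forUp (T := negBody.sz) (fun j s' =>
        (s'.wvar wNeg = 1 ∧ ¬ G.Feasible x (s₂.rarr fP)) ∨ (s'.wvar wNeg = 0 ∧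
          ∀ e < j, s₂.rarr fP (G.dst e) ≤ s₂.rarr fP (G.src e) + G.w x e)) rfl rfl hE₃.m hP.m_lt
          ?_ ?_ ?_
      · right; simp [hs₃, Cmd.den, WExp.eval]
      · intro j s' hj ha' hj' hI'
        have hE' : Env G P s' := hE₃.agree ha' rfl
        have hp' : s'.rarr fP = s₂.rarr fP := ha'.ra _ rfl
        have hx' : s'.rvar rQ = x := (ha'.r _ rfl).trans hx₂
        refine Runs.flat rfl ?_
        have hev := eval_relaxed (W := W) hE'
        rw [hj', hx'] at hev
        simp only [negBody, Cmd.den, BExp.Holds, hev, RExp.eval, WExp.eval, hj', hE'.dst, hp',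
          hP.one_mod]
        split_ifs with hlt
        · left
          refine ⟨by simp, fun hf => ?_⟩
          have := hf j hj
          linarith
        · rcases hI' with hI' | hI'
          · left; simpa using hI'
          · right
            refine ⟨by simpa using hI'.1, fun e he => ?_⟩
            rcases Nat.lt_succ_iff_lt_or_eq.1 he with he | rfl
            · exact hI'.2 e he
            · exact not_lt.1 hlt
      · rintro s' ha' (hI' | hI')
        · left
          refine ⟨hI'.1, ?_⟩
          by_contra hn
          exact hI'.2 (Net.feasible_of_rounds hn hI₂.1 hI₂.2)
        · right
          refine ⟨hI'.1, ?_⟩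
          have : s'.rarr fP = s₂.rarr fP := ha'.ra _ rfl
          rw [this]
          exact hI'.2
  · ring_nf
    omega
  · intro k s' hk _ hk' hI'
    refine Runs.flat rfl ?_
    intro v hv
    simp only [Cmd.den, WExp.eval, RExp.eval, State.setW_rarr, State.putR_rarr, if_true, hk',
      Function.update_apply]
    split_ifs with h
    · simp
    · exact hI' v (by omega)

end

end RealRAM

/-! ### Medians by a tournament -/

namespace RealRAM

namespace Tournament

/-- The better one of two entries of the tree; the entry `0` stands for no number, and the entry
`i + 1` for the number `X i`. -/
noncomputable def better (X : ℕ → ℝ) (a b : ℕ) : ℕ :=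
  if a = 0 then b else if b = 0 then a else if X (b - 1) < X (a - 1) then b else a

/-- The entry `a` is at least as good as the entry `b`. -/
def Beats (X : ℕ → ℝ) (a b : ℕ) : Prop := b = 0 ∨ (a ≠ 0 ∧ X (a - 1) ≤ X (b - 1))

variable {X : ℕ → ℝ} {T : ℕ → ℕ} {nx : ℕ} {R : Finset ℕ}

theorem beats_left (a b : ℕ) : Beats X (better X a b) a := by
  unfold Beats better
  split_ifs with h1 h2 h3
  · exact .inl h1
  · exact .inr ⟨h1, le_rfl⟩
  · exact .inr ⟨h2, h3.le⟩
  · exact .inr ⟨h1, le_rfl⟩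

theorem beats_right (a b : ℕ) : Beats X (better X a b) b := by
  unfold Beats better
  split_ifs with h1 h2 h3
  · by_cases hb : b = 0
    · exact .inl hb
    · exact .inr ⟨hb, le_rfl⟩
  · exact .inl h2
  · exact .inr ⟨h2, le_rfl⟩
  · exact .inr ⟨h1, not_lt.1 h3⟩

theorem Beats.trans {a b c : ℕ} (h : Beats X a b) (h' : Beats X b c) : Beats X a c := by
  rcases h' with h' | ⟨hb, h'⟩
  · exact .inl h'
  · rcases h with h | ⟨ha, h⟩
    · exact absurd h hb
    · exact .inr ⟨ha, h.trans h'⟩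

theorem better_eq (a b : ℕ) : better X a b = a ∨ better X a b = b := by
  unfold better
  split_ifs <;> simp

/-- The leaf for the number `i` has the index `nx + i`; the numbers in `R` have been removed. -/
def Leaves (nx : ℕ) (R : Finset ℕ) (T : ℕ → ℕ) : Prop :=
  ∀ i < nx, T (nx + i) = if i ∈ R then 0 else i + 1

/-- The node `p` contains the better one of its children `2 * p` and `2 * p + 1`. -/
def Local (X : ℕ → ℝ) (T : ℕ → ℕ) (p : ℕ) : Prop := T p = better X (T (2 * p)) (T (2 * p + 1))

/-- If all nodes from `a` on are correct, they contain numbers that have not been removed. -/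
theorem entry {a : ℕ} (hl : Leaves nx R T) (ha : 1 ≤ a)
    (h : ∀ q, a ≤ q → q < nx → Local X T q) {q : ℕ} (hq : a ≤ q) (hq' : q < 2 * nx) :
    T q = 0 ∨ ∃ i < nx, i ∉ R ∧ T q = i + 1 := by
  obtain ⟨d, hd⟩ : ∃ d, d = 2 * nx - q := ⟨_, rfl⟩
  induction d using Nat.strong_induction_on generalizing q with
  | _ d ih =>
    by_cases hqn : q < nx
    · rw [h q hq hqn]
      rcases better_eq (X := X) (T (2 * q)) (T (2 * q + 1)) with h' | h' <;> rw [h']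
      · exact ih _ (by omega) (by omega) (by omega) rfl
      · exact ih _ (by omega) (by omega) (by omega) rfl
    · obtain ⟨i, rfl⟩ := Nat.exists_eq_add_of_le (not_lt.1 hqn)
      have hi : i < nx := by omega
      rw [hl i hi]
      split_ifs with hR
      · exact .inl rfl
      · exact .inr ⟨i, hi, hR, rfl⟩

theorem entry_le {a : ℕ} (hl : Leaves nx R T) (ha : 1 ≤ a)
    (h : ∀ q, a ≤ q → q < nx → Local X T q) {q : ℕ} (hq : a ≤ q) (hq' : q < 2 * nx) :
    T q ≤ nx := by
  rcases entry hl ha h hq hq' with h0 | ⟨i, hi, _, h0⟩ <;> omega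

/-- By induction from the root to the leaves, along the parents `q / 2`. -/
theorem root_beats (h : ∀ q, 1 ≤ q → q < nx → Local X T q) {q : ℕ} (hq : 1 ≤ q)
    (hq' : q < 2 * nx) : Beats X (T 1) (T q) := by
  induction q using Nat.strong_induction_on with
  | _ q ih =>
    by_cases h1 : q = 1
    · subst h1
      by_cases h0 : T 1 = 0
      · exact .inl h0
      · exact .inr ⟨h0, le_rfl⟩
    · have hp := ih (q / 2) (by omega) (by omega) (by omega)
      refine hp.trans ?_
      rw [h (q / 2) (by omega) (by omega)]
      rcases Nat.even_or_odd' q with ⟨r, rfl | rfl⟩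
      · rw [show 2 * r / 2 = r by omega]; exact beats_left _ _
      · rw [show (2 * r + 1) / 2 = r by omega]; exact beats_right _ _

/-- The root contains a least number that has not been removed. -/
theorem root_spec (hl : Leaves nx R T) (h : ∀ q, 1 ≤ q → q < nx → Local X T q)
    (hR : ∃ j < nx, j ∉ R) :
    ∃ i < nx, i ∉ R ∧ T 1 = i + 1 ∧ ∀ j < nx, j ∉ R → X i ≤ X j := by
  obtain ⟨j, hj, hjR⟩ := hR
  have hb : ∀ j < nx, j ∉ R → T 1 ≠ 0 ∧ X (T 1 - 1) ≤ X j := by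
    intro j hj hjR
    have := root_beats h (q := nx + j) (by omega) (by omega)
    rw [hl j hj, if_neg hjR] at this
    rcases this with h0 | ⟨h1, h2⟩
    · omega
    · exact ⟨h1, by simpa using h2⟩
  rcases entry hl le_rfl h (q := 1) le_rfl (by omega) with h0 | ⟨i, hi, hiR, h0⟩
  · exact absurd h0 (hb j hj hjR).1
  · refine ⟨i, hi, hiR, h0, fun j hj hjR => ?_⟩
    have := (hb j hj hjR).2
    simpa [h0] using this

end Tournament

open Prog Tournament

section

variable {W : ℕ} {G : Net} {P : Params}

theorem den_fixNode {s : State} (h2 : 2 < W) (hW : 2 * s.wvar 44 + 1 < W)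
    (hl : s.warr aTree (2 * s.wvar 44) < W) (hr : s.warr aTree (2 * s.wvar 44 + 1) < W) :
    (fixNode.den W s).warr aTree = Function.update (s.warr aTree) (s.wvar 44)
      (better (s.rarr fX) (s.warr aTree (2 * s.wvar 44)) (s.warr aTree (2 * s.wvar 44 + 1))) := by
  have e2 : (2 % W * s.wvar 44) % W = 2 * s.wvar 44 := by
    rw [Nat.mod_eq_of_lt h2]; exact Nat.mod_eq_of_lt (by omega)
  have e1 : 1 % W = 1 := Nat.mod_eq_of_lt (by omega)
  have e3 : (2 * s.wvar 44 + 1) % W = 2 * s.wvar 44 + 1 := Nat.mod_eq_of_lt hW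
  have e4 : ∀ x, x < W → (x - 1) % W = x - 1 := fun x hx => Nat.mod_eq_of_lt (by omega)
  simp only [fixNode, block, Cmd.den, WExp.eval, BExp.Holds, RExp.eval, State.setW_wvar,
    State.setW_warr, State.setW_rarr, better, e1, e2]
  simp only [Nat.reduceEqDiff, if_true, if_false, e2, e3, e4 _ hl,
    e4 _ hr, Nat.lt_one_iff]
  split_ifs <;> simp

/-- Replacing the entry of a node affects only its parent and itself. -/
theorem Tournament.Local.update {X : ℕ → ℝ} {T : ℕ → ℕ} {p q v : ℕ} (h : Local X T q)
    (hqp : q ≠ p) (hq : q ≠ p / 2) : Local X (Function.update T p v) q := by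
  unfold Local at *
  rw [Function.update_of_ne hqp, Function.update_of_ne (by omega), Function.update_of_ne (by omega)]
  exact h

theorem Tournament.local_update_better {X : ℕ → ℝ} {T : ℕ → ℕ} {p : ℕ} (hp : 0 < p) :
    Local X (Function.update T p (better X (T (2 * p)) (T (2 * p + 1)))) p := by
  unfold Local
  rw [Function.update_self, Function.update_of_ne (by omega), Function.update_of_ne (by omega)]

theorem Tournament.Leaves.update {T : ℕ → ℕ} {nx p v : ℕ} {R : Finset ℕ} (h : Leaves nx R T)
    (hp : p < nx) : Leaves nx R (Function.update T p v) := by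
  intro i hi
  rw [Function.update_of_ne (by omega)]
  exact h i hi

/-- The tree is built from the nodes with large indices downwards, so that the children of a node are
correct before the node itself. Afterwards the set `R` of removed numbers consists of `k` least numbers,
and the last removed one is in `rQ`; after `nx / 2 + 1` rounds at least half of the numbers are on
either side of it. -/
theorem runs_median {s : State} {nx : ℕ} (hP : P.Ok W G) (hE : Env G P s)
    (hnx : s.wvar wNx = nx) (hpos : 0 < nx) (hlt : 2 * nx < 2 ^ P.lgB) :
    Runs W median s ((buildBody.sz + 2 * climbBody.sz + 100) * (nx * P.lgB + nx + P.lgB + 1))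
      fun s' => nx ≤ 2 * ((Finset.range nx).filter fun i => s.rarr fX i ≤ s'.rvar rQ).card ∧
        nx ≤ 2 * ((Finset.range nx).filter fun i => s'.rvar rQ ≤ s.rarr fX i).card := by
  set X := s.rarr fX with hX
  have hW : 4 * nx + 7 < W := by
    have := hP.pow_le; omega
  have one : 1 % W = 1 := hP.one_mod
  have two : 2 % W = 2 := Nat.mod_eq_of_lt (by omega)
  refine Runs.mono (T := nx * (7 + 8) + 8 + (nx * (buildBody.sz + 8) + 8 +
    (6 + ((nx / 2 + 1) * (5 + (3 + (4 + (3 + (P.lgB * (climbBody.sz + 8) + 8)))) + 8) + 8)))) ?_ ?_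
    fun _ _ h => h
  · refine Runs.seq (Runs.forUp (fun k s' => ∀ i < k, s'.warr aTree (nx + i) = i + 1) rfl rfl hnx
      (by omega) (by simp) ?_ fun s₁ ha₁ hI₁ _ => ?_)
    · intro k s' hk ha hk' hI
      refine Runs.flat rfl ?_
      have e1 : s'.wvar wNx = nx := (ha.w _ rfl).trans hnx
      intro i hi
      simp (disch := omega) only [Cmd.den, WExp.eval, State.putW_warr, State.setW_warr, e1, hk',
        one, Nat.mod_eq_of_lt, if_true, Function.update_apply]
      split_ifs with h
      · omega
      · exact hI i (by omega)
    have hE₁ := hE.agree ha₁ rfl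
    have hnx₁ : s₁.wvar wNx = nx := (ha₁.w _ rfl).trans hnx
    have hX₁ : s₁.rarr fX = X := ha₁.ra _ rfl
    refine Runs.seq (Runs.forUp (fun k s' => Leaves nx ∅ (s'.warr aTree) ∧
      ∀ q, 1 ≤ q → nx - k ≤ q → q < nx → Local X (s'.warr aTree) q) rfl rfl hnx₁
      (by omega) ⟨by simpa [Leaves] using hI₁, fun q _ _ _ => by omega⟩ ?_ fun s₂ ha₂ hI₂ _ => ?_)
    · intro k s' hk ha hk' ⟨hL, hI⟩
      refine Runs.flat rfl ?_
      have e1 : s'.wvar wNx = nx := (ha.w _ rfl).trans hnx₁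
      have e2 : s'.rarr fX = X := (ha.ra _ rfl).trans hX₁
      simp (disch := omega) only [buildBody, block, Cmd.den, WExp.eval, BExp.Holds,
        State.setW_warr, State.setW_wvar, e1, hk', one, Nat.mod_eq_of_lt, if_true]
      set p := nx - 1 - k with hp
      split_ifs with h0
      · have b1 : s'.warr aTree (2 * p) ≤ nx :=
          entry_le (X := X) (a := p + 1) hL (by omega)
            (fun q h1 h2 => hI q (by omega) (by omega) h2) (by omega) (by omega)
        have b2 : s'.warr aTree (2 * p + 1) ≤ nx :=
          entry_le (X := X) (a := p + 1) hL (by omega)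
            (fun q h1 h2 => hI q (by omega) (by omega) h2) (by omega) (by omega)
        rw [den_fixNode (by omega) (by simp; omega) (by simp; omega) (by simp; omega)]
        simp only [State.setW_warr, State.setW_wvar, State.setW_rarr, if_true, e2]
        refine ⟨hL.update (by omega), fun q h1 h2 h3 => ?_⟩
        by_cases hq : q = p
        · subst hq; exact local_update_better (by omega)
        · exact (hI q h1 (by omega) h3).update hq (by omega)
      · exact ⟨hL, fun q h1 h2 h3 => hI q h1 (by omega) h3⟩
    have hE₂ := hE₁.agree ha₂ rfl
    have hnx₂ : s₂.wvar wNx = nx := (ha₂.w _ rfl).trans hnx₁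
    have hX₂ : s₂.rarr fX = X := (ha₂.ra _ rfl).trans hX₁
    refine Runs.seq (Runs.flat rfl fun ha₃ => ?_)
    set s₃ := (Cmd.wset 51 (.add (.div (.var wNx) (.const 2)) (.const 1))).den W s₂ with hs₃
    have hE₃ := hE₂.agree ha₃ rfl
    have hnx₃ : s₃.wvar wNx = nx := (ha₃.w _ rfl).trans hnx₂
    have hX₃ : s₃.rarr fX = X := (ha₃.ra _ rfl).trans hX₂
    have h51 : s₃.wvar 51 = nx / 2 + 1 := by
      simp (disch := omega) only [hs₃, Cmd.den, WExp.eval, State.setW_wvar, if_true, hnx₂, one,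
        two, Nat.mod_eq_of_lt]
    have hT₃ : s₃.warr aTree = s₂.warr aTree := ha₃.wa _ rfl
    refine Runs.forUp (fun k s' => ∃ R : Finset ℕ, R ⊆ Finset.range nx ∧ R.card = k ∧
      Leaves nx R (s'.warr aTree) ∧ (∀ q, 1 ≤ q → q < nx → Local X (s'.warr aTree) q) ∧
      (∀ i ∈ R, X i ≤ s'.rvar rQ) ∧ (R.Nonempty → ∀ j < nx, j ∉ R → s'.rvar rQ ≤ X j) ∧
      (R.Nonempty → ∃ j ∈ R, s'.rvar rQ ≤ X j))
      rfl rfl h51 (by omega) ⟨∅, by simp, by simp, ?_, ?_, by simp, by simp, by simp⟩ ?_ ?_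
    · simpa [hT₃] using hI₂.1
    · simpa [hT₃] using fun q h1 h2 => hI₂.2 q h1 (by omega) h2
    · rintro k s' hk ha hk' ⟨R, hR, hRk, hL, hLoc, hlow, hup, -⟩
      have e1 : s'.wvar wNx = nx := (ha.w _ rfl).trans hnx₃
      have e2 : s'.rarr fX = X := (ha.ra _ rfl).trans hX₃
      have hE' := hE₃.agree ha rfl
      have hex : ∃ j < nx, j ∉ R := by
        by_contra! hcon
        have : Finset.range nx ⊆ R := fun j hj => hcon j (Finset.mem_range.1 hj)
        have := Finset.card_le_card this
        rw [Finset.card_range, hRk] at this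
        omega
      obtain ⟨i, hi, hiR, hroot, hmin⟩ := root_spec hL hLoc hex
      have i1 : i % W = i := Nat.mod_eq_of_lt (by omega)
      have i2 : (nx + i) % W = nx + i := Nat.mod_eq_of_lt (by omega)
      refine Runs.seq (Runs.flat rfl fun ha₄ => Runs.seq (Runs.flat rfl fun ha₅ =>
        Runs.seq (Runs.flat rfl fun ha₆ => Runs.seq (Runs.flat rfl fun ha₇ => ?_))))
      set s₄ := (Cmd.wset 49 (.sub (.get aTree (.const 1)) (.const 1))).den W s' with hs₄
      set s₅ := (Cmd.rset rQ (.get fX (.var 49))).den W s₄ with hs₅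
      set s₆ := (Cmd.wset 44 (.add (.var wNx) (.var 49))).den W s₅ with hs₆
      set s₇ := (Cmd.wput aTree (.var 44) (.const 0)).den W s₆ with hs₇
      have hw49 : s₄.wvar 49 = i := by
        simp [hs₄, Cmd.den, WExp.eval, one, hroot, i1]
      have hq₇ : s₇.rvar rQ = X i := by
        rw [ha₇.r _ rfl, ha₆.r _ rfl]
        simp [hs₅, Cmd.den, WExp.eval, RExp.eval, hw49, ha₄.ra fX rfl, e2]
      have h44 : s₆.wvar 44 = nx + i := by
        simp [hs₆, Cmd.den, WExp.eval, ha₅.w 49 rfl, hw49, ha₅.w wNx rfl, ha₄.w wNx rfl, e1, i2]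
      have hT₇ : s₇.warr aTree = Function.update (s'.warr aTree) (nx + i) 0 := by
        simp [hs₇, Cmd.den, WExp.eval, h44, ha₆.wa aTree rfl, ha₅.wa aTree rfl, ha₄.wa aTree rfl]
      have hX₇ : s₇.rarr fX = X := by
        rw [ha₇.ra _ rfl, ha₆.ra _ rfl, ha₅.ra _ rfl, ha₄.ra _ rfl, e2]
      have hB₇ : s₇.wvar wLgB = P.lgB := by
        rw [ha₇.w _ rfl, ha₆.w _ rfl, ha₅.w _ rfl, ha₄.w _ rfl, hE'.lgB]
      have hlgW : P.lgB < W := by have := hP.J_lt; omega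
      have hL' : Leaves nx (insert i R) (s₇.warr aTree) := by
        intro j hj
        rw [hT₇, Function.update_apply]
        by_cases hji : j = i
        · simp [hji]
        · rw [if_neg (by omega), hL j hj]
          simp [hji]
      -- after `r` steps of climbing at most the parent of the current node is not up to date
      refine Runs.forUp (fun r s'' => s''.wvar 44 = (nx + i) / 2 ^ r ∧
        Leaves nx (insert i R) (s''.warr aTree) ∧
        ∀ q, 1 ≤ q → q < nx → q ≠ (nx + i) / 2 ^ r / 2 → Local X (s''.warr aTree) q)
        rfl rfl hB₇ hlgW ⟨by simp [ha₇.w 44 rfl, h44], hL', ?_⟩ ?_ ?_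
      · intro q h1 h2 h3
        rw [State.setW_warr, hT₇]
        exact (hLoc q h1 h2).update (by omega) (by simpa using h3)
      · rintro r s'' hr ha'' hr' ⟨j1, j2, j3⟩
        refine Runs.flat rfl ?_
        have e3 : s''.rarr fX = X := (ha''.ra _ rfl).trans hX₇
        have hc : (nx + i) / 2 ^ r ≤ nx + i := Nat.div_le_self _ _
        have hcc : (nx + i) / 2 ^ (r + 1) = (nx + i) / 2 ^ r / 2 := by
          rw [pow_succ, Nat.div_div_eq_div_mul]
        rw [hcc]
        set c := (nx + i) / 2 ^ r with hcdef
        simp (disch := omega) only [climbBody, block, Cmd.den, WExp.eval, BExp.Holds,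
          State.setW_warr, State.setW_wvar, j1, two, Nat.mod_eq_of_lt, if_true, if_false, Nat.reduceEqDiff]
        split_ifs with h0
        · have b1 : s''.warr aTree (2 * (c / 2)) ≤ nx :=
            entry_le (X := X) (a := c / 2 + 1) j2 (by omega)
              (fun q h1 h2 => j3 q (by omega) h2 (by omega)) (by omega) (by omega)
          have b2 : s''.warr aTree (2 * (c / 2) + 1) ≤ nx :=
            entry_le (X := X) (a := c / 2 + 1) j2 (by omega)
              (fun q h1 h2 => j3 q (by omega) h2 (by omega)) (by omega) (by omega)
          rw [den_fixNode (by omega) (by simp; omega) (by simp; omega) (by simp; omega)]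
          refine ⟨?_, ?_⟩
          · have := (Runs.flat (W := W) (s := s''.setW 44 (c / 2)) (p := fixNode)
              (Q := fun s' => s' = fixNode.den W (s''.setW 44 (c / 2))) rfl rfl)
            obtain ⟨_, s₉, he, _, rfl⟩ := this
            simpa using he.agree.w 44 rfl
          simp only [State.setW_warr, State.setW_wvar, State.setW_rarr, if_true, e3]
          refine ⟨j2.update (by omega), fun q h1 h2 h3 => ?_⟩
          by_cases hq : q = c / 2
          · subst hq; exact local_update_better (by omega)
          · exact (j3 q h1 h2 hq).update hq h3
        · exact ⟨by simp, j2, fun q h1 h2 h3 => j3 q h1 h2 (by omega)⟩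
      · rintro s'' ha'' ⟨j1, j2, j3⟩
        -- the climb has passed the root, hence all nodes are correct
        have hz : (nx + i) / 2 ^ P.lgB = 0 := Nat.div_eq_of_lt (by omega)
        have hq'' : s''.rvar rQ = X i := (ha''.r _ rfl).trans hq₇
        refine ⟨insert i R, Finset.insert_subset (Finset.mem_range.2 hi) hR,
          by rw [Finset.card_insert_of_notMem hiR, hRk], j2, fun q h1 h2 => j3 q h1 h2 ?_, ?_, ?_,
          fun _ => ⟨i, Finset.mem_insert_self _ _, by simp [hq'']⟩⟩
        · rw [hz]; omega
        · intro j hj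
          simp only [State.setW_rvar, hq'']
          rcases Finset.mem_insert.1 hj with rfl | hj
          · exact le_rfl
          · exact (hlow j hj).trans (hup ⟨j, hj⟩ i hi hiR)
        · intro _ j hj hjR
          simp only [State.setW_rvar, hq'']
          rw [Finset.mem_insert, not_or] at hjR
          exact hmin j hj hjR.2
    · rintro s' ha ⟨R, hR, hRk, _, _, hlow, hup, hlast⟩
      have hne : R.Nonempty := by rw [← Finset.card_pos]; omega
      constructor
      · have : R ⊆ (Finset.range nx).filter fun i => X i ≤ s'.rvar rQ := fun i hi =>
          Finset.mem_filter.2 ⟨hR hi, hlow i hi⟩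
        have := Finset.card_le_card this
        omega
      · obtain ⟨l, hl, hlX⟩ := hlast hne
        have hsub : insert l (Finset.range nx \ R) ⊆
            (Finset.range nx).filter fun i => s'.rvar rQ ≤ X i := fun i hi => by
          rcases Finset.mem_insert.1 hi with rfl | hi
          · exact Finset.mem_filter.2 ⟨hR hl, hlX⟩
          · rw [Finset.mem_sdiff] at hi
            exact Finset.mem_filter.2 ⟨hi.1, hup hne i (Finset.mem_range.1 hi.1) hi.2⟩
        have := Finset.card_le_card hsub
        rw [Finset.card_insert_of_notMem (by simp [hl]), Finset.card_sdiff_of_subset hR,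
          Finset.card_range, hRk] at this
        omega
  · have h2 : nx / 2 + 1 ≤ 2 * nx := by omega
    have : (nx / 2 + 1) * (5 + (3 + (4 + (3 + (P.lgB * (climbBody.sz + 8) + 8)))) + 8) ≤
      2 * nx * (5 + (3 + (4 + (3 + (P.lgB * (climbBody.sz + 8) + 8)))) + 8) :=
      Nat.mul_le_mul_right _ h2
    refine le_trans (Nat.add_le_add_left (Nat.add_le_add_left (Nat.add_le_add_left
      (Nat.add_le_add_right this 8) 6) _) _) ?_
    ring_nf
    omega

end

end RealRAM

/-! ### Prune and search -/

/-- In the list of the candidates with `al i ≠ 0`, the second, fourth, … member of each group `g`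
is paired with its predecessor; `pend cg al k g` is one more than the member of the group that is
waiting for a partner when the first `k` candidates have been considered, and `0` if there is
none. -/
def pend (cg al : ℕ → ℕ) : ℕ → ℕ → ℕ
  | 0, _ => 0
  | k + 1, g =>
    if al k ≠ 0 ∧ cg k = g then (if pend cg al k g = 0 then k + 1 else 0) else pend cg al k g

/-- The candidate `i` is the second member of a pair. -/
def Paired (cg al : ℕ → ℕ) (i : ℕ) : Prop := al i ≠ 0 ∧ pend cg al i (cg i) ≠ 0

instance (cg al : ℕ → ℕ) : DecidablePred (Paired cg al) := fun _ => instDecidableAnd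

/-- The candidates below `S` that have not been discarded. -/
def live (al : ℕ → ℕ) (S : ℕ) : Finset ℕ := (Finset.range S).filter fun i => al i ≠ 0

section

variable {cg al : ℕ → ℕ}

theorem mem_live {S i : ℕ} : i ∈ live al S ↔ i < S ∧ al i ≠ 0 := by simp [live]

/-- The waiting candidate is a live member of the group. -/
theorem pend_spec {k g : ℕ} (h : pend cg al k g ≠ 0) :
    pend cg al k g - 1 < k ∧ al (pend cg al k g - 1) ≠ 0 ∧ cg (pend cg al k g - 1) = g := by
  induction k with
  | zero => simp [pend] at h
  | succ k ih =>
    rw [pend] at h ⊢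
    split_ifs at h ⊢ with h1 h2
    · exact ⟨by omega, h1.1, h1.2⟩
    · simp at h
    · obtain ⟨i1, i2, i3⟩ := ih h
      exact ⟨by omega, i2, i3⟩

theorem live_succ (k : ℕ) :
    live al (k + 1) = if al k ≠ 0 then insert k (live al k) else live al k := by
  simp only [live, Finset.range_add_one, Finset.filter_insert]

theorem notMem_live (k : ℕ) : k ∉ live al k := by simp [live]

/-- Every live candidate is in a pair or pending. -/
theorem card_live_eq {Gr : ℕ} (hcg : ∀ i, al i ≠ 0 → cg i < Gr) (k : ℕ) :
    (live al k).card = 2 * ((Finset.range k).filter (Paired cg al)).card +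
      ((Finset.range Gr).filter fun g => pend cg al k g ≠ 0).card := by
  induction k with
  | zero => simp [live, pend]
  | succ k ih =>
    rw [live_succ, Finset.range_add_one, Finset.filter_insert]
    by_cases hal : al k ≠ 0
    · rw [if_pos hal, Finset.card_insert_of_notMem (notMem_live k), ih]
      by_cases hp : pend cg al k (cg k) = 0
      · rw [if_neg (by simp [Paired, hp])]
        have : (Finset.range Gr).filter (fun g => pend cg al (k + 1) g ≠ 0) =
            insert (cg k) ((Finset.range Gr).filter fun g => pend cg al k g ≠ 0) := by
          ext g
          rw [Finset.mem_insert, Finset.mem_filter, Finset.mem_filter, Finset.mem_range, pend]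
          by_cases hg : cg k = g
          · subst hg; simp [hal, hp, hcg k hal]
          · simp [hg, Ne.symm hg]
        rw [this, Finset.card_insert_of_notMem (by simp [hp])]
        omega
      · rw [if_pos ⟨hal, hp⟩, Finset.card_insert_of_notMem (by simp)]
        have : insert (cg k) ((Finset.range Gr).filter (fun g => pend cg al (k + 1) g ≠ 0)) =
            ((Finset.range Gr).filter fun g => pend cg al k g ≠ 0) := by
          ext g
          rw [Finset.mem_insert, Finset.mem_filter, Finset.mem_filter, Finset.mem_range, pend]
          by_cases hg : cg k = g
          · subst hg; simp [hp, hcg k hal]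
          · simp [hg, Ne.symm hg]
        rw [← this, Finset.card_insert_of_notMem (by simp [pend, hal, hp])]
        omega
    · rw [if_neg hal, if_neg (by simp [Paired, hal]), ih]
      simp [pend, hal]

theorem card_pend_le (Gr k : ℕ) :
    ((Finset.range Gr).filter fun g => pend cg al k g ≠ 0).card ≤ ((live al k).image cg).card := by
  refine Finset.card_le_card fun g hg => ?_
  obtain ⟨h1, h2, h3⟩ := pend_spec (Finset.mem_filter.1 hg).2
  exact Finset.mem_image.2 ⟨_, mem_live.2 ⟨h1, h2⟩, h3⟩

/-- Every pair has a second member, which is not the only live member of its group. -/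
theorem card_image_add_le (k : ℕ) : ((live al k).image cg).card +
    ((Finset.range k).filter (Paired cg al)).card ≤ (live al k).card := by
  induction k with
  | zero => simp [live]
  | succ k ih =>
    rw [live_succ, Finset.range_add_one, Finset.filter_insert]
    by_cases hal : al k ≠ 0
    · rw [if_pos hal, Finset.card_insert_of_notMem (notMem_live k), Finset.image_insert]
      by_cases hp : pend cg al k (cg k) = 0
      · rw [if_neg (by simp [Paired, hp])]
        have := Finset.card_insert_le (cg k) ((live al k).image cg)
        omega
      · obtain ⟨h1, h2, h3⟩ := pend_spec hp
        rw [if_pos ⟨hal, hp⟩,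
          Finset.insert_eq_of_mem (Finset.mem_image.2 ⟨_, mem_live.2 ⟨h1, h2⟩, h3⟩),
          Finset.card_insert_of_notMem (by simp)]
        omega
    · rw [if_neg hal, if_neg (by simp [Paired, hal])]
      exact ih

end

namespace RealRAM

open Prog

/-- The current interval of parameters; it is unbounded to the left as long as `wHas` is `0`. -/
def Itv (s : State) (x : ℝ) : Prop := (s.wvar wHas ≠ 0 → s.rvar rLo ≤ x) ∧ x ≤ s.rvar rHi

/-- There is a negative cycle at the right end of the interval, but not at the left one. -/
structure Bracket (G : Net) (s : State) : Prop where
  lo : s.wvar wHas ≠ 0 → ¬ G.Neg (s.rvar rLo) ∧ s.rvar rLo < s.rvar rHi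
  hi : G.Neg (s.rvar rHi)

theorem Bracket.agree {G : Net} {p : Cmd} {s s' : State} (h : Bracket G s) (ha : Agree p s s')
    (h1 : p.writesW wHas = false) (h2 : p.writesR rLo = false) (h3 : p.writesR rHi = false) :
    Bracket G s' :=
  ⟨by rw [ha.w _ h1, ha.r _ h2, ha.r _ h3]; exact h.lo, by rw [ha.r _ h3]; exact h.hi⟩

/-- The candidates, and the interval of parameters. -/
structure Cands (S Gr : ℕ) (cg : ℕ → ℕ) (a b : ℕ → ℝ) (s : State) : Prop where
  S : s.wvar wS = S
  Gr : s.wvar wGr = Gr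
  cg : s.warr aCg = cg
  a : s.rarr fCa = a
  b : s.rarr fCb = b

/-- The program does not write the memory described by `Cands`. -/
def Cmd.keepsCands (p : Cmd) : Bool :=
  !p.writesW wS && !p.writesW wGr && !p.putsW aCg && !p.putsR fCa && !p.putsR fCb

theorem Cands.agree {S Gr : ℕ} {cg : ℕ → ℕ} {a b : ℕ → ℝ} {p : Cmd} {s s' : State}
    (h : Cands S Gr cg a b s) (ha : Agree p s s') (hp : p.keepsCands = true) :
    Cands S Gr cg a b s' := by
  simp only [Cmd.keepsCands, Bool.and_eq_true, Bool.not_eq_true'] at hp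
  obtain ⟨⟨⟨⟨h1, h2⟩, h3⟩, h4⟩, h5⟩ := hp
  exact ⟨(ha.w _ h1).trans h.S, (ha.w _ h2).trans h.Gr, (ha.wa _ h3).trans h.cg,
    (ha.ra _ h4).trans h.a, (ha.ra _ h5).trans h.b⟩

/-- The crossing point of the lines of the candidates `i` and `j`. For parallel lines it is `0`,
because the divisor is zero; the value is recorded but not used to compare such lines. -/
noncomputable def cross (a b : ℕ → ℝ) (i j : ℕ) : ℝ := (a i - a j) / (b i - b j)

section

variable {W : ℕ} {G : Net} {P : Params} {S Gr : ℕ} {cg : ℕ → ℕ} {a b : ℕ → ℝ}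

theorem runs_clearPend {s : State} (hC : Cands S Gr cg a b s) (hGW : Gr < W) :
    Runs W clearPend s (Gr * 11 + 8) fun s' => ∀ g < Gr, s'.warr aPend g = 0 := by
  refine Runs.forUp (fun k s' => ∀ g < k, s'.warr aPend g = 0) rfl rfl hC.Gr hGW
    (by simp) (fun k s' hk ha hk' hI => Runs.flat rfl ?_) fun s' _ h => h
  intro g hg
  simp only [Cmd.den, WExp.eval, State.putW_warr, State.setW_warr, hk', if_true,
    Function.update_apply]
  split_ifs with h
  · simp
  · exact hI g (by omega)

open Classical in
/-- One step of the pairing, with `act` applied to a state in which the variable `54` holds the partner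
and `rX` the crossing point. -/
theorem den_pairBody {s : State} {act : Cmd} {i : ℕ} (hC : Cands S Gr cg a b s)
    (hi : s.wvar 53 = i) (hiW : i + 1 < W)
    (hpW : s.warr aPend (cg i) < W) : (pairBody act).den W s =
      if s.warr aAl i = 0 then s else
      if s.warr aPend (cg i) = 0 then s.putW aPend (cg i) (i + 1) else
      act.den W (((s.setW 54 (s.warr aPend (cg i) - 1)).putW aPend (cg i) 0).setR rX
        (cross a b i (s.warr aPend (cg i) - 1))) := by
  have one : 1 % W = 1 := Nat.mod_eq_of_lt (by omega)
  have e1 : (i + 1) % W = i + 1 := Nat.mod_eq_of_lt hiW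
  have e2 : (s.warr aPend (cg i) - 1) % W = s.warr aPend (cg i) - 1 := Nat.mod_eq_of_lt (by omega)
  simp only [pairBody, block, Cmd.den, WExp.eval, RExp.eval, BExp.Holds, State.setW_wvar,
    State.setW_warr, State.setW_rarr, State.putW_wvar, State.putW_rarr, hi, hC.cg, hC.a, hC.b, one,
    e1, e2, Nat.zero_mod, Nat.lt_one_iff, if_true, cross, Nat.reduceEqDiff, if_false]
  by_cases h : s.warr aAl i = 0
  · simp [h]
  · have : 0 < s.warr aAl i := Nat.pos_of_ne_zero h
    simp [h, this]

open Classical in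
/-- The order in which the crossing points are recorded is irrelevant: the record contains as many
points with a property `p` as there are pairs with such a crossing point. -/
theorem runs_recordPass {s : State} {al : ℕ → ℕ} (hC : Cands S Gr cg a b s)
    (hcg : ∀ i < S, cg i < Gr) (hal : s.warr aAl = al) (hGW : Gr < W) (hSW : S + 1 < W) :
    Runs W recordPass s (Gr * 11 + S * ((pairBody recordAct).sz + 8) + 18) fun s' =>
      s'.wvar wNx = ((Finset.range S).filter (Paired cg al)).card ∧
      ∀ p : ℝ → Prop, ((Finset.range (s'.wvar wNx)).filter fun k => p (s'.rarr fX k)).card =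
        ((Finset.range S).filter fun i =>
          Paired cg al i ∧ p (cross a b i (pend cg al i (cg i) - 1))).card := by
  refine Runs.mono (T := Gr * 11 + 8 + (2 + (S * ((pairBody recordAct).sz + 8) + 8)))
    (Runs.seq ((runs_clearPend hC hGW).mono le_rfl fun s₁ ha₁ hI₁ _ => ?_)) (by omega)
    fun _ _ h => h
  have hC₁ := hC.agree ha₁ rfl
  have hal₁ : s₁.warr aAl = al := (ha₁.wa _ rfl).trans hal
  refine Runs.seq (Runs.flat rfl fun ha₂ => ?_)
  have hC₂ := hC₁.agree ha₂ rfl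
  set s₂ := (Cmd.wset wNx (.const 0)).den W s₁ with hs₂
  refine Runs.forUp (fun k s' => (∀ g < Gr, s'.warr aPend g = pend cg al k g) ∧
    s'.wvar wNx = ((Finset.range k).filter (Paired cg al)).card ∧
      ∀ p : ℝ → Prop, ((Finset.range (s'.wvar wNx)).filter fun k => p (s'.rarr fX k)).card =
        ((Finset.range k).filter fun i =>
          Paired cg al i ∧ p (cross a b i (pend cg al i (cg i) - 1))).card)
    rfl rfl hC₂.S (by omega) ⟨?_, ?_, ?_⟩ ?_ fun s' _ h => h.2
  · intro g hg
    simpa [hs₂, Cmd.den, pend] using hI₁ g hg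
  · simp [hs₂, Cmd.den, WExp.eval]
  · simp [hs₂, Cmd.den, WExp.eval]
  · rintro k s' hk ha hk' ⟨h1, h2, h3⟩
    refine Runs.flat rfl ?_
    have hC' := hC₂.agree ha rfl
    have hal' : s'.warr aAl = al := by rw [ha.wa _ rfl, ha₂.wa _ rfl, hal₁]
    have hpk : s'.warr aPend (cg k) = pend cg al k (cg k) := h1 _ (hcg k hk)
    have hpW : s'.warr aPend (cg k) < W := by
      rw [hpk]
      by_cases h0 : pend cg al k (cg k) = 0
      · omega
      · have := (pend_spec h0).1; omega
    rw [den_pairBody hC' hk' (by omega) hpW, hal', hpk]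
    have hnx : s'.wvar wNx + 1 < W := by
      rw [h2]
      have := Finset.card_filter_le (Finset.range k) (Paired cg al)
      rw [Finset.card_range] at this
      omega
    by_cases h0 : al k = 0
    · rw [if_pos h0]
      have hn : ¬ Paired cg al k := by simp [Paired, h0]
      refine ⟨fun g hg => ?_, ?_, fun p => ?_⟩
      · simpa [pend, h0] using h1 g hg
      · simpa [Finset.range_add_one, Finset.filter_insert, hn] using h2
      · simpa [Finset.range_add_one, Finset.filter_insert, hn] using h3 p
    · rw [if_neg h0]
      by_cases hp : pend cg al k (cg k) = 0
      · rw [if_pos hp]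
        have hn : ¬ Paired cg al k := by simp [Paired, hp]
        refine ⟨fun g hg => ?_, ?_, fun p => ?_⟩
        · simp only [State.setW_warr, State.putW_warr, if_true, Function.update_apply, pend]
          by_cases hg' : g = cg k
          · subst hg'; simp [h0, hp]
          · simp [hg', Ne.symm hg', h1 g hg]
        · simpa [Finset.range_add_one, Finset.filter_insert, hn] using h2
        · simpa [Finset.range_add_one, Finset.filter_insert, hn] using h3 p
      · rw [if_neg hp]
        have hn : Paired cg al k := ⟨h0, hp⟩
        have e1 : (s'.wvar wNx + 1 % W) % W = s'.wvar wNx + 1 := by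
          rw [Nat.mod_eq_of_lt (show 1 < W by omega)]; exact Nat.mod_eq_of_lt hnx
        simp only [recordAct, Cmd.inc, Cmd.den, WExp.eval, RExp.eval, State.setW_wvar,
          State.setW_warr, State.setW_rarr, State.putW_wvar, State.putW_warr, State.putW_rarr,
          State.setR_wvar, State.setR_warr, State.setR_rvar, State.setR_rarr, State.putR_wvar,
          State.putR_warr, State.putR_rarr, if_true, if_false, Nat.reduceEqDiff, e1]
        refine ⟨fun g hg => ?_, ?_, fun p => ?_⟩
        · simp only [Function.update_apply, pend]
          by_cases hg' : g = cg k
          · subst hg'; simp [h0, hp]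
          · simp [hg', Ne.symm hg', h1 g hg]
        · rw [h2, Finset.range_add_one, Finset.filter_insert, if_pos hn,
            Finset.card_insert_of_notMem (by simp)]
        · have e2 : (Finset.range (s'.wvar wNx)).filter (fun j => p (Function.update (s'.rarr fX)
              (s'.wvar wNx) (cross a b k (pend cg al k (cg k) - 1)) j)) =
              (Finset.range (s'.wvar wNx)).filter fun j => p (s'.rarr fX j) := by
            refine Finset.filter_congr fun j hj => ?_
            rw [Function.update_of_ne (Finset.mem_range.1 hj).ne]
          rw [Finset.range_add_one, Finset.filter_insert, Finset.range_add_one,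
            Finset.filter_insert, e2]
          simp only [Function.update_self, hn, true_and]
          split_ifs
          · rw [Finset.card_insert_of_notMem (by simp), Finset.card_insert_of_notMem (by simp), h3]
          · exact h3 p

/-- After the interval has been shrunk, `rQ` is not inside it. -/
theorem runs_shrink {s : State} (hP : P.Ok W G) (hE : Env G P s) (hB : Bracket G s) :
    Runs W shrink s ((relaxBody.sz + negBody.sz + 150) * (G.N * G.m + G.N + G.m + 1)) fun s' =>
      Bracket G s' ∧ (∀ x, Itv s' x → Itv s x) ∧
      ((s'.wvar wHas ≠ 0 ∧ s.rvar rQ ≤ s'.rvar rLo) ∨ s'.rvar rHi ≤ s.rvar rQ) := by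
  refine Runs.mono (T := BExp.cost (.and (.not (.and (.wlt (.const 0) (.var wHas))
      (.not (.rlt (.var rLo) (.var rQ))))) (.rlt (.var rQ) (.var rHi))) +
    ((relaxBody.sz + negBody.sz + 100) * (G.N * G.m + G.N + G.m + 1) + 20))
    (Runs.ite (fun hb => ?_) fun hb => ?_) ?_ fun _ _ h => h
  · simp only [BExp.Holds, RExp.eval, WExp.eval, Nat.zero_mod, not_and, not_not] at hb
    refine Runs.seq ((runs_bellmanFord hP hE).mono le_rfl fun s₁ ha₁ h₁ _ => ?_)
    have e1 : s₁.wvar wHas = s.wvar wHas := ha₁.w _ rfl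
    have e2 : s₁.rvar rLo = s.rvar rLo := ha₁.r _ rfl
    have e3 : s₁.rvar rHi = s.rvar rHi := ha₁.r _ rfl
    have e4 : s₁.rvar rQ = s.rvar rQ := ha₁.r _ rfl
    refine Runs.mono (Runs.flat rfl (Q := fun s' => _) ?_)
      (show Cmd.sz _ ≤ 20 by simp [Cmd.sz, BExp.cost, WExp.cost, RExp.cost]) fun _ _ h => h
    rcases h₁ with ⟨h₁, h₂⟩ | ⟨h₁, h₂⟩
    · rw [Cmd.den, if_pos (show BExp.Holds W s₁ _ by simp [BExp.Holds, WExp.eval, h₁])]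
      simp only [Cmd.den, RExp.eval]
      refine ⟨⟨fun h => ?_, ?_⟩, fun x hx => ?_, .inr ?_⟩
      · simp only [State.setR_wvar, State.setR_rvar, e1, e2, e4] at h ⊢
        exact ⟨(hB.lo h).1, hb.1 (Nat.pos_of_ne_zero h)⟩
      · simpa [e4] using h₂
      · simp only [Itv, State.setR_wvar, State.setR_rvar, e1, e2, e4] at hx ⊢
        exact ⟨hx.1, hx.2.trans hb.2.le⟩
      · simp [e4]
    · rw [Cmd.den, if_neg (show ¬ BExp.Holds W s₁ _ by simp [BExp.Holds, WExp.eval, h₁])]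
      simp only [Cmd.den, RExp.eval, WExp.eval]
      have one : 1 % W = 1 := hP.one_mod
      refine ⟨⟨fun h => ?_, ?_⟩, fun x hx => ?_, .inl ⟨?_, ?_⟩⟩
      · simp only [State.setR_rvar, State.setW_rvar, e3, e4, if_true]
        exact ⟨Net.not_neg_of_feasible h₂, hb.2⟩
      · simpa [e3] using hB.hi
      · simp [Itv, e3, e4, one] at hx ⊢
        exact ⟨fun h => (hb.1 (Nat.pos_of_ne_zero h)).le.trans hx.1, hx.2⟩
      · simp [one]
      · simp [e4]
  · simp only [BExp.Holds, RExp.eval, WExp.eval, Nat.zero_mod] at hb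
    refine Runs.mono (Runs.flat rfl (Q := fun s' => s' = s) rfl) (by simp [Cmd.sz]) ?_
    rintro s' - rfl
    refine ⟨hB, fun _ h => h, ?_⟩
    rcases not_and_or.1 hb with hb | hb
    · have hb := not_not.1 hb
      exact .inl ⟨Nat.pos_iff_ne_zero.1 hb.1, not_lt.1 hb.2⟩
    · exact .inr (not_lt.1 hb)
  · simp only [BExp.cost, RExp.cost, WExp.cost]
    ring_nf
    omega

end

end RealRAM

namespace RealRAM

open Prog

/-- The line of the candidate `j` is nowhere above the line of the candidate `i` on the current
interval. -/
def Below (a b : ℕ → ℝ) (s : State) (j i : ℕ) : Prop :=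
  ∀ x, Itv s x → a j - x * b j ≤ a i - x * b i

/-- Every candidate is dominated by a live candidate of the same group. -/
def Dominated (S : ℕ) (cg : ℕ → ℕ) (a b : ℕ → ℝ) (s : State) : Prop :=
  ∀ i < S, ∃ j < S, s.warr aAl j ≠ 0 ∧ cg j = cg i ∧ Below a b s j i

/-- The parameter `x` is not inside the current interval. -/
def Outside (s : State) (x : ℝ) : Prop := (s.wvar wHas ≠ 0 ∧ x ≤ s.rvar rLo) ∨ s.rvar rHi ≤ x

section

variable {W : ℕ} {G : Net} {P : Params} {S Gr : ℕ} {cg : ℕ → ℕ} {a b : ℕ → ℝ}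

theorem below_of_cross_le {s : State} {i j : ℕ} (hb : b j < b i) (hh : s.wvar wHas ≠ 0)
    (h : cross a b i j ≤ s.rvar rLo) : Below a b s i j := by
  intro x hx
  have h1 := h.trans (hx.1 hh)
  rw [cross, div_le_iff₀ (by linarith)] at h1
  linarith

theorem below_of_le_cross {s : State} {i j : ℕ} (hb : b j < b i)
    (h : s.rvar rHi ≤ cross a b i j) : Below a b s j i := by
  intro x hx
  have h1 := hx.2.trans h
  rw [cross, le_div_iff₀ (by linarith)] at h1
  linarith

theorem cross_comm (i j : ℕ) : cross a b i j = cross a b j i := by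
  rw [cross, cross, ← neg_sub (a j), ← neg_sub (b j), neg_div_neg_eq]

open Classical in
/-- The effect of `resolveAct` on a pair: nothing is discarded, or one candidate that is dominated
by the other one; the latter happens whenever the crossing point is not inside the interval. -/
theorem den_resolveAct {s : State} {i j : ℕ} (hC : Cands S Gr cg a b s) (hi : s.wvar 53 = i)
    (hj : s.wvar 54 = j) (hx : s.rvar rX = cross a b i j) :
    (resolveAct.den W s = s ∧ ¬ Outside s (cross a b i j)) ∨
    (resolveAct.den W s = s.putW aAl i 0 ∧ Below a b s j i) ∨
    (resolveAct.den W s = s.putW aAl j 0 ∧ Below a b s i j) := by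
  simp only [resolveAct, Cmd.den, BExp.Holds, WExp.eval, RExp.eval, hC.a, hC.b, hi, hj, hx,
    Nat.zero_mod, Outside]
  split_ifs with h1 h2 h3 h4 h5 h6 h7
  · exact .inr (.inl ⟨rfl, below_of_cross_le h1 (Nat.pos_iff_ne_zero.1 h2.1)
      (by rw [cross_comm]; exact not_lt.1 h2.2)⟩)
  · refine .inl ⟨rfl, ?_⟩
    rintro (h | h)
    · exact h2 ⟨Nat.pos_of_ne_zero h.1, not_lt.2 h.2⟩
    · exact absurd h3 (not_lt.2 h)
  · exact .inr (.inr ⟨rfl, below_of_le_cross h1 (by rw [cross_comm]; exact not_lt.1 h3)⟩)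
  · exact .inr (.inr ⟨rfl, below_of_cross_le h4 (Nat.pos_iff_ne_zero.1 h5.1) (not_lt.1 h5.2)⟩)
  · refine .inl ⟨rfl, ?_⟩
    rintro (h | h)
    · exact h5 ⟨Nat.pos_of_ne_zero h.1, not_lt.2 h.2⟩
    · exact absurd h6 (not_lt.2 h)
  · exact .inr (.inl ⟨rfl, below_of_le_cross h4 (not_lt.1 h6)⟩)
  · refine .inr (.inr ⟨rfl, fun x _ => ?_⟩)
    rw [le_antisymm (not_lt.1 h4) (not_lt.1 h1)]
    linarith
  · refine .inr (.inl ⟨rfl, fun x _ => ?_⟩)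
    rw [le_antisymm (not_lt.1 h4) (not_lt.1 h1)]
    linarith [not_lt.1 h7]

theorem live_update {al : ℕ → ℕ} {i : ℕ} : live (Function.update al i 0) S = (live al S).erase i := by
  ext k
  simp only [mem_live, Finset.mem_erase, Function.update_apply]
  split_ifs with h
  · simp [h]
  · simp [h]

/-- A candidate that is dominated by another live one may be discarded. -/
theorem Dominated.discard {s s' : State} {i j : ℕ} (h : Dominated S cg a b s)
    (hs' : s'.warr aAl = Function.update (s.warr aAl) i 0) (hI : ∀ x, Itv s' x → Itv s x)
    (hj : j < S) (hj0 : s.warr aAl j ≠ 0) (hij : j ≠ i) (hg : cg j = cg i)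
    (hb : Below a b s j i) : Dominated S cg a b s' := by
  intro k hk
  obtain ⟨l, hl, hl0, hlg, hlb⟩ := h k hk
  rw [hs']
  by_cases hli : l = i
  · subst hli
    exact ⟨j, hj, by rwa [Function.update_of_ne hij], hg.trans hlg,
      fun x hx => (hb x (hI x hx)).trans (hlb x (hI x hx))⟩
  · exact ⟨l, hl, by rwa [Function.update_of_ne hli], hlg, fun x hx => hlb x (hI x hx)⟩

/-- Domination persists when the interval shrinks. -/
theorem Dominated.of_eq {s s' : State} (h : Dominated S cg a b s)
    (hs' : s'.warr aAl = s.warr aAl) (hI : ∀ x, Itv s' x → Itv s x) : Dominated S cg a b s' := by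
  intro k hk
  obtain ⟨l, hl, hl0, hlg, hlb⟩ := h k hk
  exact ⟨l, hl, by rwa [hs'], hlg, fun x hx => hlb x (hI x hx)⟩

open Classical in
/-- One candidate is discarded for every pair whose crossing point is not inside the interval. The
pairing is that of the candidates `al` that are live at the beginning: a candidate may be discarded
only after its pair has been formed, so that candidates that are still to come or waiting are live. -/
theorem runs_resolvePass {s : State} {al : ℕ → ℕ} (hC : Cands S Gr cg a b s)
    (hcg : ∀ i < S, cg i < Gr) (hal : s.warr aAl = al) (hGW : Gr < W) (hSW : S + 1 < W)
    (hD : Dominated S cg a b s) :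
    Runs W resolvePass s (Gr * 11 + S * ((pairBody resolveAct).sz + 8) + 16) fun s' =>
      Dominated S cg a b s' ∧ (live (s'.warr aAl) S).card + ((Finset.range S).filter fun i =>
        Paired cg al i ∧ Outside s (cross a b i (pend cg al i (cg i) - 1))).card ≤
      (live al S).card := by
  refine Runs.mono (T := Gr * 11 + 8 + (S * ((pairBody resolveAct).sz + 8) + 8))
    (Runs.seq ((runs_clearPend hC hGW).mono le_rfl fun s₁ ha₁ hI₁ _ => ?_)) (by omega)
    fun _ _ h => h
  have hC₁ := hC.agree ha₁ rfl
  have hal₁ : s₁.warr aAl = al := (ha₁.wa _ rfl).trans hal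
  have itv : ∀ {p : Cmd} {s s' : State}, Agree p s s' → p.writesW wHas = false →
      p.writesR rLo = false → p.writesR rHi = false → (∀ x, Itv s' x → Itv s x) := by
    intro p s s' ha h1 h2 h3 x hx
    simpa only [Itv, ha.w _ h1, ha.r _ h2, ha.r _ h3] using hx
  have hD₁ := hD.of_eq (ha₁.wa _ rfl) (itv ha₁ rfl rfl rfl)
  refine Runs.forUp (fun k s' => (∀ g < Gr, s'.warr aPend g = pend cg al k g) ∧
    (∀ i, k ≤ i → s'.warr aAl i = al i) ∧
    (∀ g, pend cg al k g ≠ 0 → s'.warr aAl (pend cg al k g - 1) ≠ 0) ∧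
    Dominated S cg a b s' ∧ (live (s'.warr aAl) S).card + ((Finset.range k).filter fun i =>
        Paired cg al i ∧ Outside s (cross a b i (pend cg al i (cg i) - 1))).card ≤
      (live al S).card)
    rfl rfl hC₁.S (by omega) ⟨?_, ?_, ?_, hD₁.of_eq rfl fun _ h => h, ?_⟩ ?_ fun s' _ h => h.2.2.2
  · intro g hg
    simpa [pend] using hI₁ g hg
  · intro i _; simp [hal₁]
  · intro g hg; simp [pend] at hg
  · simp [hal₁]
  · rintro k s' hk ha hk' ⟨h1, h2, h3, h4, h5⟩
    refine Runs.flat rfl ?_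
    have hC' := hC₁.agree ha rfl
    have hpk : s'.warr aPend (cg k) = pend cg al k (cg k) := h1 _ (hcg k hk)
    have hpW : s'.warr aPend (cg k) < W := by
      rw [hpk]
      by_cases h0 : pend cg al k (cg k) = 0
      · omega
      · have := (pend_spec h0).1; omega
    rw [den_pairBody hC' hk' (by omega) hpW, h2 k le_rfl, hpk]
    by_cases h0 : al k = 0
    · rw [if_pos h0]
      have hn : ¬ Paired cg al k := by simp [Paired, h0]
      refine ⟨fun g hg => ?_, fun i hi => ?_, fun g hg => ?_, h4.of_eq rfl fun _ h => h, ?_⟩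
      · simpa [pend, h0] using h1 g hg
      · simpa using h2 i (by omega)
      · simp only [pend, h0, ne_eq, not_true, false_and, if_false] at hg ⊢
        simpa using h3 g hg
      · simpa [Finset.range_add_one, Finset.filter_insert, hn] using h5
    rw [if_neg h0]
    by_cases hp : pend cg al k (cg k) = 0
    · rw [if_pos hp]
      have hn : ¬ Paired cg al k := by simp [Paired, hp]
      refine ⟨fun g hg => ?_, fun i hi => ?_, fun g hg => ?_, h4.of_eq (by simp) fun _ h => h, ?_⟩
      · simp only [State.setW_warr, State.putW_warr, if_true, Function.update_apply, pend]
        by_cases hg' : g = cg k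
        · subst hg'; simp [h0, hp]
        · simp [hg', Ne.symm hg', h1 g hg]
      · simpa using h2 i (by omega)
      · simp only [State.setW_warr, State.putW_warr, Nat.reduceEqDiff, if_false]
        rw [pend] at hg ⊢
        by_cases hg' : cg k = g
        · subst hg'; simp [h0, hp, h2]
        · simp only [hg', and_false, if_false] at hg ⊢
          exact h3 g hg
      · simpa [Finset.range_add_one, Finset.filter_insert, hn] using h5
    rw [if_neg hp]
    have hn : Paired cg al k := ⟨h0, hp⟩
    obtain ⟨p1, p2, p3⟩ := pend_spec hp
    have p4 := h3 _ hp
    set j := pend cg al k (cg k) - 1 with hj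
    set s₂ := ((s'.setW 54 j).putW aPend (cg k) 0).setR rX (cross a b k j) with hs₂
    have al₂ : s₂.warr aAl = s'.warr aAl := by simp [hs₂]
    have i₂ : ∀ x, Itv s₂ x ↔ Itv s' x := fun x => by simp [Itv, hs₂]
    have o₂ : ∀ x, Outside s₂ x ↔ Outside s x := fun x => by
      simp [Outside, hs₂, ha.w wHas rfl, ha₁.w wHas rfl, ha.r rLo rfl, ha₁.r rLo rfl,
        ha.r rHi rfl, ha₁.r rHi rfl]
    have hC₂ : Cands S Gr cg a b s₂ := ⟨by simp [hs₂, hC'.S], by simp [hs₂, hC'.Gr],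
      by simp [hs₂, hC'.cg], by simp [hs₂, hC'.a], by simp [hs₂, hC'.b]⟩
    have pend₂ : ∀ g < Gr, s₂.warr aPend g = pend cg al (k + 1) g := by
      intro g hg
      simp only [hs₂, State.setR_warr, State.putW_warr, State.setW_warr, if_true,
        Function.update_apply, pend]
      by_cases hg' : g = cg k
      · subst hg'; simp [h0, hp]
      · simp [hg', Ne.symm hg', h1 g hg]
    have pnext : ∀ g, pend cg al (k + 1) g ≠ 0 → pend cg al (k + 1) g = pend cg al k g ∧
        g ≠ cg k := by
      intro g hg
      rw [pend] at hg ⊢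
      by_cases hg' : cg k = g
      · subst hg'; simp [h0, hp] at hg
      · simp [hg', Ne.symm hg']
    have hD₂ := h4.of_eq (s' := s₂) (by simp [hs₂]) fun x => (i₂ x).1
    have hcard : ((Finset.range (k + 1)).filter fun i =>
        Paired cg al i ∧ Outside s (cross a b i (pend cg al i (cg i) - 1))).card ≤
        ((Finset.range k).filter fun i =>
        Paired cg al i ∧ Outside s (cross a b i (pend cg al i (cg i) - 1))).card + 1 := by
      rw [Finset.range_add_one, Finset.filter_insert]
      split_ifs
      · exact Finset.card_insert_le _ _
      · omega
    rcases den_resolveAct (W := W) (i := k) (j := j) hC₂ (by simp [hs₂, hk']) (by simp [hs₂])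
      (by simp [hs₂]) with ⟨hd, ho⟩ | ⟨hd, hb⟩ | ⟨hd, hb⟩ <;> rw [hd]
    · -- nothing is discarded
      refine ⟨fun g hg => ?_, fun i hi => ?_, fun g hg => ?_, hD₂.of_eq rfl fun _ h => h, ?_⟩
      · simpa using pend₂ g hg
      · simpa [al₂] using h2 i (by omega)
      · obtain ⟨e, -⟩ := pnext g hg
        rw [e] at hg ⊢
        simpa [al₂] using h3 g hg
      · rw [o₂] at ho
        rw [Finset.range_add_one, Finset.filter_insert, if_neg (by rw [← hj]; tauto)]
        simpa [al₂] using h5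
    · -- the second member is discarded
      have al₃ : ((s₂.putW aAl k 0).setW 53 (k + 1)).warr aAl =
          Function.update (s'.warr aAl) k 0 := by simp [al₂]
      refine ⟨fun g hg => ?_, fun i hi => ?_, fun g hg => ?_,
        hD₂.discard (by simp) (fun _ h => h) (p1.trans hk) (by rwa [al₂]) p1.ne p3 hb, ?_⟩
      · simpa using pend₂ g hg
      · rw [al₃, Function.update_of_ne (by omega)]; exact h2 i (by omega)
      · obtain ⟨e, -⟩ := pnext g hg
        rw [e] at hg ⊢
        have := (pend_spec hg).1
        rw [al₃, Function.update_of_ne (by omega)]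
        exact h3 g hg
      · have hm : k ∈ live (s'.warr aAl) S := mem_live.2 ⟨hk, by rwa [h2 k le_rfl]⟩
        rw [al₃, live_update, Finset.card_erase_of_mem hm]
        have := Finset.card_pos.2 ⟨k, hm⟩
        omega
    · -- the first member is discarded
      have al₃ : ((s₂.putW aAl j 0).setW 53 (k + 1)).warr aAl =
          Function.update (s'.warr aAl) j 0 := by simp [al₂]
      refine ⟨fun g hg => ?_, fun i hi => ?_, fun g hg => ?_,
        hD₂.discard (by simp) (fun _ h => h) hk (by rw [al₂, h2 k le_rfl]; exact h0) p1.ne'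
          p3.symm hb, ?_⟩
      · simpa using pend₂ g hg
      · rw [al₃, Function.update_of_ne (by omega)]; exact h2 i (by omega)
      · obtain ⟨e, hne⟩ := pnext g hg
        rw [e] at hg ⊢
        have hg3 := (pend_spec hg).2.2
        rw [al₃, Function.update_of_ne]
        · exact h3 g hg
        · intro heq
          rw [heq, p3] at hg3
          exact hne hg3.symm
      · have hm : j ∈ live (s'.warr aAl) S := mem_live.2 ⟨p1.trans hk, p4⟩
        rw [al₃, live_update, Finset.card_erase_of_mem hm]
        have := Finset.card_pos.2 ⟨j, hm⟩
        omega

end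

end RealRAM

namespace RealRAM

open Prog

section

variable {W : ℕ} {G : Net} {P : Params} {S Gr : ℕ} {cg : ℕ → ℕ} {a b : ℕ → ℝ}

/-- Every group keeps a live candidate. -/
theorem Dominated.image_live {s : State} (h : Dominated S cg a b s) :
    (live (s.warr aAl) S).image cg = (Finset.range S).image cg := by
  refine Finset.Subset.antisymm (Finset.image_subset_image (Finset.filter_subset _ _)) ?_
  intro g hg
  obtain ⟨i, hi, rfl⟩ := Finset.mem_image.1 hg
  obtain ⟨j, hj, hj0, hjg, -⟩ := h i (Finset.mem_range.1 hi)
  exact Finset.mem_image.2 ⟨j, mem_live.2 ⟨hj, hj0⟩, hjg⟩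

/-- A constant for the running time of one round of prune and search. -/
def pruneConst : ℕ := (pairBody recordAct).sz + (pairBody resolveAct).sz + buildBody.sz +
  2 * climbBody.sz + relaxBody.sz + negBody.sz + 400

/-- One round removes a quarter of the superfluous candidates: half of the crossing points are on
the same side of the interval as the median. -/
theorem runs_pruneBody {s : State} {e : ℕ} (hP : P.Ok W G) (hE : Env G P s)
    (hC : Cands S Gr cg a b s) (hcg : ∀ i < S, cg i < Gr) (hGW : Gr < W) (hS : S < 2 ^ P.lgB)
    (hB : Bracket G s) (hD : Dominated S cg a b s)
    (he : (live (s.warr aAl) S).card ≤ e + ((Finset.range S).image cg).card) :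
    Runs W pruneBody s (pruneConst * (e * (P.lgB + 1) + (Gr + S + G.N * G.m + G.N + G.m + P.lgB + 1)))
      fun s' => Bracket G s' ∧ (∀ x, Itv s' x → Itv s x) ∧ Dominated S cg a b s' ∧
        4 * (live (s'.warr aAl) S).card ≤ 3 * (live (s.warr aAl) S).card +
          ((Finset.range S).image cg).card := by
  classical
  set al := s.warr aAl with hal
  have hSW : S + 1 < W := by have := hP.pow_le; omega
  set np := ((Finset.range S).filter (Paired cg al)).card with hnp
  have hΓ : ((live al S).image cg).card = ((Finset.range S).image cg).card := by
    rw [hD.image_live]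
  have hne : np ≤ e := by
    have := card_image_add_le (cg := cg) (al := al) S
    omega
  set al' : ℕ → ℕ := fun i => if i < S then al i else 0 with hal'
  -- candidates beyond the end of the list play no role
  have hlive : live al' S = live al S := by
    ext i; simp only [mem_live, hal']; constructor <;> rintro ⟨h1, h2⟩ <;> simp_all
  have hpend' : ∀ k ≤ S, ∀ g, pend cg al' k g = pend cg al k g := by
    intro k
    induction k with
    | zero => intros; rfl
    | succ k ih => intro hk g; rw [pend, pend, ih (by omega)]; simp [hal', show k < S by omega]
  have hpair' : (Finset.range S).filter (Paired cg al') = (Finset.range S).filter (Paired cg al) := by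
    refine Finset.filter_congr fun i hi => ?_
    have hi := Finset.mem_range.1 hi
    rw [Paired, Paired, hpend' i hi.le]
    simp [hal', hi]
  have hcount : (live al S).card ≤ 2 * np + ((Finset.range S).image cg).card := by
    have h1 := card_live_eq (cg := cg) (al := al') (Gr := Gr) (fun i hi => hcg i (by
      by_contra h; simp [hal', h] at hi)) S
    have h2 := card_pend_le (cg := cg) (al := al') Gr S
    rw [hlive, hpair'] at h1
    rw [hlive] at h2
    omega
  have h2np : 2 * np ≤ S := by
    have h1 := card_live_eq (cg := cg) (al := al') (Gr := Gr) (fun i hi => hcg i (by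
      by_contra h; simp [hal', h] at hi)) S
    rw [hlive, hpair'] at h1
    have h2 : (live al S).card ≤ S := by
      simpa [live] using Finset.card_filter_le (Finset.range S) (fun i => al i ≠ 0)
    omega
  refine Runs.mono (T := Gr * 11 + S * ((pairBody recordAct).sz + 8) + 18 + (3 +
    ((buildBody.sz + 2 * climbBody.sz + 100) * (np * P.lgB + np + P.lgB + 1) +
      (relaxBody.sz + negBody.sz + 150) * (G.N * G.m + G.N + G.m + 1)) +
    (Gr * 11 + S * ((pairBody resolveAct).sz + 8) + 16))) (Runs.seq
    ((runs_recordPass hC hcg hal.symm hGW hSW).mono le_rfl fun s₁ ha₁ ⟨h₁, h₁'⟩ _ => ?_)) ?_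
    fun _ _ h => h
  · have hC₁ := hC.agree ha₁ rfl
    have hE₁ := hE.agree ha₁ rfl
    have hB₁ := hB.agree ha₁ rfl rfl rfl
    have hal₁ : s₁.warr aAl = al := ha₁.wa _ rfl
    have hI₁ : ∀ x, Itv s₁ x → Itv s x := fun x hx => by
      simpa only [Itv, ha₁.w wHas rfl, ha₁.r rLo rfl, ha₁.r rHi rfl] using hx
    rw [h₁] at h₁'
    rw [← hnp] at h₁ h₁'
    refine Runs.seq ((Runs.ite (Q := fun s' => Bracket G s' ∧ (∀ x, Itv s' x → Itv s₁ x) ∧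
      np ≤ 2 * ((Finset.range S).filter fun i => Paired cg al i ∧
        Outside s' (cross a b i (pend cg al i (cg i) - 1))).card) (fun hb => ?_) fun hb => ?_).mono
        (T := 3 + ((buildBody.sz + 2 * climbBody.sz + 100) * (np * P.lgB + np + P.lgB + 1) +
        (relaxBody.sz + negBody.sz + 150) * (G.N * G.m + G.N + G.m + 1))) (by simp) fun s₂ ha₂ ⟨h₂, h₂', h₂''⟩ _ => ?_)
    · have hpos : 0 < np := by
        simpa only [BExp.Holds, WExp.eval, h₁, Nat.zero_mod] using hb
      refine Runs.seq ((runs_median hP hE₁ h₁ hpos (by omega)).mono le_rfl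
        fun s₂ ha₂ ⟨h₂, h₂'⟩ _ => ?_)
      have hE₂ := hE₁.agree ha₂ rfl
      have hB₂ := hB₁.agree ha₂ rfl rfl rfl
      have hI₂ : ∀ x, Itv s₂ x → Itv s₁ x := fun x hx => by
        simpa only [Itv, ha₂.w wHas rfl, ha₂.r rLo rfl, ha₂.r rHi rfl] using hx
      rw [h₁' (fun x => x ≤ s₂.rvar rQ)] at h₂
      rw [h₁' (fun x => s₂.rvar rQ ≤ x)] at h₂'
      refine (runs_shrink hP hE₂ hB₂).mono le_rfl fun s₃ ha₃ ⟨h₃, h₃', h₃''⟩ => ⟨h₃,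
        fun x hx => hI₂ x (h₃' x hx), ?_⟩
      rcases h₃'' with ⟨h4, h5⟩ | h5
      · refine h₂.trans (Nat.mul_le_mul_left 2 (Finset.card_le_card fun i hi => ?_))
        obtain ⟨hi1, hi2, hi3⟩ := Finset.mem_filter.1 hi
        exact Finset.mem_filter.2 ⟨hi1, hi2, .inl ⟨h4, hi3.trans h5⟩⟩
      · refine h₂'.trans (Nat.mul_le_mul_left 2 (Finset.card_le_card fun i hi => ?_))
        obtain ⟨hi1, hi2, hi3⟩ := Finset.mem_filter.1 hi
        exact Finset.mem_filter.2 ⟨hi1, hi2, .inr (h5.trans hi3)⟩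
    · have hpos : np = 0 := by
        simpa only [BExp.Holds, WExp.eval, h₁, Nat.zero_mod, Nat.pos_iff_ne_zero, not_not] using hb
      have : 1 ≤ (relaxBody.sz + negBody.sz + 150) * (G.N * G.m + G.N + G.m + 1) :=
        Nat.mul_pos (by omega) (by omega)
      refine Runs.mono (Runs.flat rfl (Q := fun s' => s' = s₁) rfl) (le_trans this (Nat.le_add_left _ _)) ?_
      rintro s' - rfl
      exact ⟨hB₁, fun _ h => h, by omega⟩
    · have hC₂ := hC₁.agree ha₂ rfl
      have hal₂ : s₂.warr aAl = al := (ha₂.wa _ rfl).trans hal₁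
      have hD₂ : Dominated S cg a b s₂ :=
        hD.of_eq (by rw [hal₂]) fun x hx => hI₁ x (h₂' x hx)
      refine (runs_resolvePass hC₂ hcg hal₂ hGW hSW hD₂).mono le_rfl fun s₃ ha₃ ⟨h₃, h₃'⟩ => ?_
      refine ⟨h₂.agree ha₃ rfl rfl rfl, fun x hx => hI₁ x (h₂' x ?_), h₃, by omega⟩
      simpa only [Itv, ha₃.w wHas rfl, ha₃.r rLo rfl, ha₃.r rHi rfl] using hx
  · have h1 : np * P.lgB + np + P.lgB + 1 ≤ e * (P.lgB + 1) + P.lgB + 1 := by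
      have := Nat.mul_le_mul_right (P.lgB + 1) hne
      nlinarith
    have h2 := Nat.mul_le_mul_left (buildBody.sz + 2 * climbBody.sz + 100) h1
    unfold pruneConst
    refine le_trans (Nat.add_le_add_left (Nat.add_le_add_right (Nat.add_le_add_left
      (Nat.add_le_add_right h2 _) _) _) _) ?_
    ring_nf
    omega

/-- The medians of all rounds together take linear time, up to a logarithm, because the number of
superfluous candidates decreases geometrically. -/
theorem sum_geometric_le (S J : ℕ) : ∑ r ∈ Finset.range J, 3 ^ r * S / 4 ^ r ≤ 4 * S := by
  have h : ∀ J : ℕ, (∑ r ∈ Finset.range J, ((3 ^ r * S / 4 ^ r : ℕ) : ℚ)) ≤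
      4 * S - 4 * S * (3 / 4 : ℚ) ^ J := by
    intro J
    induction J with
    | zero => simp
    | succ J ih =>
      rw [Finset.sum_range_succ]
      have h1 : ((3 ^ J * S / 4 ^ J : ℕ) : ℚ) ≤ (3 / 4 : ℚ) ^ J * S := by
        refine Nat.cast_div_le.trans (le_of_eq ?_)
        push_cast
        rw [div_pow]
        ring
      have h2 : (3 / 4 : ℚ) ^ (J + 1) = (3 / 4 : ℚ) ^ J * (3 / 4) := pow_succ _ _
      rw [h2]
      linarith
  have := h J
  have h0 : (0 : ℚ) ≤ 4 * S * (3 / 4 : ℚ) ^ J := by positivity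
  rw [← Nat.cast_sum] at this
  exact_mod_cast (by linarith : ((∑ r ∈ Finset.range J, 3 ^ r * S / 4 ^ r : ℕ) : ℚ) ≤ 4 * S)

/-- The lines that have been stored are lines of candidates, and they are minimal in their groups
on the whole current interval. -/
structure Winners (S Gr : ℕ) (cg : ℕ → ℕ) (a b : ℕ → ℝ) (s : State) : Prop where
  le : ∀ i < S, s.warr aWF (cg i) ≠ 0 ∧
    ∀ x, Itv s x → s.rarr fWA (cg i) - x * s.rarr fWB (cg i) ≤ a i - x * b i
  mem : ∀ g < Gr, s.warr aWF g ≠ 0 →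
    ∃ i < S, cg i = g ∧ s.rarr fWA g = a i ∧ s.rarr fWB g = b i

/-- When only one candidate of each group is left, it is minimal in its group. -/
theorem runs_store {s : State} (hC : Cands S Gr cg a b s) (hcg : ∀ i < S, cg i < Gr)
    (hGW : Gr < W) (hSW : S + 1 < W) (hD : Dominated S cg a b s)
    (hcard : (live (s.warr aAl) S).card ≤ ((Finset.range S).image cg).card) :
    Runs W store s (Gr * 11 + S * (storeBody.sz + 8) + 16) fun s' => Winners S Gr cg a b s' := by
  have hinj : Set.InjOn cg (live (s.warr aAl) S) := by
    rw [← Finset.card_image_iff]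
    exact le_antisymm Finset.card_image_le (by rw [hD.image_live]; exact hcard)
  refine Runs.mono (T := Gr * 11 + 8 + (S * (storeBody.sz + 8) + 8)) (Runs.seq
    (Runs.forUp (T := 3) (fun k s' => ∀ g < k, s'.warr aWF g = 0) rfl rfl hC.Gr hGW
    (by simp) (fun k s' hk ha hk' hI => Runs.flat rfl ?_) fun s₁ ha₁ h₁ _ => ?_)) (by omega)
    fun _ _ h => h
  · intro g hg
    simp only [Cmd.den, WExp.eval, State.putW_warr, State.setW_warr, hk', if_true,
      Function.update_apply]
    split_ifs with h
    · simp
    · exact hI g (by omega)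
  · have hC₁ := hC.agree ha₁ rfl
    set al := s.warr aAl with hal
    have hal₁ : s₁.warr aAl = al := ha₁.wa _ rfl
    refine Runs.forUp (fun k s' => (∀ i < k, al i ≠ 0 → s'.warr aWF (cg i) ≠ 0) ∧
      ∀ g < Gr, s'.warr aWF g ≠ 0 →
        ∃ i < S, al i ≠ 0 ∧ cg i = g ∧ s'.rarr fWA g = a i ∧ s'.rarr fWB g = b i)
      rfl rfl hC₁.S (by omega) ⟨by simp, ?_⟩ ?_ ?_
    · intro g hg h
      simp [h₁ g hg] at h
    · rintro k s' hk ha hk' ⟨j1, j2⟩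
      refine Runs.flat rfl ?_
      have hC' := hC₁.agree ha rfl
      have hal' : s'.warr aAl = al := (ha.wa _ rfl).trans hal₁
      by_cases h0 : al k = 0
      · rw [storeBody, Cmd.den, if_neg (show ¬ BExp.Holds W s' _ by
          simp [BExp.Holds, WExp.eval, hal', hk', h0])]
        refine ⟨fun i hi hi0 => ?_, by simpa [Cmd.den] using j2⟩
        rcases Nat.lt_succ_iff_lt_or_eq.1 hi with hi | rfl
        · simpa [Cmd.den] using j1 i hi hi0
        · exact absurd h0 hi0
      · rw [storeBody, Cmd.den, if_pos (show BExp.Holds W s' _ by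
          simpa [BExp.Holds, WExp.eval, hal', hk'] using Nat.pos_of_ne_zero h0)]
        have one : 1 % W = 1 := Nat.mod_eq_of_lt (by omega)
        simp only [block, Cmd.den, WExp.eval, RExp.eval, State.setW_warr, State.setW_rarr,
          State.putW_wvar, State.putW_warr, State.putW_rarr, State.putR_wvar, State.putR_warr,
          State.putR_rarr, hk', hC'.cg, hC'.a, hC'.b, one, if_true, if_false, Nat.reduceEqDiff,
          Function.update_apply]
        refine ⟨fun i hi hi0 => ?_, fun g hg hg0 => ?_⟩
        · by_cases hik : cg i = cg k
          · simp [hik]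
          · have : i ≠ k := fun h => hik (h ▸ rfl)
            rw [if_neg hik]
            exact j1 i (by omega) hi0
        · by_cases hgk : g = cg k
          · subst hgk
            exact ⟨k, hk, h0, rfl, by simp⟩
          · simp only [hgk, if_false] at hg0 ⊢
            exact j2 g hg hg0
    · rintro s' ha' ⟨j1, j2⟩
      have hI : ∀ x, Itv s' x → Itv s x := fun x hx => by
        simpa only [Itv, ha'.w wHas rfl, ha'.r rLo rfl, ha'.r rHi rfl, ha₁.w wHas rfl,
          ha₁.r rLo rfl, ha₁.r rHi rfl] using hx
      refine ⟨fun i hi => ?_, fun g hg hg0 => ?_⟩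
      · obtain ⟨j, hj, hj0, hjg, hjb⟩ := hD i hi
        have hw := j1 j hj hj0
        rw [hjg] at hw
        refine ⟨hw, fun x hx => ?_⟩
        obtain ⟨l, hl, hl0, hlg, h1, h2⟩ := j2 (cg i) (hcg i hi) hw
        obtain rfl : l = j := hinj (mem_live.2 ⟨hl, hl0⟩) (mem_live.2 ⟨hj, hj0⟩) (hlg.trans hjg.symm)
        rw [h1, h2]
        exact hjb x (hI x hx)
      · obtain ⟨i, hi, -, h⟩ := j2 g hg hg0
        exact ⟨i, hi, h⟩

/-- A constant for the running time of `groupMin`. -/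
def groupConst : ℕ := 20 * (pruneConst + storeBody.sz + 100)

/-- The interval shrinks, and then every group has a member that is minimal on the whole interval. The
result may be any of the intervals that still contain the minimum ratio; this is expressed by
`Bracket`. -/
theorem runs_groupMin {s : State} (hP : P.Ok W G) (hE : Env G P s) (hC : Cands S Gr cg a b s)
    (hcg : ∀ i < S, cg i < Gr) (hGW : Gr < W) (hS : S < 2 ^ P.lgB) (hB : Bracket G s) :
    Runs W groupMin s (groupConst * (P.lgB + 1) * (Gr + S + G.N * G.m + G.N + G.m + P.lgB + 1))
      fun s' => Bracket G s' ∧ (∀ x, Itv s' x → Itv s x) ∧ Winners S Gr cg a b s' := by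
  have hSW : S + 1 < W := by have := hP.pow_le; omega
  set Γ := ((Finset.range S).image cg).card with hΓ
  set Z := Gr + S + G.N * G.m + G.N + G.m + P.lgB + 1 with hZ
  refine Runs.mono (T := S * (3 + 8) + 8 + ((∑ r ∈ Finset.range (3 * P.lgB),
    (pruneConst * ((3 ^ r * S / 4 ^ r) * (P.lgB + 1) + Z) + 8) + 8) +
    (Gr * 11 + S * (storeBody.sz + 8) + 16)))
    (Runs.seq (Runs.forUp (T := 3) (fun k s' => ∀ i < k, s'.warr aAl i ≠ 0) rfl rfl hC.S (by omega)
    (by simp) (fun k s' hk ha hk' hI => Runs.flat rfl ?_) fun s₁ ha₁ h₁ _ => ?_)) ?_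
    fun _ _ h => h
  · intro i hi
    have one : 1 % W = 1 := hP.one_mod
    simp only [Cmd.den, WExp.eval, State.putW_warr, State.setW_warr, hk', if_true,
      Function.update_apply, one]
    split_ifs with h
    · simp
    · exact hI i (by omega)
  · have hC₁ := hC.agree ha₁ rfl
    have hE₁ := hE.agree ha₁ rfl
    have hB₁ := hB.agree ha₁ rfl rfl rfl
    have hI₁ : ∀ x, Itv s₁ x → Itv s x := fun x hx => by
      simpa only [Itv, ha₁.w wHas rfl, ha₁.r rLo rfl, ha₁.r rHi rfl] using hx
    refine Runs.seq (Runs.forUp_sum (fun r => pruneConst * ((3 ^ r * S / 4 ^ r) * (P.lgB + 1) + Z))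
      -- after `r` rounds there are at most `(3 / 4) ^ r * S` more live candidates than groups
      (fun r s' => Bracket G s' ∧ (∀ x, Itv s' x → Itv s x) ∧ Dominated S cg a b s' ∧
        4 ^ r * (live (s'.warr aAl) S).card ≤ 3 ^ r * S + 4 ^ r * Γ) rfl rfl hE₁.J hP.J_lt
      ⟨?_, ?_, ?_, ?_⟩ ?_ ?_)
    · exact ⟨by simpa using hB₁.lo, by simpa using hB₁.hi⟩
    · intro x hx
      exact hI₁ x (by simpa [Itv] using hx)
    · exact fun i hi => ⟨i, hi, by simpa using h₁ i hi, rfl, fun _ _ => le_rfl⟩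
    · have : (live (s₁.warr aAl) S).card ≤ S := by
        simpa [live] using Finset.card_filter_le (Finset.range S) (fun i => s₁.warr aAl i ≠ 0)
      simpa using this.trans (Nat.le_add_right _ _)
    · rintro r s' hr ha hr' ⟨hB', hI', hD', hA⟩
      have hC' := hC₁.agree ha rfl
      have hE' := hE₁.agree ha rfl
      refine (runs_pruneBody (e := 3 ^ r * S / 4 ^ r) hP hE' hC' hcg hGW hS hB' hD' ?_).mono le_rfl
        fun s'' ha'' ⟨q1, q2, q3, q4⟩ => ⟨⟨by simpa using q1.lo, by simpa using q1.hi⟩,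
          fun x hx => hI' x (q2 x (by simpa [Itv] using hx)), q3.of_eq rfl fun _ h => h, ?_⟩
      · have h4 : 0 < 4 ^ r := by positivity
        have : (live (s'.warr aAl) S).card - Γ ≤ 3 ^ r * S / 4 ^ r := by
          rw [Nat.le_div_iff_mul_le h4, Nat.sub_mul]
          rw [mul_comm, mul_comm Γ]
          omega
        omega
      · simp only [State.setW_warr]
        have h4 : 4 ^ r * (4 * (live (s''.warr aAl) S).card) ≤
            4 ^ r * (3 * (live (s'.warr aAl) S).card + Γ) := Nat.mul_le_mul_left _ q4
        rw [pow_succ, pow_succ]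
        nlinarith
    · rintro s₂ ha₂ ⟨hB₂, hI₂, hD₂, hA⟩ _
      have hC₂ := hC₁.agree ha₂ rfl
      refine (runs_store hC₂ hcg hGW hSW hD₂ ?_).mono le_rfl fun s₃ ha₃ h₃ =>
        ⟨hB₂.agree ha₃ rfl rfl rfl, fun x hx => hI₂ x ?_, h₃⟩
      · -- after `3 * lgB` rounds the number of superfluous candidates is below one
        by_contra hcon
        have h1 : 4 ^ (3 * P.lgB) * (Γ + 1) ≤ 3 ^ (3 * P.lgB) * S + 4 ^ (3 * P.lgB) * Γ :=
          le_trans (Nat.mul_le_mul_left _ (by omega)) hA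
        have h2 : 4 ^ (3 * P.lgB) ≤ 3 ^ (3 * P.lgB) * S := by
          rw [mul_add, mul_one] at h1; omega
        have h3 : 3 ^ (3 * P.lgB) * S < 3 ^ (3 * P.lgB) * 2 ^ P.lgB :=
          Nat.mul_lt_mul_of_pos_left hS (by positivity)
        have h4 : 3 ^ (3 * P.lgB) * 2 ^ P.lgB ≤ 4 ^ (3 * P.lgB) := by
          rw [pow_mul, pow_mul, ← mul_pow]
          exact Nat.pow_le_pow_left (by norm_num) _
        omega
      · simpa only [Itv, ha₃.w wHas rfl, ha₃.r rLo rfl, ha₃.r rHi rfl] using hx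
  · have hsum : ∑ r ∈ Finset.range (3 * P.lgB),
        (pruneConst * ((3 ^ r * S / 4 ^ r) * (P.lgB + 1) + Z) + 8) ≤
        pruneConst * (4 * S * (P.lgB + 1)) + 3 * P.lgB * (pruneConst * Z + 8) := by
      have e1 : ∀ r, pruneConst * ((3 ^ r * S / 4 ^ r) * (P.lgB + 1) + Z) + 8 =
          pruneConst * (P.lgB + 1) * (3 ^ r * S / 4 ^ r) + (pruneConst * Z + 8) := fun r => by ring
      simp only [e1, Finset.sum_add_distrib, ← Finset.mul_sum, Finset.sum_const, Finset.card_range,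
        smul_eq_mul]
      have := Nat.mul_le_mul_left (pruneConst * (P.lgB + 1)) (sum_geometric_le S (3 * P.lgB))
      nlinarith
    have hSZ : S ≤ Z := by omega
    have hGZ : Gr ≤ Z := by omega
    have hZ1 : 1 ≤ Z := by omega
    have b1 : pruneConst * (4 * S * (P.lgB + 1)) ≤ pruneConst * (4 * Z * (P.lgB + 1)) := by gcongr
    have b2 : S * (storeBody.sz + 8) ≤ Z * (storeBody.sz + 8) := by gcongr
    have b3 : P.lgB ≤ P.lgB * Z := Nat.le_mul_of_pos_right _ hZ1
    unfold groupConst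
    clear_value Z
    refine le_trans (Nat.add_le_add_left (Nat.add_le_add_right (Nat.add_le_add_right hsum 8) _) _)
      ?_
    have b4 : Z ≤ Z * P.lgB + Z := by omega
    clear hsum
    ring_nf at b1 b2 b3 ⊢
    omega

end

end RealRAM

/-! ### Finding a cycle -/

namespace Net

variable {G : Net}

theorem walk_map_range {g : ℕ → ℕ} {k : ℕ} (hg : ∀ x < k, g x < G.m)
    (hc : ∀ x, x + 1 < k → G.dst (g x) = G.src (g (x + 1))) (hk : 0 < k) :
    G.Walk (G.src (g 0)) ((List.range k).map g) (G.dst (g (k - 1))) := by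
  induction k with
  | zero => omega
  | succ k ih =>
    rw [List.range_succ, List.map_append, List.map_singleton, walk_concat]
    refine ⟨hg k (by omega), by simp, ?_⟩
    rcases Nat.eq_zero_or_pos k with rfl | hk
    · exact walk_nil.2 rfl
    · have := ih (fun x hx => hg x (by omega)) (fun x hx => hc x (by omega)) hk
      rwa [hc (k - 1) (by omega), Nat.sub_add_cancel hk] at this

theorem Cyc.exists_next {l : List ℕ} (h : G.Cyc l) {e : ℕ} (he : e ∈ l) :
    ∃ f ∈ l, G.src f = G.dst e := by
  obtain ⟨hne, ⟨u, _, hu⟩, _⟩ := h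
  have h1 : G.dst e ∈ l.map G.src ++ [u] := by
    rw [← hu]; exact List.mem_cons_of_mem _ (List.mem_map_of_mem he)
  rcases List.mem_append.1 h1 with h2 | h2
  · obtain ⟨f, hf, hfe⟩ := List.mem_map.1 h2
    exact ⟨f, hf, hfe⟩
  · cases l with
    | nil => exact absurd rfl hne
    | cons f l =>
      simp only [List.map_cons, List.cons_append, List.cons.injEq] at hu
      exact ⟨f, by simp, ((List.mem_singleton.1 h2).trans hu.1).symm⟩

end Net

namespace RealRAM

open Prog

/-- The list of edges in the output. -/
def State.output (s : State) : List ℕ := (List.range (s.wvar wLen)).map (s.warr aOut)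

section

variable {W : ℕ} {G : Net} {P : Params}

theorem Params.Ok.cells_lt (hP : P.Ok W G) : 4 * ((G.N + 1) * (G.N + G.m)) + 3 < W := by
  have := hP.edges_lt; have := hP.pow_le; omega

/-- The layers of the table of walks: rows `1, …, K` are complete. -/
structure Layered (G : Net) (mk f : ℕ → ℕ) (K : ℕ) : Prop where
  zero : ∀ v < G.N, f v ≠ 0
  sound : ∀ k < K, ∀ v < G.N, f ((k + 1) * G.N + v) ≠ 0 → ∃ e < G.m, mk e ≠ 0 ∧ G.src e = v ∧
    f ((k + 1) * G.N + v) = e + 1 ∧ f (k * G.N + G.dst e) ≠ 0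
  complete : ∀ k < K, ∀ e < G.m, mk e ≠ 0 → f (k * G.N + G.dst e) ≠ 0 →
    f ((k + 1) * G.N + G.src e) ≠ 0

/-- The row `k + 1` of the table is computed from the row `k`; it has zeros everywhere before. Entries
may be overwritten by other edges with the same tail. -/
theorem runs_layers {s : State} {mk : ℕ → ℕ} (hP : P.Ok W G) (hE : Env G P s)
    (hmk : s.warr aMask = mk) :
    Runs W layers s ((nxtBody.sz + 100) * (G.N * G.m + G.N * G.N + G.N + G.m + 1)) fun s' =>
      Layered G mk (s'.warr aNxt) G.N := by
  have hcl := hP.cells_lt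
  have hNN : (G.N + 1) * G.N < W := by nlinarith
  have hNm : G.m < W := hP.m_lt
  refine Runs.mono (T := (G.N + 1) * G.N * (3 + 8) + 8 + (G.N * (3 + 8) + 8 +
    (G.N * (G.m * (nxtBody.sz + 8) + 8 + 8) + 8))) (Runs.seq (Runs.forUp
    (fun k s' => ∀ x < k, s'.warr aNxt x = 0) rfl rfl hE.NN1 hNN (by simp)
    (fun k s' hk ha hk' hI => Runs.flat rfl ?_) fun s₁ ha₁ h₁ _ => ?_)) (by ring_nf; omega)
    fun _ _ h => h
  · intro x hx
    simp only [Cmd.den, WExp.eval, State.putW_warr, State.setW_warr, hk', if_true,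
      Function.update_apply]
    split_ifs with h
    · simp
    · exact hI x (by omega)
  have hE₁ := hE.agree ha₁ rfl
  refine Runs.seq (Runs.forUp (T := 3) (fun k s' => (∀ v < k, s'.warr aNxt v ≠ 0) ∧
    ∀ x, G.N ≤ x → x < (G.N + 1) * G.N → s'.warr aNxt x = 0) rfl rfl hE₁.N hP.N_lt
    ⟨by simp, fun x _ hx => by simpa using h₁ x hx⟩
    (fun k s' hk ha hk' ⟨hI, hI'⟩ => Runs.flat rfl ?_) fun s₂ ha₂ h₂ _ => ?_)
  · simp only [Cmd.den, WExp.eval, State.putW_warr, State.setW_warr, hk', if_true,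
      Function.update_apply, hP.one_mod]
    refine ⟨fun x hx => ?_, fun x hx hx' => ?_⟩
    · split_ifs with h
      · simp
      · exact hI x (by omega)
    · rw [if_neg (by omega)]
      exact hI' x hx hx'
  have hE₂ := hE₁.agree ha₂ rfl
  have hmk₂ : s₂.warr aMask = mk := by rw [ha₂.wa _ rfl, ha₁.wa _ rfl, hmk]
  refine Runs.forUp (fun k s' => Layered G mk (s'.warr aNxt) k ∧
    ∀ x, (k + 1) * G.N ≤ x → x < (G.N + 1) * G.N → s'.warr aNxt x = 0) rfl rfl hE₂.N hP.N_lt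
    ⟨⟨by simpa using h₂.1, by simp, by simp⟩, by simpa using h₂.2⟩ ?_ fun s' _ h => h.1
  rintro k s' hk ha hk' ⟨hL, hZ⟩
  have hE' := hE₂.agree ha rfl
  have hmk' : s'.warr aMask = mk := (ha.wa _ rfl).trans hmk₂
  set f := s'.warr aNxt with hf
  have hkN : (k + 2) * G.N ≤ (G.N + 1) * G.N := Nat.mul_le_mul_right _ (by omega)
  have m1 : (k + 1) * G.N = k * G.N + G.N := Nat.succ_mul k G.N
  have m2 : (k + 2) * G.N = k * G.N + G.N + G.N := by ring
  refine Runs.forUp (fun j s'' => (∀ x, x < (k + 1) * G.N ∨ (k + 2) * G.N ≤ x →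
      s''.warr aNxt x = f x) ∧
    (∀ v < G.N, s''.warr aNxt ((k + 1) * G.N + v) ≠ 0 → ∃ e < G.m, mk e ≠ 0 ∧ G.src e = v ∧
      s''.warr aNxt ((k + 1) * G.N + v) = e + 1 ∧ f (k * G.N + G.dst e) ≠ 0) ∧
    ∀ e < j, mk e ≠ 0 → f (k * G.N + G.dst e) ≠ 0 →
      s''.warr aNxt ((k + 1) * G.N + G.src e) ≠ 0) rfl rfl hE'.m hNm ⟨by simp [hf], ?_, by simp⟩
    ?_ ?_
  · intro v hv h
    refine absurd ?_ h
    exact hZ _ (by omega) (by omega)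
  · rintro j s'' hj ha'' hj'' ⟨i1, i2, i3⟩
    refine Runs.flat rfl ?_
    have hE'' := hE'.agree ha'' rfl
    have hmk'' : s''.warr aMask = mk := (ha''.wa _ rfl).trans hmk'
    have hk'' : s''.wvar 32 = k := (ha''.w _ rfl).trans hk'
    have hs := G.src_lt j hj
    have hd := G.dst_lt j hj
    have a1 : (k * G.N) % W = k * G.N := Nat.mod_eq_of_lt (by omega)
    have a2 : (k * G.N + G.dst j) % W = k * G.N + G.dst j := Nat.mod_eq_of_lt (by omega)
    have a3 : (k + 1) % W = k + 1 := Nat.mod_eq_of_lt (by have := hP.N_lt; omega)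
    have a4 : ((k + 1) * G.N) % W = (k + 1) * G.N := Nat.mod_eq_of_lt (by omega)
    have a5 : ((k + 1) * G.N + G.src j) % W = (k + 1) * G.N + G.src j :=
      Nat.mod_eq_of_lt (by omega)
    have a6 : (j + 1) % W = j + 1 := Nat.mod_eq_of_lt (by nlinarith)
    have e1 : s''.warr aNxt (k * G.N + G.dst j) = f (k * G.N + G.dst j) := i1 _ (by omega)
    have hcond : BExp.Holds W s'' (.and (.wlt (.const 0) (.get aMask (.var 33)))
        (.wlt (.const 0) (.get aNxt (.add (.mul (.var 32) (.var wN)) (.get aDst (.var 33)))))) ↔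
        mk j ≠ 0 ∧ f (k * G.N + G.dst j) ≠ 0 := by
      simp only [BExp.Holds, WExp.eval, hmk'', hj'', hk'', hE''.N, hE''.dst, a1, a2, e1,
        Nat.zero_mod, Nat.pos_iff_ne_zero]
    rw [nxtBody, Cmd.den]
    split_ifs with hb
    · rw [hcond] at hb
      simp only [Cmd.den, WExp.eval, State.setW_warr, State.putW_warr, if_true, hj'', hk'', hE''.N,
        hE''.src, hP.one_mod, a3, a4, a5, a6, Function.update_apply]
      refine ⟨fun x hx => ?_, fun v hv h => ?_, fun e he h0 h1 => ?_⟩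
      · rw [if_neg (by omega)]
        exact i1 x hx
      · by_cases hvj : v = G.src j
        · subst hvj
          exact ⟨j, hj, hb.1, rfl, by simp, hb.2⟩
        · rw [if_neg (by omega)] at h ⊢
          exact i2 v hv h
      · by_cases hej : G.src e = G.src j
        · rw [hej]; simp
        · rw [if_neg (by omega)]
          exact i3 e (by rcases Nat.lt_succ_iff_lt_or_eq.1 he with h | h
                         · exact h
                         · exact absurd (h ▸ rfl) hej) h0 h1
    · rw [hcond] at hb
      refine ⟨by simpa [Cmd.den] using i1, by simpa [Cmd.den] using i2, fun e he h0 h1 => ?_⟩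
      rcases Nat.lt_succ_iff_lt_or_eq.1 he with he | rfl
      · simpa [Cmd.den] using i3 e he h0 h1
      · exact absurd ⟨h0, h1⟩ hb
  · rintro s'' ha'' ⟨i1, i2, i3⟩
    have i1' : ∀ k' ≤ k, ∀ v < G.N, s''.warr aNxt (k' * G.N + v) = f (k' * G.N + v) := by
      intro k' hk' v hv
      have := Nat.mul_le_mul_right G.N hk'
      exact i1 _ (by omega)
    refine ⟨⟨fun v hv => ?_, fun k' hk'' v hv h => ?_, fun k' hk'' e he h0 h1 => ?_⟩, fun x hx hx' => ?_⟩
    · have := i1' 0 (by omega) v hv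
      simp only [zero_mul, zero_add] at this
      simp only [State.setW_warr, this]
      exact hL.zero v hv
    · simp only [State.setW_warr] at h ⊢
      rcases Nat.lt_succ_iff_lt_or_eq.1 hk'' with hlt | rfl
      · rw [i1' (k' + 1) (by omega) v hv] at h ⊢
        obtain ⟨e, he, e1, e2, e3, e4⟩ := hL.sound k' hlt v hv h
        exact ⟨e, he, e1, e2, e3, by rwa [i1' k' hlt.le _ (G.dst_lt e he)]⟩
      · obtain ⟨e, he, e1, e2, e3, e4⟩ := i2 v hv h
        exact ⟨e, he, e1, e2, e3, by rwa [i1' k' le_rfl _ (G.dst_lt e he)]⟩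
    · simp only [State.setW_warr] at h1 ⊢
      rw [i1' k' (by omega) _ (G.dst_lt e he)] at h1
      rcases Nat.lt_succ_iff_lt_or_eq.1 hk'' with hlt | rfl
      · rw [i1' (k' + 1) (by omega) _ (G.src_lt e he)]
        exact hL.complete k' hlt e he h0 h1
      · exact i3 e he h0 h1
    · simp only [State.setW_warr]
      have : (k + 1 + 1) * G.N = (k + 2) * G.N := rfl
      rw [i1 x (by omega)]
      exact hZ x (by omega) hx'

/-- A walk can go round a cycle of selected edges as long as needed, hence no cycle is missed when the
last row is zero. -/
theorem Layered.ne_zero_of_cyc {mk f : ℕ → ℕ} {K : ℕ} (h : Layered G mk f K) {l : List ℕ}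
    (hl : G.Cyc l) (hmk : ∀ e ∈ l, mk e ≠ 0) : ∀ k ≤ K, ∀ e ∈ l, f (k * G.N + G.src e) ≠ 0 := by
  intro k
  induction k with
  | zero => intro _ e he; simpa using h.zero _ (G.src_lt e (hl.lt e he))
  | succ k ih =>
    intro hk e he
    obtain ⟨e', he', hs⟩ := hl.exists_next he
    refine h.complete k (by omega) e (hl.lt e he) (hmk e he) ?_
    rw [← hs]
    exact ih (by omega) e' he'

/-- A walk with `N` edges repeats a vertex, and the part between the first two visits of the first
repeated vertex is a simple cycle. While the search goes on, the variable `36` is `0`, the first `j`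
edges of the walk are in `aEs`, the current vertex is in the variable `34`, and `aPos[u]` is one more than
the position of the edge of the walk with tail `u`, or `0` if there is none. -/
theorem runs_follow {s : State} {mk : ℕ → ℕ} (hP : P.Ok W G) (hE : Env G P s)
    (hL : Layered G mk (s.warr aNxt) G.N) (hv : s.wvar 34 < G.N)
    (hv0 : s.warr aNxt (G.N * G.N + s.wvar 34) ≠ 0) :
    Runs W follow s ((followBody.sz + 100) * (G.N + 1)) fun s' =>
      s'.wvar wLen ≠ 0 ∧ s'.wvar wLen ≤ G.N ∧ G.Cyc s'.output ∧ ∀ e ∈ s'.output, mk e ≠ 0 := by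
  have hcl := hP.cells_lt
  have hNW : G.N + 1 < W := by nlinarith [hP.m_pos]
  have hNN : (G.N + 1) * G.N + G.N + 1 < W := by nlinarith [hP.m_pos]
  have mN : (G.N + 1) * G.N = G.N * G.N + G.N := Nat.succ_mul _ _
  refine Runs.mono (T := G.N * (3 + 8) + 8 + (2 + ((G.N + 1) * (followBody.sz + 8) + 8 + (4 +
    (G.N * (6 + 8) + 8))))) (Runs.seq (Runs.forUp
    (fun k s' => ∀ x < k, s'.warr aPos x = 0) rfl rfl hE.N hP.N_lt (by simp)
    (fun k s' hk ha hk' hI => Runs.flat rfl ?_) fun s₁ ha₁ h₁ _ => Runs.seq (Runs.flat rfl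
    fun ha₂ => ?_))) (by ring_nf; omega) fun _ _ h => h
  · intro x hx
    simp only [Cmd.den, WExp.eval, State.putW_warr, State.setW_warr, hk', if_true,
      Function.update_apply]
    split_ifs with h
    · simp
    · exact hI x (by omega)
  set s₂ := (Cmd.wset 36 (.const 0)).den W s₁ with hs₂
  have hE₂ := (hE.agree ha₁ rfl).agree ha₂ rfl
  set nx := s.warr aNxt with hnx
  have hnx₂ : s₂.warr aNxt = nx := by rw [ha₂.wa _ rfl, ha₁.wa _ rfl]
  refine Runs.seq ((Runs.forUp (Q := fun s' => s'.wvar 38 < s'.wvar 39 ∧ s'.wvar 39 ≤ G.N ∧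
    (∀ x, s'.wvar 38 ≤ x → x < s'.wvar 39 → s'.warr aEs x < G.m ∧ mk (s'.warr aEs x) ≠ 0) ∧
    (∀ x, s'.wvar 38 ≤ x → x + 1 < s'.wvar 39 →
      G.dst (s'.warr aEs x) = G.src (s'.warr aEs (x + 1))) ∧
    G.dst (s'.warr aEs (s'.wvar 39 - 1)) = G.src (s'.warr aEs (s'.wvar 38)) ∧
    ∀ x y, s'.wvar 38 ≤ x → x < s'.wvar 39 → s'.wvar 38 ≤ y → y < s'.wvar 39 →
      G.src (s'.warr aEs x) = G.src (s'.warr aEs y) → x = y)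
    (fun j s' => (s'.wvar 36 = 0 ∧ s'.wvar 34 < G.N ∧ j ≤ G.N ∧
      (∀ x < j, s'.warr aEs x < G.m ∧ mk (s'.warr aEs x) ≠ 0) ∧
      (∀ x, x + 1 < j → G.dst (s'.warr aEs x) = G.src (s'.warr aEs (x + 1))) ∧
      (0 < j → G.dst (s'.warr aEs (j - 1)) = s'.wvar 34) ∧
      (∀ u < G.N, s'.warr aPos u ≠ 0 → s'.warr aPos u - 1 < j ∧
        G.src (s'.warr aEs (s'.warr aPos u - 1)) = u) ∧
      (∀ x < j, s'.warr aPos (G.src (s'.warr aEs x)) = x + 1) ∧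
      nx ((G.N - j) * G.N + s'.wvar 34) ≠ 0) ∨
    (s'.wvar 36 = 1 ∧ s'.wvar 38 < s'.wvar 39 ∧ s'.wvar 39 ≤ G.N ∧
    (∀ x, s'.wvar 38 ≤ x → x < s'.wvar 39 → s'.warr aEs x < G.m ∧ mk (s'.warr aEs x) ≠ 0) ∧
    (∀ x, s'.wvar 38 ≤ x → x + 1 < s'.wvar 39 →
      G.dst (s'.warr aEs x) = G.src (s'.warr aEs (x + 1))) ∧
    G.dst (s'.warr aEs (s'.wvar 39 - 1)) = G.src (s'.warr aEs (s'.wvar 38)) ∧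
    ∀ x y, s'.wvar 38 ≤ x → x < s'.wvar 39 → s'.wvar 38 ≤ y → y < s'.wvar 39 →
      G.src (s'.warr aEs x) = G.src (s'.warr aEs y) → x = y))
    rfl rfl hE₂.N1 hNW (.inl ?_) ?_ ?_).mono le_rfl fun s₃ ha₃ h₃ _ => ?_)
  · have e1 : s₂.wvar 34 = s.wvar 34 := by rw [ha₂.w _ rfl, ha₁.w _ rfl]
    have e2 : s₂.warr aPos = s₁.warr aPos := ha₂.wa _ rfl
    refine ⟨by simp [hs₂, Cmd.den, WExp.eval], by simpa [e1] using hv, by omega, by simp, by simp,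
      by simp, fun u hu h => ?_, by simp, by simpa [e1] using hv0⟩
    rw [State.setW_warr, e2, h₁ u hu] at h
    exact absurd rfl h
  · intro j s' hj ha hj' hI
    refine Runs.flat rfl ?_
    have hE' := hE₂.agree ha rfl
    have hnx' : s'.warr aNxt = nx := (ha.wa _ rfl).trans hnx₂
    have one : 1 % W = 1 := hP.one_mod
    rcases hI with ⟨h36, hvN, hjN, i1, i2, i3, i4, i5, i6⟩ | ⟨h36, i1⟩
    swap
    · rw [followBody, Cmd.den, if_neg (show ¬ BExp.Holds W s' _ by
        simp [BExp.Holds, WExp.eval, h36, one])]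
      right
      simpa [Cmd.den] using ⟨h36, i1⟩
    rw [followBody, Cmd.den, if_pos (show BExp.Holds W s' _ by
      simp [BExp.Holds, WExp.eval, h36, one]), Cmd.den]
    set v := s'.wvar 34 with hv
    set f := s'.warr aEs with hf
    have injf : ∀ x y, x < j → y < j → G.src (f x) = G.src (f y) → x = y := by
      intro x y hx hy hxy
      have := i5 x hx
      rw [hxy, i5 y hy] at this
      omega
    split_ifs with hb
    · -- the current vertex has been visited before
      have hb : s'.warr aPos v ≠ 0 := by
        simpa [BExp.Holds, WExp.eval, ← hv, Nat.pos_iff_ne_zero] using hb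
      obtain ⟨p1, p2⟩ := i4 v hvN hb
      have a1 : (s'.warr aPos v - 1) % W = s'.warr aPos v - 1 := Nat.mod_eq_of_lt (by omega)
      right
      simp only [block, Cmd.den, WExp.eval, State.setW_wvar, State.setW_warr, ← hv, one, a1, if_true,
        if_false, Nat.reduceEqDiff, hj', ← hf]
      refine ⟨trivial, p1, hjN, fun x _ hx => i1 x hx, fun x _ hx => i2 x hx, ?_,
        fun x y _ hx _ hy => injf x y hx hy⟩
      rw [i3 (by omega), p2]
    · have hb : s'.warr aPos v = 0 := by
        simpa [BExp.Holds, WExp.eval, ← hv] using hb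
      -- the vertices visited so far are different, hence fewer than `N`
      have hjlt : j < G.N := by
        by_contra hcon
        obtain rfl : j = G.N := by omega
        have hsub : (Finset.range G.N).image (fun x => G.src (f x)) ⊆
            (Finset.range G.N).erase v := by
          intro y hy
          obtain ⟨x, hx, rfl⟩ := Finset.mem_image.1 hy
          have hx := Finset.mem_range.1 hx
          refine Finset.mem_erase.2 ⟨fun h => ?_, Finset.mem_range.2 (G.src_lt _ (i1 x hx).1)⟩
          have := i5 x hx
          simp only [h, hb] at this
          omega
        have h1 := Finset.card_le_card hsub
        rw [Finset.card_image_of_injOn (fun x hx y hy h => injf x y (by simpa using hx)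
          (by simpa using hy) h), Finset.card_erase_of_mem (Finset.mem_range.2 hvN),
          Finset.card_range] at h1
        omega
      have hrow : (G.N - j) * G.N ≤ G.N * G.N := Nat.mul_le_mul_right _ (by omega)
      obtain ⟨k, hk⟩ : ∃ k, G.N - j = k + 1 := ⟨G.N - j - 1, by omega⟩
      rw [hk] at i6
      obtain ⟨e, he, e1, e2, e3, e4⟩ := hL.sound k (by omega) v hvN i6
      have a0 : (G.N - j) % W = k + 1 := by rw [hk]; exact Nat.mod_eq_of_lt (by omega)
      rw [hk] at hrow
      have a1 : ((k + 1) * G.N) % W = (k + 1) * G.N := Nat.mod_eq_of_lt (by omega)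
      have a2 : ((k + 1) * G.N + v) % W = (k + 1) * G.N + v := Nat.mod_eq_of_lt (by omega)
      have a3 : (e + 1 - 1) % W = e := by
        rw [Nat.add_sub_cancel]; exact Nat.mod_eq_of_lt (by have := hP.m_lt; omega)
      have a4 : (j + 1) % W = j + 1 := Nat.mod_eq_of_lt (by omega)
      left
      simp only [block, Cmd.den, WExp.eval, State.setW_wvar, State.setW_warr, State.putW_wvar,
        State.putW_warr, ← hv, one, if_true, if_false, Nat.reduceEqDiff, hj', hE'.N, hE'.dst, ← hf,
        hnx', a0, a1, a2, a4, e3, a3, Function.update_self, h36]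
      refine ⟨trivial, G.dst_lt e he, hjlt, fun x hx => ?_, fun x hx => ?_, fun _ => ?_,
        fun u hu h => ?_, fun x hx => ?_, ?_⟩
      · by_cases hxj : x = j
        · subst hxj; simp [he, e1]
        · rw [Function.update_of_ne hxj]; exact i1 x (by omega)
      · rw [Function.update_of_ne (by omega)]
        by_cases hxj : x + 1 = j
        · subst hxj
          rw [Function.update_self, e2]
          exact i3 (by omega)
        · rw [Function.update_of_ne hxj]; exact i2 x (by omega)
      · simp
      · by_cases huv : u = v
        · subst huv; simp [e2]
        · rw [Function.update_of_ne huv] at h ⊢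
          obtain ⟨q1, q2⟩ := i4 u hu h
          exact ⟨by omega, by rwa [Function.update_of_ne (by omega)]⟩
      · by_cases hxj : x = j
        · subst hxj; simp [e2]
        · rw [Function.update_of_ne hxj]
          have hx' := i5 x (by omega)
          rw [Function.update_of_ne]
          · exact hx'
          · intro h; rw [h, hb] at hx'; omega
      · rw [show G.N - (j + 1) = k by omega]
        exact e4
  · rintro s' - (h | h)
    · exact absurd h.2.2.1 (by omega)
    · exact h.2
  · have hE₃ := hE₂.agree ha₃ rfl
    obtain ⟨c1, c2, c3, c4, c5, c6⟩ := h₃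
    refine Runs.seq (Runs.flat rfl fun ha₄ => ?_)
    set s₄ := (Cmd.wset wLen (.sub (.var 39) (.var 38))).den W s₃ with hs₄
    have l₄ : s₄.wvar wLen = s₃.wvar 39 - s₃.wvar 38 := by
      simp only [hs₄, Cmd.den, WExp.eval, State.setW_wvar, if_true]
      exact Nat.mod_eq_of_lt (by omega)
    set len := s₃.wvar 39 - s₃.wvar 38 with hlen
    set st := s₃.wvar 38 with hst
    set f := s₃.warr aEs with hf
    have st₄ : s₄.wvar 38 = st := ha₄.w _ rfl
    have f₄ : s₄.warr aEs = f := ha₄.wa _ rfl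
    refine Runs.mono (Runs.forUp (T := 6) (fun k s' => ∀ x < k, s'.warr aOut x = f (st + x))
      rfl rfl l₄ (by omega) (by simp) ?_ fun s' ha' hI => ?_)
      (show len * (6 + 8) + 8 ≤ _ by
        have : len ≤ G.N := by omega
        omega) fun _ _ h => h
    · intro k s' hk ha hk' hI
      refine Runs.flat rfl ?_
      intro x hx
      have a1 : (st + k) % W = st + k := Nat.mod_eq_of_lt (by omega)
      simp only [Cmd.den, WExp.eval, State.putW_warr, State.setW_warr, hk', if_true,
        Function.update_apply, ha.w 38 rfl, st₄, ha.wa aEs rfl, f₄, a1]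
      split_ifs with h
      · rw [h]
      · exact hI x (by omega)
    · have hl' : s'.wvar wLen = len := (ha'.w _ rfl).trans l₄
      have hout : s'.output = (List.range len).map fun x => f (st + x) := by
        rw [State.output, hl']
        exact List.map_congr_left fun x hx => hI x (List.mem_range.1 hx)
      have hw := Net.walk_map_range (G := G) (g := fun x => f (st + x)) (k := len)
        (fun x hx => (c3 (st + x) (by omega) (by omega)).1)
        (fun x hx => c4 (st + x) (by omega) (by omega)) (by omega)
      have e1 : st + (len - 1) = s₃.wvar 39 - 1 := by omega
      simp only [e1, c5, add_zero] at hw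
      refine ⟨by omega, by omega, ⟨?_, ⟨_, hout ▸ hw⟩, ?_⟩, ?_⟩
      · rw [hout, ne_eq, List.map_eq_nil_iff, List.range_eq_nil]; omega
      · rw [hout, List.map_map]
        refine List.Nodup.map_on (fun x hx y hy h => ?_) List.nodup_range
        have hx := List.mem_range.1 hx
        have hy := List.mem_range.1 hy
        have := c6 (st + x) (st + y) (by omega) (by omega) (by omega) (by omega) h
        omega
      · intro e he
        rw [hout] at he
        obtain ⟨x, hx, rfl⟩ := List.mem_map.1 he
        have hx := List.mem_range.1 hx
        exact (c3 (st + x) (by omega) (by omega)).2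

/-- A constant for the running time of `findCycle`. -/
def cycleConst : ℕ := nxtBody.sz + pickBody.sz + followBody.sz + 400

/-- `mk e ≠ 0` if and only if the edge `e` is selected. -/
theorem runs_findCycle {s : State} {mk : ℕ → ℕ} (hP : P.Ok W G) (hE : Env G P s)
    (hmk : s.warr aMask = mk) :
    Runs W findCycle s (cycleConst * (G.N * G.m + G.N * G.N + G.N + G.m + 1)) fun s' =>
      s'.wvar wLen ≤ G.N ∧
      ((s'.wvar wLen ≠ 0 ∧ G.Cyc s'.output ∧ ∀ e ∈ s'.output, mk e ≠ 0) ∨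
        (s'.wvar wLen = 0 ∧ ∀ l, G.Cyc l → ∃ e ∈ l, mk e = 0)) := by
  have hcl := hP.cells_lt
  have hNN : (G.N + 1) * G.N < W := by nlinarith
  have mN : (G.N + 1) * G.N = G.N * G.N + G.N := Nat.succ_mul _ _
  refine Runs.mono (T := (nxtBody.sz + 100) * (G.N * G.m + G.N * G.N + G.N + G.m + 1) + (2 +
    (G.N * (pickBody.sz + 8) + 8 + (2 + (3 + (followBody.sz + 100) * (G.N + 1))))))
    (Runs.seq ((runs_layers hP hE hmk).mono le_rfl fun s₁ ha₁ h₁ _ => Runs.seq (Runs.flat rfl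
      fun ha₂ => ?_))) (by unfold cycleConst; ring_nf; omega) fun _ _ h => h
  set s₂ := (Cmd.wset 34 (.var wN)).den W s₁ with hs₂
  have hE₁ := hE.agree ha₁ rfl
  have hE₂ := hE₁.agree ha₂ rfl
  set nx := s₁.warr aNxt with hnx
  have hnx₂ : s₂.warr aNxt = nx := ha₂.wa _ rfl
  refine Runs.seq ((Runs.forUp (fun k s' => (s'.wvar 34 < G.N ∧ nx (G.N * G.N + s'.wvar 34) ≠ 0) ∨
    (s'.wvar 34 = G.N ∧ ∀ v < k, nx (G.N * G.N + v) = 0)) rfl rfl hE₂.N hP.N_lt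
    (.inr ⟨by simp [hs₂, Cmd.den, WExp.eval, hE₁.N], by simp⟩) ?_ fun s₃ ha₃ h₃ _ =>
    Runs.seq (Runs.flat rfl fun ha₄ => ?_)))
  · intro k s' hk ha hk' hI
    refine Runs.flat rfl ?_
    have hE' := hE₂.agree ha rfl
    have a1 : (G.N * G.N) % W = G.N * G.N := Nat.mod_eq_of_lt (by omega)
    have a2 : (G.N * G.N + k) % W = G.N * G.N + k := Nat.mod_eq_of_lt (by omega)
    have hcond : BExp.Holds W s' (.wlt (.const 0) (.get aNxt
        (.add (.mul (.var wN) (.var wN)) (.var 35)))) ↔ nx (G.N * G.N + k) ≠ 0 := by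
      simp only [BExp.Holds, WExp.eval, hE'.N, hk', a1, a2, ha.wa aNxt rfl, hnx₂, Nat.zero_mod,
        Nat.pos_iff_ne_zero]
    rw [pickBody, Cmd.den]
    split_ifs with hb
    · rw [hcond] at hb
      left
      simpa [Cmd.den, WExp.eval, hk'] using ⟨hk, hb⟩
    · rw [hcond, not_not] at hb
      rcases hI with hI | hI
      · left; simpa [Cmd.den] using hI
      · right
        refine ⟨by simpa [Cmd.den] using hI.1, fun v hv => ?_⟩
        rcases Nat.lt_succ_iff_lt_or_eq.1 hv with hv | rfl
        · exact hI.2 v hv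
        · exact hb
  · set s₄ := (Cmd.wset wLen (.const 0)).den W s₃ with hs₄
    have hE₄ := (hE₂.agree ha₃ rfl).agree ha₄ rfl
    have e34 : s₄.wvar 34 = s₃.wvar 34 := ha₄.w _ rfl
    have hnx₄ : s₄.warr aNxt = nx := by rw [ha₄.wa _ rfl, ha₃.wa _ rfl, hnx₂]
    refine Runs.ite (fun hb => ?_) fun hb => ?_
    · have hb : s₃.wvar 34 < G.N := by simpa [BExp.Holds, WExp.eval, hE₄.N, e34] using hb
      rcases h₃ with h₃ | h₃
      swap
      · omega
      refine (runs_follow (mk := mk) hP hE₄ (by rw [hnx₄]; exact h₁) (by rwa [e34])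
        (by rw [hnx₄, e34]; exact h₃.2)).mono le_rfl fun s₅ _ h₅ => ⟨h₅.2.1, .inl ⟨h₅.1, h₅.2.2⟩⟩
    · have hb : ¬ s₃.wvar 34 < G.N := by simpa [BExp.Holds, WExp.eval, hE₄.N, e34] using hb
      rcases h₃ with h₃ | h₃
      · exact absurd h₃.1 hb
      refine Runs.mono (Runs.flat rfl (Q := fun s' => s' = s₄) rfl) (T' := _)
        (show 1 ≤ _ from Nat.mul_pos (by omega) (by omega)) ?_
      rintro s' - rfl
      have hlen : s₄.wvar wLen = 0 := by simp [hs₄, Cmd.den, WExp.eval]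
      refine ⟨by omega, .inr ⟨hlen, fun l hl => ?_⟩⟩
      by_contra! hcon
      obtain ⟨e, he⟩ := List.exists_mem_of_ne_nil l hl.1
      exact h₁.ne_zero_of_cyc hl hcon G.N le_rfl e he (h₃.2 _ (G.src_lt e (hl.lt e he)))

end

end RealRAM

/-! ### Collecting candidates -/

namespace RealRAM

open Prog

/-- The line `z ↦ x - z * y` is a candidate in the group `g`. -/
def Has (s : State) (g : ℕ) (x y : ℝ) : Prop :=
  ∃ i < s.wvar wS, s.warr aCg i = g ∧ s.rarr fCa i = x ∧ s.rarr fCb i = y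

/-- The candidates in `D`, at most `n` in number, are appended between the states `s` and `s'`. -/
structure Adds (n : ℕ) (D : ℕ → ℝ → ℝ → Prop) (s s' : State) : Prop where
  le : s'.wvar wS ≤ s.wvar wS + n
  has : ∀ g x y, Has s' g x y ↔ Has s g x y ∨ D g x y

section

variable {W n n' : ℕ} {D D' : ℕ → ℝ → ℝ → Prop} {s s' s'' : State}

theorem Adds.trans (h : Adds n D s s') (h' : Adds n' D' s' s'') :
    Adds (n + n') (fun g x y => D g x y ∨ D' g x y) s s'' :=
  ⟨by have := h.le; have := h'.le; omega, fun g x y => by rw [h'.has, h.has, or_assoc]⟩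

theorem Adds.mono (h : Adds n D s s') (hn : n ≤ n') (hD : ∀ g x y, D g x y ↔ D' g x y) :
    Adds n' D' s s' :=
  ⟨h.le.trans (by omega), fun g x y => by rw [h.has, hD]⟩

theorem Has.setW {i v g : ℕ} {x y : ℝ} (hi : i ≠ 17) : Has (s.setW i v) g x y ↔ Has s g x y := by
  simp [Has, Ne.symm hi]

/-- The values `x` and `y` are computed after `aCg` has been written, and in the case of `y` also `fCa`. -/
theorem runs_push {g : WExp} {a b : RExp} {i : ℕ} {x y : ℝ} (hS : s.wvar wS + 1 < W)
    (hg : g.eval W s = i) (ha : a.eval W (s.putW aCg (s.wvar wS) i) = x)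
    (hb : b.eval W ((s.putW aCg (s.wvar wS) i).putR fCa (s.wvar wS) x) = y) :
    Runs W (push g a b) s (push g a b).sz
      (Adds 1 (fun g' x' y' => g' = i ∧ x' = x ∧ y' = y) s) := by
  have one : 1 % W = 1 := Nat.mod_eq_of_lt (by omega)
  have e : (s.wvar wS + 1) % W = s.wvar wS + 1 := Nat.mod_eq_of_lt hS
  refine Runs.flat rfl ?_
  simp only [push, block, Cmd.den, Cmd.inc, WExp.eval, hg, State.putW_wvar, State.putR_wvar, ha, hb,
    one, e]
  refine ⟨by simp, fun g' x' y' => ?_⟩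
  simp only [Has, State.setW_wvar, State.setW_warr, State.setW_rarr, State.putR_warr,
    State.putR_rarr, State.putW_warr, State.putW_rarr, if_true, Nat.reduceEqDiff, if_false,
    Function.update_apply]
  constructor
  · rintro ⟨j, hj, h1, h2, h3⟩
    rcases Nat.lt_succ_iff_lt_or_eq.1 hj with hj | rfl
    · have := hj.ne
      exact .inl ⟨j, hj, by simpa [this] using h1, by simpa [this] using h2,
        by simpa [this] using h3⟩
    · right
      simp at h1 h2 h3
      exact ⟨h1.symm, h2.symm, h3.symm⟩
  · rintro (⟨j, hj, h1, h2, h3⟩ | ⟨rfl, rfl, rfl⟩)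
    · have := hj.ne
      exact ⟨j, by omega, by simpa [this] using h1, by simpa [this] using h2,
        by simpa [this] using h3⟩
    · exact ⟨_, Nat.lt_succ_self _, by simp⟩

/-- A case distinction around a collecting program adds a condition to the candidates. -/
theorem runs_guard {b : BExp} {p : Cmd} {B : Prop} {T : ℕ} (hb : b.Holds W s ↔ B)
    (h : B → Runs W p s T (Adds n D s)) :
    Runs W (.ite b p .skip) s (b.cost + (T + 1))
      (Adds n (fun g x y => B ∧ D g x y) s) := by
  refine Runs.ite (fun h1 => ?_) fun h1 => ?_
  · exact (h (hb.1 h1)).mono (by omega) fun s' _ h' =>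
      h'.mono le_rfl fun g x y => by simp [hb.1 h1]
  · refine Runs.mono (Runs.flat rfl (Q := fun s' => s' = s) rfl) (by simp [Cmd.sz]) ?_
    rintro s' - rfl
    exact ⟨by omega, fun g x y => by simp [show ¬ B from fun h => h1 (hb.2 h)]⟩

/-- A loop that collects candidates. -/
theorem runs_collect {i b N T : ℕ} {p : Cmd} {D : ℕ → ℕ → ℝ → ℝ → Prop}
    (hi : p.writesW i = false) (hb : (Cmd.forUp i b p).writesW b = false) (hiS : i ≠ 17)
    (hN : s.wvar b = N) (hW : N < W) (hcap : s.wvar wS + N * n < W)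
    (h : ∀ k s', k < N → Agree (.forUp i b p) s s' → s'.wvar i = k → s'.wvar wS + n < W →
      Runs W p s' T (Adds n (D k) s')) :
    Runs W (.forUp i b p) s (N * (T + 8) + 8)
      (Adds (N * n) (fun g x y => ∃ k < N, D k g x y) s) := by
  refine Runs.forUp (fun k => Adds (k * n) (fun g x y => ∃ j < k, D j g x y) s) hi hb hN hW
    ⟨by simp [Ne.symm hiS], fun g x y => by rw [Has.setW hiS]; simp⟩ (fun k s' hk ha hk' hI => ?_)
    fun s' _ h => h
  have h1 := hI.le
  have h2 : k * n + n ≤ N * n := by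
    rw [← Nat.succ_mul]; exact Nat.mul_le_mul_right _ hk
  refine (h k s' hk ha hk' (by omega)).mono le_rfl fun s'' _ h' => ?_
  have h3 := hI.trans h'
  refine ⟨?_, fun g x y => ?_⟩
  · have := h3.le
    simp only [State.setW_wvar, Ne.symm hiS, if_false]
    rw [Nat.succ_mul]; omega
  · rw [Has.setW hiS, h3.has]
    refine or_congr_right ⟨?_, ?_⟩
    · rintro (⟨j, hj, h⟩ | h)
      exacts [⟨j, by omega, h⟩, ⟨k, by omega, h⟩]
    · rintro ⟨j, hj, h⟩
      rcases Nat.lt_succ_iff_lt_or_eq.1 hj with hj | rfl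
      exacts [.inl ⟨j, hj, h⟩, .inr h]

/-- The line stored in the cell `i`. -/
def Line (s : State) (i : ℕ) (x y : ℝ) : Prop :=
  s.warr aWF i ≠ 0 ∧ x = s.rarr fWA i ∧ y = s.rarr fWB i

theorem runs_pushCell {g i : WExp} {j k : ℕ} (hS : s.wvar wS + 1 < W) (hg : g.eval W s = j)
    (hi : i.eval W s = k) (hi' : i.eval W (s.putW aCg (s.wvar wS) j) = k)
    (hi'' : ∀ x, i.eval W ((s.putW aCg (s.wvar wS) j).putR fCa (s.wvar wS) x) = k) :
    Runs W (pushCell g i) s (pushCell g i).sz (Adds 1 (fun g x y => g = j ∧ Line s k x y) s) := by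
  refine (runs_guard (B := s.warr aWF k ≠ 0)
    (by simp [BExp.Holds, WExp.eval, hi, Nat.pos_iff_ne_zero])
    fun _ => runs_push (x := s.rarr fWA k) (y := s.rarr fWB k) hS hg (by simp [RExp.eval, hi'])
    (by simp [RExp.eval, hi''])).mono (by simp [pushCell, Cmd.sz]) fun s' _ h =>
      h.mono le_rfl fun g x y => by rw [Line]; tauto

/-- For every group with a candidate in `D`, a line is stored that is one of these candidates and that
is minimal in its group on the current interval. -/
structure Selected (Gr : ℕ) (D : ℕ → ℝ → ℝ → Prop) (s : State) : Prop where
  le : ∀ g x y, D g x y → s.warr aWF g ≠ 0 ∧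
    ∀ z, Itv s z → s.rarr fWA g - z * s.rarr fWB g ≤ x - z * y
  mem : ∀ g < Gr, s.warr aWF g ≠ 0 → D g (s.rarr fWA g) (s.rarr fWB g)

/-- The second half of every stage: `D` is the set of all candidates because the list was empty in the
state `s₀`. -/
theorem runs_select {G : Net} {P : Params} {r Gr M : ℕ} {s₀ s : State} (hP : P.Ok W G)
    (hE : Env G P s) (hB : Bracket G s) (h₀ : s₀.wvar wS = 0) (hD : Adds M D s₀ s)
    (hr : s.wvar r = Gr) (hGr : ∀ g x y, D g x y → g < Gr) (hGW : Gr < W) (hM : M < 2 ^ P.lgB) :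
    Runs W (.seq (.wset wGr (.var r)) groupMin) s
      (2 + groupConst * (P.lgB + 1) * (Gr + M + G.N * G.m + G.N + G.m + P.lgB + 1))
      fun s' => Bracket G s' ∧ (∀ z, Itv s' z → Itv s z) ∧ Selected Gr D s' := by
  have hHas : ∀ g x y, Has s g x y ↔ D g x y := fun g x y => by
    rw [hD.has, or_iff_right]
    simp [Has, h₀]
  have hS : s.wvar wS ≤ M := by have := hD.le; omega
  refine Runs.seq (Runs.flat rfl fun ha => ?_)
  set s₁ := (Cmd.wset wGr (.var r)).den W s with hs₁
  have hC : Cands (s.wvar wS) Gr (s.warr aCg) (s.rarr fCa) (s.rarr fCb) s₁ := by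
    constructor <;> simp [hs₁, Cmd.den, WExp.eval, hr]
  refine (runs_groupMin hP (hE.agree ha rfl) hC (fun i hi => ?_) hGW (hS.trans_lt hM)
    (hB.agree ha rfl rfl rfl)).mono (by gcongr) fun s' ha' ⟨h1, h2, h3⟩ =>
    ⟨h1, fun z hz => ?_, ⟨fun g x y hg => ?_, fun g hg hw => ?_⟩⟩
  · exact hGr _ _ _ ((hHas _ _ _).1 ⟨i, hi, rfl, rfl, rfl⟩)
  · simpa [Itv, hs₁, Cmd.den] using h2 z hz
  · obtain ⟨i, hi, rfl, rfl, rfl⟩ := (hHas _ _ _).2 hg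
    exact h3.le i hi
  · obtain ⟨i, hi, e1, e2, e3⟩ := h3.mem g hg hw
    exact (hHas _ _ _).1 ⟨i, hi, e1, e2.symm, e3.symm⟩

end

end RealRAM

/-! ### The stages of the parametric search -/

namespace RealRAM

open Prog

/-- The stored lines belong to walks in the relation `R`, and on the current interval they are not
above the weights of these walks. -/
structure Optimal (G : Net) (Gr : ℕ) (R : ℕ → List ℕ → Prop) (s : State) : Prop where
  sound : ∀ g < Gr, ∀ x y, Line s g x y → ∃ l, R g l ∧ x = G.costSum l ∧ y = G.timeSum l
  complete : ∀ g l, R g l → ∃ x y, Line s g x y ∧ ∀ z, Itv s z → x - z * y ≤ G.wt z l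

/-- The walks from `u` to `v` with at most `k` edges, for the cell of `u` and `v`. -/
def WalkRel (G : Net) (k g : ℕ) (l : List ℕ) : Prop :=
  ∃ u < G.N, ∃ v < G.N, g = u * G.N + v ∧ G.Walk u l v ∧ l.length ≤ k

/-- The list `l` is a walk from the sample `a` to the sample `b` that consists of `2 ^ r` segments
with at most `h` edges between sampled vertices. -/
def Cov (G : Net) (P : Params) : ℕ → ℕ → List ℕ → ℕ → Prop
  | 0, a, l, b => G.Walk (P.C a) l (P.C b) ∧ l.length ≤ P.h
  | r + 1, a, l, b => ∃ k < P.L, ∃ l₁ l₂, l = l₁ ++ l₂ ∧ Cov G P r a l₁ k ∧ Cov G P r k l₂ b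

/-- The list `l` is a closed walk with at most `h` edges. -/
def Short (G : Net) (P : Params) (l : List ℕ) : Prop :=
  ∃ v < G.N, G.Walk v l v ∧ l.length ≤ P.h

/-- The walks represented in the matrix of the sampled vertices after `r` squarings, and the short
closed walks in the last cell. -/
def SampleRel (G : Net) (P : Params) (r g : ℕ) (l : List ℕ) : Prop :=
  (∃ a < P.L, ∃ b < P.L, g = a * P.L + b ∧ Cov G P r a l b) ∨ (g = P.L * P.L ∧ Short G P l)

/-- All closed walks that have been found, in the cell `0`. -/
def CloseRel (G : Net) (P : Params) (g : ℕ) (l : List ℕ) : Prop :=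
  g = 0 ∧ ((∃ a < P.L, Cov G P P.lg a l a) ∨ Short G P l)

theorem Cov.walk {G : Net} {P : Params} {r a b : ℕ} {l : List ℕ} (h : Cov G P r a l b) :
    G.Walk (P.C a) l (P.C b) := by
  induction r generalizing a b l with
  | zero => exact h.1
  | succ r ih =>
    obtain ⟨k, -, l₁, l₂, rfl, h₁, h₂⟩ := h
    exact (ih h₁).append (ih h₂)

theorem cell_lt {u v n : ℕ} (hu : u < n) (hv : v < n) : u * n + v < n * n := by nlinarith

theorem cell_inj {u v u' v' n : ℕ} (hv : v < n) (hv' : v' < n) (h : u * n + v = u' * n + v') :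
    u = u' ∧ v = v' := by
  have h1 : (u * n + v) % n = v := by
    rw [mul_comm, Nat.mul_add_mod, Nat.mod_eq_of_lt hv]
  have h2 : (u' * n + v') % n = v' := by
    rw [mul_comm, Nat.mul_add_mod, Nat.mod_eq_of_lt hv']
  have h3 : v = v' := by rw [← h1, ← h2, h]
  subst h3
  exact ⟨Nat.eq_of_mul_eq_mul_right (by omega : 0 < n) (by omega), rfl⟩

section

variable {W : ℕ} {G : Net} {P : Params} {s s' : State}

theorem eval_cell {x l u v n : ℕ} {y : WExp} (hx : s.wvar x = u) (hl : s.wvar l = n)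
    (hy : y.eval W s = v) (hu : u < n) (hv : v < n) (hW : n * n < W) :
    (cell x l y).eval W s = u * n + v := by
  have h := cell_lt hu hv
  simp only [cell, WExp.eval, hx, hl, hy]
  rw [Nat.mod_eq_of_lt (by omega : u * n < W), Nat.mod_eq_of_lt (by omega)]

theorem Line.agree {p : Cmd} (ha : Agree p s s') (h1 : p.putsW aWF = false)
    (h2 : p.putsR fWA = false) (h3 : p.putsR fWB = false) : Line s' = Line s := by
  funext i x y
  simp only [Line, ha.wa _ h1, ha.ra _ h2, ha.ra _ h3]

theorem Optimal.agree {Gr : ℕ} {R : ℕ → List ℕ → Prop} (h : Optimal G Gr R s) (hL : Line s' = Line s)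
    (hI : ∀ z, Itv s' z → Itv s z) : Optimal G Gr R s' :=
  ⟨fun g hg x y hl => h.sound g hg x y (hL ▸ hl), fun g l hl => by
    obtain ⟨x, y, h1, h2⟩ := h.complete g l hl
    exact ⟨x, y, hL ▸ h1, fun z hz => h2 z (hI z hz)⟩⟩

theorem itv_agree {p : Cmd} (ha : Agree p s s') (h1 : p.writesW wHas = false)
    (h2 : p.writesR rLo = false) (h3 : p.writesR rHi = false) (z : ℝ) : Itv s' z ↔ Itv s z := by
  simp only [Itv, ha.w _ h1, ha.r _ h2, ha.r _ h3]

/-- The first condition says that the candidates belong to walks, the second one that every walk is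
dominated by a candidate. -/
theorem Selected.optimal {Gr : ℕ} {D : ℕ → ℝ → ℝ → Prop} {R : ℕ → List ℕ → Prop}
    (h : Selected Gr D s)
    (h₁ : ∀ g x y, D g x y → ∃ l, R g l ∧ x = G.costSum l ∧ y = G.timeSum l)
    (h₂ : ∀ g l, R g l → ∃ x y, D g x y ∧ ∀ z, Itv s z → x - z * y ≤ G.wt z l) :
    Optimal G Gr R s := by
  refine ⟨fun g hg x y ⟨hw, hx, hy⟩ => ?_, fun g l hl => ?_⟩
  · subst hx; subst hy
    exact h₁ _ _ _ (h.mem g hg hw)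
  · obtain ⟨x, y, hd, hle⟩ := h₂ g l hl
    obtain ⟨h3, h4⟩ := h.le g x y hd
    exact ⟨_, _, ⟨h3, rfl, rfl⟩, fun z hz => (h4 z hz).trans (hle z hz)⟩

theorem Params.Ok.square_lt (hP : P.Ok W G) : G.N * G.N < W := by
  have := hP.cells_lt; nlinarith

theorem Params.Ok.samples_lt' (hP : P.Ok W G) :
    4 * (P.L * P.L * P.L + P.L * P.L + P.L + 1) < W := by
  have := hP.samples_lt; have := hP.pow_le; omega

/-- A constant for the running time of one stage. -/
def stageConst : ℕ := 3 * groupConst + (push (cell 58 wN (.var 58)) (.const 0) (.const 0)).sz +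
  (pushCell (.var 58) (.var 58)).sz + extendBody.sz + restrictBody.sz +
  (pushCell (.var wLL) (cell 58 wN (.var 58))).sz + squareBody.sz +
  (pushCell (.var wLL) (.var wLL)).sz + (pushCell (.const 0) (cell 58 wL (.var 58))).sz +
  (pushCell (.const 0) (.var wLL)).sz + 100

theorem runs_startStage (hP : P.Ok W G) (hE : Env G P s) (hB : Bracket G s) :
    Runs W startStage s
      (stageConst * (P.lgB + 1) * (G.N * G.N + G.N * G.m + G.N + G.m + P.lgB + 1))
      fun s' => Bracket G s' ∧ (∀ z, Itv s' z → Itv s z) ∧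
        Optimal G (G.N * G.N) (WalkRel G 0) s' := by
  have hNN := hP.square_lt
  have hN := hP.N_lt
  have hcl := hP.cells_lt
  refine Runs.mono (T := 2 + (G.N * ((push (cell 58 wN (.var 58)) (.const 0) (.const 0)).sz + 8) +
    8 + (2 + groupConst * (P.lgB + 1) *
      (G.N * G.N + G.N + G.N * G.m + G.N + G.m + P.lgB + 1))))
    (Runs.seq (Runs.flat rfl fun ha => ?_)) ?_ fun _ _ h => h
  · set s₁ := (Cmd.wset wS (.const 0)).den W s with hs₁
    have hS₁ : s₁.wvar wS = 0 := by simp [hs₁, Cmd.den, WExp.eval]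
    have hE₁ := hE.agree ha rfl
    refine Runs.seq (Runs.mono (runs_collect (n := 1)
      (D := fun v g x y => g = v * G.N + v ∧ x = 0 ∧ y = 0) rfl rfl (by decide) hE₁.N hN
      (by omega) fun v s' hv ha' hv' hS' => ?_) le_rfl fun s₂ ha₂ h₂ _ => ?_)
    · have hE' := hE₁.agree ha' rfl
      exact runs_push hS' (eval_cell hv' hE'.N (by simpa [WExp.eval] using hv') hv hv hNN)
        (by simp [RExp.eval]) (by simp [RExp.eval])
    · have hE₂ := hE₁.agree ha₂ rfl
      refine (runs_select hP hE₂ ((hB.agree ha rfl rfl rfl).agree ha₂ rfl rfl rfl) hS₁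
        (h₂.mono (by omega) fun g x y => Iff.rfl) hE₂.NN ?_ hNN ?_).mono le_rfl
        fun s₃ _ ⟨h3, h4, h5⟩ => ⟨h3, fun z hz => ?_, h5.optimal ?_ ?_⟩
      · rintro g x y ⟨v, hv, rfl, -, -⟩
        exact cell_lt hv hv
      · have := hP.edges_lt; nlinarith
      · exact (itv_agree ha rfl rfl rfl z).1 ((itv_agree ha₂ rfl rfl rfl z).1 (h4 z hz))
      · rintro g x y ⟨v, hv, rfl, rfl, rfl⟩
        exact ⟨[], ⟨v, hv, v, hv, rfl, Net.walk_nil.2 rfl, le_rfl⟩, by simp, by simp⟩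
      · rintro g l ⟨u, hu, v, hv, rfl, hl, h0⟩
        rw [Nat.le_zero, List.length_eq_zero_iff] at h0
        subst h0
        obtain rfl := Net.walk_nil.1 hl
        exact ⟨0, 0, ⟨u, hu, rfl, rfl, rfl⟩, fun z _ => by simp⟩
  · unfold stageConst; ring_nf; omega

/-- A walk with `k + 1` edges is a walk with `k` edges and a last edge; replacing the former by the stored
walk with the same ends does not increase the weight on the interval. -/
theorem runs_extendStage {k : ℕ} (hP : P.Ok W G) (hE : Env G P s) (hB : Bracket G s)
    (hO : Optimal G (G.N * G.N) (WalkRel G k) s) :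
    Runs W extendStage s
      (stageConst * (P.lgB + 1) * (G.N * G.N + G.N * G.m + G.N + G.m + P.lgB + 1))
      fun s' => Bracket G s' ∧ (∀ z, Itv s' z → Itv s z) ∧
        Optimal G (G.N * G.N) (WalkRel G (k + 1)) s' := by
  have hNN := hP.square_lt
  have hN := hP.N_lt
  have hcl := hP.cells_lt
  have hcap : G.N * G.N + G.N * G.m < W := by nlinarith
  refine Runs.mono (T := 2 + (G.N * G.N * ((pushCell (.var 58) (.var 58)).sz + 8) + 8 +
    ((G.N * ((G.m * (extendBody.sz + 8) + 8) + 8) + 8) + (2 + groupConst * (P.lgB + 1) *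
      (G.N * G.N + (G.N * G.N + G.N * G.m) + G.N * G.m + G.N + G.m + P.lgB + 1)))))
    (Runs.seq (Runs.flat rfl fun ha => ?_)) ?_ fun _ _ h => h
  · set s₁ := (Cmd.wset wS (.const 0)).den W s with hs₁
    have hS₁ : s₁.wvar wS = 0 := by simp [hs₁, Cmd.den, WExp.eval]
    have hE₁ := hE.agree ha rfl
    have hL₁ : Line s₁ = Line s := Line.agree ha rfl rfl rfl
    refine Runs.seq (Runs.mono (runs_collect (n := 1)
      (D := fun i g x y => g = i ∧ Line s i x y) rfl rfl (by decide) hE₁.NN hNN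
      (by omega) fun i s' hi ha' hi' hS' => ?_) le_rfl fun s₂ ha₂ h₂ _ => ?_)
    · rw [← hL₁, ← Line.agree ha' rfl rfl rfl]
      exact runs_pushCell hS' (by simpa [WExp.eval] using hi') (by simpa [WExp.eval] using hi')
        (by simpa [WExp.eval] using hi') (by simpa [WExp.eval] using hi')
    · have hE₂ := hE₁.agree ha₂ rfl
      have hL₂ : Line s₂ = Line s := (Line.agree ha₂ rfl rfl rfl).trans hL₁
      have hS₂ : s₂.wvar wS ≤ G.N * G.N := by have := h₂.le; omega
      refine Runs.seq (Runs.mono (runs_collect (n := G.m * 1)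
        (D := fun u g x y => ∃ e < G.m, s.warr aWF (u * G.N + G.src e) ≠ 0 ∧ (g = u * G.N + G.dst e ∧
          x = s.rarr fWA (u * G.N + G.src e) + G.c e ∧
          y = s.rarr fWB (u * G.N + G.src e) + G.t e)) rfl rfl (by decide) hE₂.N hN
        (by rw [mul_one]; omega) fun u s' hu ha' hu' hS' => ?_) le_rfl fun s₃ ha₃ h₃ _ => ?_)
      · have hE' := hE₂.agree ha' rfl
        refine runs_collect (n := 1) rfl rfl (by decide) hE'.m hP.m_lt (by omega)
          fun e s'' he ha'' he' hS'' => ?_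
        have hE'' := hE'.agree ha'' rfl
        have hu'' : s''.wvar 58 = u := (ha''.w 58 rfl).trans hu'
        have e1 : s''.warr aWF = s.warr aWF := by
          rw [ha''.wa _ rfl, ha'.wa _ rfl, ha₂.wa _ rfl, ha.wa _ rfl]
        have e2 : s''.rarr fWA = s.rarr fWA := by
          rw [ha''.ra _ rfl, ha'.ra _ rfl, ha₂.ra _ rfl, ha.ra _ rfl]
        have e3 : s''.rarr fWB = s.rarr fWB := by
          rw [ha''.ra _ rfl, ha'.ra _ rfl, ha₂.ra _ rfl, ha.ra _ rfl]
        have c1 : ∀ s₄ : State, s₄.wvar = s''.wvar → s₄.warr aSrc = s''.warr aSrc →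
            (cell 58 wN (.get aSrc (.var 59))).eval W s₄ = u * G.N + G.src e := fun s₄ q1 q2 =>
          eval_cell (by rw [q1, hu'']) (by rw [q1, hE''.N])
            (by simp [WExp.eval, q1, q2, he', hE''.src]) hu (G.src_lt e he) hNN
        have c2 : (cell 58 wN (.get aDst (.var 59))).eval W s'' = u * G.N + G.dst e :=
          eval_cell hu'' hE''.N (by simp [WExp.eval, he', hE''.dst]) hu (G.dst_lt e he) hNN
        refine runs_guard (by simp [BExp.Holds, WExp.eval, c1 s'' rfl rfl, e1, Nat.pos_iff_ne_zero])
          fun _ => runs_push hS'' c2 ?_ ?_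
        · simp [RExp.eval, WExp.eval, c1 (s''.putW 11 (s''.wvar 17) (u * G.N + G.dst e)) rfl (by simp),
            e2, hE''.c, he']
        · simp [RExp.eval, WExp.eval, c1 ((s''.putW 11 (s''.wvar 17) (u * G.N + G.dst e)).putR 3
            (s''.wvar 17) (s.rarr fWA (u * G.N + G.src e) + G.c e)) rfl (by simp), e3, hE''.t, he']
      · have hE₃ := hE₂.agree ha₃ rfl
        refine (runs_select hP hE₃ (((hB.agree ha rfl rfl rfl).agree ha₂ rfl rfl rfl).agree ha₃
          rfl rfl rfl) hS₁ ((h₂.trans h₃).mono (n' := G.N * G.N + G.N * G.m) (by simp)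
          fun g x y => Iff.rfl) hE₃.NN ?_ hNN ?_).mono le_rfl
          fun s₄ _ ⟨h4, h5, h6⟩ => ?_
        · rintro g x y (⟨v, hv, rfl, -⟩ | ⟨u, hu, e, he, -, rfl, -⟩)
          · exact hv
          · exact cell_lt hu (G.dst_lt e he)
        · have := hP.edges_lt; nlinarith
        · have hI : ∀ z, Itv s₄ z → Itv s z := fun z hz => (itv_agree ha rfl rfl rfl z).1
            ((itv_agree ha₂ rfl rfl rfl z).1 ((itv_agree ha₃ rfl rfl rfl z).1 (h5 z hz)))
          refine ⟨h4, hI, h6.optimal ?_ ?_⟩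
          · rintro g x y (⟨v, hv, rfl, hl⟩ | ⟨u, hu, e, he, hw, rfl, rfl, rfl⟩)
            · obtain ⟨l, ⟨u, hu, v, hv, hg, hl, hk⟩, h⟩ := hO.sound _ hv x y hl
              exact ⟨l, ⟨u, hu, v, hv, hg, hl, by omega⟩, h⟩
            · obtain ⟨l, ⟨u', hu', v', hv', hg, hl, hk⟩, hx, hy⟩ :=
                hO.sound _ (cell_lt hu (G.src_lt e he)) _ _ ⟨hw, rfl, rfl⟩
              obtain ⟨rfl, rfl⟩ := cell_inj (G.src_lt e he) hv' hg
              exact ⟨l ++ [e], ⟨u, hu, _, G.dst_lt e he, rfl, Net.walk_concat.2 ⟨he, rfl, hl⟩,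
                by simpa using hk⟩, by simp [hx], by simp [hy]⟩
          · rintro g l ⟨u, hu, v, hv, rfl, hl, hk⟩
            rcases Nat.le_succ_iff.1 hk with hk | hk
            · obtain ⟨x, y, hxy, hle⟩ := hO.complete _ l ⟨u, hu, v, hv, rfl, hl, hk⟩
              exact ⟨x, y, .inl ⟨_, cell_lt hu hv, rfl, hxy⟩, fun z hz => hle z (hI z hz)⟩
            · rcases List.eq_nil_or_concat l with rfl | ⟨l', e, rfl⟩
              · simp at hk
              rw [List.concat_eq_append] at hl hk ⊢
              obtain ⟨he, rfl, hl'⟩ := Net.walk_concat.1 hl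
              obtain ⟨x, y, ⟨hw, hx, hy⟩, hle⟩ := hO.complete _ l'
                ⟨u, hu, _, G.src_lt e he, rfl, hl', by simp at hk; omega⟩
              refine ⟨x + G.c e, y + G.t e, .inr ⟨u, hu, e, he, hw, rfl, by rw [hx], by rw [hy]⟩,
                fun z hz => ?_⟩
              have := hle z (hI z hz)
              simp only [Net.wt_append, Net.wt_cons, Net.wt_nil, Net.w]
              linarith
  · unfold stageConst; ring_nf; omega

end

end RealRAM

namespace RealRAM

open Prog

section

variable {W : ℕ} {G : Net} {P : Params} {s s' : State}

theorem runs_restrictStage (hP : P.Ok W G) (hE : Env G P s) (hB : Bracket G s)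
    (hO : Optimal G (G.N * G.N) (WalkRel G P.h) s) :
    Runs W restrictStage s (stageConst * (P.lgB + 1) * (P.L * P.L * P.L + P.L * P.L + P.L +
        G.N * G.m + G.N + G.m + P.lgB + 1))
      fun s' => Bracket G s' ∧ (∀ z, Itv s' z → Itv s z) ∧
        Optimal G (P.L * P.L + 1) (SampleRel G P 0) s' := by
  have hNN := hP.square_lt
  have hN := hP.N_lt
  have hcl := hP.cells_lt
  have hsl := hP.samples_lt'
  refine Runs.mono (T := 2 + (P.L * ((P.L * (restrictBody.sz + 8) + 8) + 8) + 8 +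
    ((G.N * ((pushCell (.var wLL) (cell 58 wN (.var 58))).sz + 8) + 8) + (2 + groupConst *
      (P.lgB + 1) * (P.L * P.L + 1 + (P.L * P.L + G.N) + G.N * G.m + G.N + G.m + P.lgB + 1)))))
    (Runs.seq (Runs.flat rfl fun ha => ?_)) ?_ fun _ _ h => h
  · set s₁ := (Cmd.wset wS (.const 0)).den W s with hs₁
    have hS₁ : s₁.wvar wS = 0 := by simp [hs₁, Cmd.den, WExp.eval]
    have hE₁ := hE.agree ha rfl
    have hL₁ : Line s₁ = Line s := Line.agree ha rfl rfl rfl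
    refine Runs.seq (Runs.mono (runs_collect (n := P.L * 1)
      (D := fun a g x y => ∃ b < P.L, g = a * P.L + b ∧ Line s (P.C a * G.N + P.C b) x y)
      rfl rfl (by decide) hE₁.L (by omega) (by rw [hS₁, mul_one]; omega)
      fun a s' hi ha' hi' hS' => ?_) le_rfl fun s₂ ha₂ h₂ _ => ?_)
    · have hE' := hE₁.agree ha' rfl
      refine runs_collect (n := 1) rfl rfl (by decide) hE'.L (by omega) (by omega)
          fun b s'' hb ha'' hb' hS'' => ?_
      have hE'' := hE'.agree ha'' rfl
      have hi'' : s''.wvar 58 = a := (ha''.w 58 rfl).trans hi'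
      rw [← hL₁, ← Line.agree ha' rfl rfl rfl, ← Line.agree ha'' rfl rfl rfl]
      have c1 : ∀ s₄ : State, s₄.wvar = s''.wvar → s₄.warr aC = s''.warr aC →
          (WExp.add (.mul (.get aC (.var 58)) (.var wN)) (.get aC (.var 59))).eval W s₄ =
            P.C a * G.N + P.C b := fun s₄ q1 q2 => by
        have h := cell_lt (hP.C_lt a hi) (hP.C_lt b hb)
        simp only [WExp.eval, q1, q2, hi'', hb', hE''.C, hE''.N]
        rw [Nat.mod_eq_of_lt (by omega : P.C a * G.N < W), Nat.mod_eq_of_lt (by omega)]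
      exact runs_pushCell hS'' (eval_cell hi'' hE''.L (by simpa [WExp.eval] using hb') hi hb
        (by omega)) (c1 _ rfl rfl) (c1 _ rfl rfl) fun x => c1 _ rfl rfl
    · have hE₂ := hE₁.agree ha₂ rfl
      have hL₂ : Line s₂ = Line s := (Line.agree ha₂ rfl rfl rfl).trans hL₁
      have hS₂ : s₂.wvar wS ≤ P.L * P.L := by have := h₂.le; rw [mul_one] at this; omega
      have hcap : P.L * P.L + G.N < W := by nlinarith
      refine Runs.seq (Runs.mono (runs_collect (n := 1)
        (D := fun v g x y => g = P.L * P.L ∧ Line s (v * G.N + v) x y) rfl rfl (by decide) hE₂.N hN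
        (by omega) fun v s' hv ha' hv' hS' => ?_) le_rfl fun s₃ ha₃ h₃ _ => ?_)
      · have hE' := hE₂.agree ha' rfl
        rw [← hL₂, ← Line.agree ha' rfl rfl rfl]
        have c1 : ∀ s₄ : State, s₄.wvar = s'.wvar →
            (cell 58 wN (.var 58)).eval W s₄ = v * G.N + v := fun s₄ q1 =>
          eval_cell (by rw [q1, hv']) (by rw [q1, hE'.N]) (by simp [WExp.eval, q1, hv']) hv hv hNN
        exact runs_pushCell hS' (by simpa [WExp.eval] using hE'.LL) (c1 _ rfl) (c1 _ rfl)
          fun x => c1 _ rfl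
      · have hE₃ := hE₂.agree ha₃ rfl
        refine (runs_select hP hE₃ (((hB.agree ha rfl rfl rfl).agree ha₂ rfl rfl rfl).agree ha₃
          rfl rfl rfl) hS₁ ((h₂.trans h₃).mono (n' := P.L * P.L + G.N) (by simp)
          fun g x y => Iff.rfl) hE₃.cells ?_ (by omega) ?_).mono le_rfl
          fun s₄ _ ⟨h4, h5, h6⟩ => ?_
        · rintro g x y (⟨a, ha, b, hb, rfl, -⟩ | ⟨v, hv, rfl, -⟩)
          · exact (cell_lt ha hb).trans (Nat.lt_succ_self _)
          · exact Nat.lt_succ_self _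
        · have h7 := hP.edges_lt
          have h8 := hP.samples_lt
          have h9 := hP.m_pos
          rcases le_total (P.L * P.L) G.N with h | h
          · nlinarith
          · rcases Nat.eq_zero_or_pos P.L with h0 | h0
            · nlinarith
            · have := Nat.le_mul_of_pos_right (P.L * P.L) h0
              omega
        · have hI : ∀ z, Itv s₄ z → Itv s z := fun z hz => (itv_agree ha rfl rfl rfl z).1
            ((itv_agree ha₂ rfl rfl rfl z).1 ((itv_agree ha₃ rfl rfl rfl z).1 (h5 z hz)))
          refine ⟨h4, hI, h6.optimal ?_ ?_⟩
          · rintro g x y (⟨a, ha, b, hb, rfl, hl⟩ | ⟨v, hv, rfl, hl⟩)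
            · obtain ⟨l, ⟨u, hu, v, hv, hg, hl, hk⟩, h⟩ :=
                hO.sound _ (cell_lt (hP.C_lt a ha) (hP.C_lt b hb)) x y hl
              obtain ⟨rfl, rfl⟩ := cell_inj (hP.C_lt b hb) hv hg
              exact ⟨l, .inl ⟨a, ha, b, hb, rfl, hl, hk⟩, h⟩
            · obtain ⟨l, ⟨u', hu', v', hv', hg, hl, hk⟩, h⟩ := hO.sound _ (cell_lt hv hv) x y hl
              obtain ⟨rfl, rfl⟩ := cell_inj hv hv' hg
              exact ⟨l, .inr ⟨rfl, v, hv, hl, hk⟩, h⟩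
          · rintro g l (⟨a, ha, b, hb, rfl, hl, hk⟩ | ⟨rfl, v, hv, hl, hk⟩)
            · obtain ⟨x, y, hxy, hle⟩ := hO.complete _ l
                ⟨_, hP.C_lt a ha, _, hP.C_lt b hb, rfl, hl, hk⟩
              exact ⟨x, y, .inl ⟨a, ha, b, hb, rfl, hxy⟩, fun z hz => hle z (hI z hz)⟩
            · obtain ⟨x, y, hxy, hle⟩ := hO.complete _ l ⟨v, hv, v, hv, rfl, hl, hk⟩
              exact ⟨x, y, .inr ⟨v, hv, rfl, hxy⟩, fun z hz => hle z (hI z hz)⟩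
  · refine le_trans ?_ (Nat.mul_le_mul_right _ (Nat.mul_le_mul_right _ (show 3 * groupConst +
      (restrictBody.sz + (pushCell (.var wLL) (cell 58 wN (.var 58))).sz) + 100 ≤
      stageConst by unfold stageConst; omega)))
    generalize restrictBody.sz = c₁
    generalize (pushCell (.var wLL) (cell 58 wN (.var 58))).sz = c₂
    ring_nf; omega

/-- The last cell is not a cell of the matrix. -/
theorem SampleRel.of_last {r g : ℕ} {l : List ℕ} (hg : g = P.L * P.L) :
    SampleRel G P r g l ↔ Short G P l := by
  refine ⟨?_, fun h => .inr ⟨hg, h⟩⟩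
  rintro (⟨a, ha, b, hb, h, -⟩ | ⟨-, h⟩)
  · have := cell_lt ha hb; omega
  · exact h

theorem SampleRel.of_cell {r a b : ℕ} {l : List ℕ} (ha : a < P.L) (hb : b < P.L) :
    SampleRel G P r (a * P.L + b) l ↔ Cov G P r a l b := by
  refine ⟨?_, fun h => .inl ⟨a, ha, b, hb, rfl, h⟩⟩
  rintro (⟨a', ha', b', hb', h, h'⟩ | ⟨h, -⟩)
  · obtain ⟨rfl, rfl⟩ := cell_inj hb hb' h
    exact h'
  · have := cell_lt ha hb; omega

theorem runs_squareStage {r : ℕ} (hP : P.Ok W G) (hE : Env G P s) (hB : Bracket G s)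
    (hO : Optimal G (P.L * P.L + 1) (SampleRel G P r) s) :
    Runs W squareStage s (stageConst * (P.lgB + 1) * (P.L * P.L * P.L + P.L * P.L + P.L +
        G.N * G.m + G.N + G.m + P.lgB + 1))
      fun s' => Bracket G s' ∧ (∀ z, Itv s' z → Itv s z) ∧
        Optimal G (P.L * P.L + 1) (SampleRel G P (r + 1)) s' := by
  have hsl := hP.samples_lt'
  have hcap : P.L * (P.L * P.L) + 1 < W := by rw [← mul_assoc]; omega
  refine Runs.mono (T := 2 + (P.L * ((P.L * (P.L * (squareBody.sz + 8) + 8 + 8) + 8) + 8) + 8 +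
    ((pushCell (.var wLL) (.var wLL)).sz + (2 + groupConst * (P.lgB + 1) * (P.L * P.L + 1 +
      (P.L * (P.L * P.L) + 1) + G.N * G.m + G.N + G.m + P.lgB + 1)))))
    (Runs.seq (Runs.flat rfl fun ha => ?_)) ?_ fun _ _ h => h
  · set s₁ := (Cmd.wset wS (.const 0)).den W s with hs₁
    have hS₁ : s₁.wvar wS = 0 := by simp [hs₁, Cmd.den, WExp.eval]
    have hE₁ := hE.agree ha rfl
    have hL₁ : Line s₁ = Line s := Line.agree ha rfl rfl rfl
    refine Runs.seq (Runs.mono (runs_collect (n := P.L * (P.L * 1))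
      (D := fun a g x y => ∃ b < P.L, ∃ k < P.L, (s.warr aWF (a * P.L + k) ≠ 0 ∧
        s.warr aWF (k * P.L + b) ≠ 0) ∧ (g = a * P.L + b ∧
        x = s.rarr fWA (a * P.L + k) + s.rarr fWA (k * P.L + b) ∧
        y = s.rarr fWB (a * P.L + k) + s.rarr fWB (k * P.L + b)))
      rfl rfl (by decide) hE₁.L (by omega) (by rw [hS₁, mul_one]; omega)
      fun a s' hi ha' hi' hS' => ?_) le_rfl fun s₂ ha₂ h₂ _ => ?_)
    · have hE' := hE₁.agree ha' rfl
      refine runs_collect (n := P.L * 1) rfl rfl (by decide) hE'.L (by omega) (by omega)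
          fun b s'' hb ha'' hb' hS'' => ?_
      have hE'' := hE'.agree ha'' rfl
      refine runs_collect (n := 1) rfl rfl (by decide) hE''.L (by omega) (by omega)
          fun k s₃ hk ha₃ hk' hS₃ => ?_
      have hE₃ := hE''.agree ha₃ rfl
      have hb₃ : s₃.wvar 59 = b := (ha₃.w 59 rfl).trans hb'
      have hi₃ : s₃.wvar 58 = a := (ha₃.w 58 rfl).trans ((ha''.w 58 rfl).trans hi')
      have e1 : s₃.warr aWF = s.warr aWF := by
        rw [ha₃.wa _ rfl, ha''.wa _ rfl, ha'.wa _ rfl, ha.wa _ rfl]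
      have e2 : s₃.rarr fWA = s.rarr fWA := by
        rw [ha₃.ra _ rfl, ha''.ra _ rfl, ha'.ra _ rfl, ha.ra _ rfl]
      have e3 : s₃.rarr fWB = s.rarr fWB := by
        rw [ha₃.ra _ rfl, ha''.ra _ rfl, ha'.ra _ rfl, ha.ra _ rfl]
      have c1 : ∀ s₄ : State, s₄.wvar = s₃.wvar →
          (cell 58 wL (.var 60)).eval W s₄ = a * P.L + k := fun s₄ q1 =>
        eval_cell (by rw [q1, hi₃]) (by rw [q1, hE₃.L]) (by simp [WExp.eval, q1, hk']) hi hk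
          (by omega)
      have c2 : ∀ s₄ : State, s₄.wvar = s₃.wvar →
          (cell 60 wL (.var 59)).eval W s₄ = k * P.L + b := fun s₄ q1 =>
        eval_cell (by rw [q1, hk']) (by rw [q1, hE₃.L]) (by simp [WExp.eval, q1, hb₃]) hk hb
          (by omega)
      have c3 : (cell 58 wL (.var 59)).eval W s₃ = a * P.L + b :=
        eval_cell hi₃ hE₃.L (by simp [WExp.eval, hb₃]) hi hb (by omega)
      refine runs_guard (by simp [BExp.Holds, WExp.eval, c1 s₃ rfl, c2 s₃ rfl, e1,
          Nat.pos_iff_ne_zero]) fun _ => runs_push hS₃ c3 ?_ ?_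
      · simp [RExp.eval, c1 (s₃.putW 11 (s₃.wvar 17) (a * P.L + b)) rfl,
          c2 (s₃.putW 11 (s₃.wvar 17) (a * P.L + b)) rfl, e2]
      · simp [RExp.eval, c1 ((s₃.putW 11 (s₃.wvar 17) (a * P.L + b)).putR 3 (s₃.wvar 17)
            (s.rarr fWA (a * P.L + k) + s.rarr fWA (k * P.L + b))) rfl,
          c2 ((s₃.putW 11 (s₃.wvar 17) (a * P.L + b)).putR 3 (s₃.wvar 17)
            (s.rarr fWA (a * P.L + k) + s.rarr fWA (k * P.L + b))) rfl, e3]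
    · have hE₂ := hE₁.agree ha₂ rfl
      have hL₂ : Line s₂ = Line s := (Line.agree ha₂ rfl rfl rfl).trans hL₁
      have hS₂ : s₂.wvar wS ≤ P.L * (P.L * P.L) := by
        have := h₂.le; rw [mul_one] at this; omega
      have hll : s₂.wvar wLL = P.L * P.L := hE₂.LL
      refine Runs.seq (Runs.mono (runs_pushCell (by omega) (by simpa [WExp.eval] using hll)
        (by simpa [WExp.eval] using hll) (by simpa [WExp.eval] using hll)
        (by simpa [WExp.eval] using hll)) le_rfl fun s₃ ha₃ h₃ _ => ?_)
      have hE₃ := hE₂.agree ha₃ rfl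
      rw [hL₂] at h₃
      refine (runs_select hP hE₃ (((hB.agree ha rfl rfl rfl).agree ha₂ rfl rfl rfl).agree ha₃
        rfl rfl rfl) hS₁ ((h₂.trans h₃).mono (n' := P.L * (P.L * P.L) + 1) (by simp)
        fun g x y => Iff.rfl) hE₃.cells ?_ (by omega) ?_).mono le_rfl
        fun s₄ _ ⟨h4, h5, h6⟩ => ?_
      · rintro g x y (⟨a, ha, b, hb, k, hk, -, rfl, -⟩ | ⟨rfl, -⟩)
        · exact (cell_lt ha hb).trans (Nat.lt_succ_self _)
        · exact Nat.lt_succ_self _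
      · have := hP.samples_lt; rw [← mul_assoc]; omega
      · have hI : ∀ z, Itv s₄ z → Itv s z := fun z hz => (itv_agree ha rfl rfl rfl z).1
          ((itv_agree ha₂ rfl rfl rfl z).1 ((itv_agree ha₃ rfl rfl rfl z).1 (h5 z hz)))
        refine ⟨h4, hI, h6.optimal ?_ ?_⟩
        · rintro g x y (⟨a, ha, b, hb, k, hk, ⟨hw1, hw2⟩, rfl, rfl, rfl⟩ | ⟨rfl, hl⟩)
          · obtain ⟨l₁, h₁, hx, hy⟩ := hO.sound _ ((cell_lt ha hk).trans (Nat.lt_succ_self _)) _ _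
              ⟨hw1, rfl, rfl⟩
            obtain ⟨l₂, h₂, hx', hy'⟩ := hO.sound _ ((cell_lt hk hb).trans (Nat.lt_succ_self _)) _ _
              ⟨hw2, rfl, rfl⟩
            exact ⟨l₁ ++ l₂, .inl ⟨a, ha, b, hb, rfl, k, hk, l₁, l₂, rfl,
              (SampleRel.of_cell ha hk).1 h₁, (SampleRel.of_cell hk hb).1 h₂⟩,
              by simp [hx, hx'], by simp [hy, hy']⟩
          · obtain ⟨l, hl, h⟩ := hO.sound _ (Nat.lt_succ_self _) x y hl
            exact ⟨l, .inr ⟨rfl, (SampleRel.of_last rfl).1 hl⟩, h⟩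
        · rintro g l (⟨a, ha, b, hb, rfl, k, hk, l₁, l₂, rfl, hl₁, hl₂⟩ | ⟨rfl, hl⟩)
          · obtain ⟨x₁, y₁, ⟨hw₁, hx₁, hy₁⟩, hle₁⟩ := hO.complete _ _ (.inl ⟨a, ha, k, hk, rfl, hl₁⟩)
            obtain ⟨x₂, y₂, ⟨hw₂, hx₂, hy₂⟩, hle₂⟩ := hO.complete _ _ (.inl ⟨k, hk, b, hb, rfl, hl₂⟩)
            refine ⟨x₁ + x₂, y₁ + y₂, .inl ⟨a, ha, b, hb, k, hk, ⟨hw₁, hw₂⟩, rfl, by rw [hx₁, hx₂],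
              by rw [hy₁, hy₂]⟩, fun z hz => ?_⟩
            have h1 := hle₁ z (hI z hz)
            have h2 := hle₂ z (hI z hz)
            rw [Net.wt_append]
            linarith
          · obtain ⟨x, y, hxy, hle⟩ := hO.complete _ l (.inr ⟨rfl, hl⟩)
            exact ⟨x, y, .inr ⟨rfl, hxy⟩, fun z hz => hle z (hI z hz)⟩
  · refine le_trans ?_ (Nat.mul_le_mul_right _ (Nat.mul_le_mul_right _ (show 3 * groupConst +
      (squareBody.sz + (pushCell (.var wLL) (.var wLL)).sz) + 100 ≤
      stageConst by unfold stageConst; omega)))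
    generalize squareBody.sz = c₁
    generalize (pushCell (.var wLL) (.var wLL)).sz = c₂
    ring_nf; omega

theorem runs_closeStage (hP : P.Ok W G) (hE : Env G P s) (hB : Bracket G s)
    (hO : Optimal G (P.L * P.L + 1) (SampleRel G P P.lg) s) :
    Runs W closeStage s (stageConst * (P.lgB + 1) * (P.L * P.L * P.L + P.L * P.L + P.L +
        G.N * G.m + G.N + G.m + P.lgB + 1))
      fun s' => Bracket G s' ∧ (∀ z, Itv s' z → Itv s z) ∧
        Optimal G (P.L * P.L + 1) (CloseRel G P) s' := by
  have hsl := hP.samples_lt'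
  refine Runs.mono (T := 2 + (P.L * ((pushCell (.const 0) (cell 58 wL (.var 58))).sz + 8) + 8 +
    ((pushCell (.const 0) (.var wLL)).sz + (2 + groupConst * (P.lgB + 1) * (P.L * P.L + 1 +
      (P.L + 1) + G.N * G.m + G.N + G.m + P.lgB + 1)))))
    (Runs.seq (Runs.flat rfl fun ha => ?_)) ?_ fun _ _ h => h
  · set s₁ := (Cmd.wset wS (.const 0)).den W s with hs₁
    have hS₁ : s₁.wvar wS = 0 := by simp [hs₁, Cmd.den, WExp.eval]
    have hE₁ := hE.agree ha rfl
    have hL₁ : Line s₁ = Line s := Line.agree ha rfl rfl rfl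
    refine Runs.seq (Runs.mono (runs_collect (n := 1)
      (D := fun a g x y => g = 0 ∧ Line s (a * P.L + a) x y)
      rfl rfl (by decide) hE₁.L (by omega) (by omega)
      fun a s' hi ha' hi' hS' => ?_) le_rfl fun s₂ ha₂ h₂ _ => ?_)
    · have hE' := hE₁.agree ha' rfl
      rw [← hL₁, ← Line.agree ha' rfl rfl rfl]
      have c1 : ∀ s₄ : State, s₄.wvar = s'.wvar →
          (cell 58 wL (.var 58)).eval W s₄ = a * P.L + a := fun s₄ q1 =>
        eval_cell (by rw [q1, hi']) (by rw [q1, hE'.L]) (by simp [WExp.eval, q1, hi']) hi hi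
          (by omega)
      exact runs_pushCell hS' (by simp [WExp.eval]) (c1 _ rfl) (c1 _ rfl) fun x => c1 _ rfl
    · have hE₂ := hE₁.agree ha₂ rfl
      have hL₂ : Line s₂ = Line s := (Line.agree ha₂ rfl rfl rfl).trans hL₁
      have hS₂ : s₂.wvar wS ≤ P.L := by have := h₂.le; omega
      have hll : s₂.wvar wLL = P.L * P.L := hE₂.LL
      refine Runs.seq (Runs.mono (runs_pushCell (j := 0) (by omega) (by simp [WExp.eval])
        (by simpa [WExp.eval] using hll) (by simpa [WExp.eval] using hll)
        (by simpa [WExp.eval] using hll)) le_rfl fun s₃ ha₃ h₃ _ => ?_)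
      have hE₃ := hE₂.agree ha₃ rfl
      rw [hL₂] at h₃
      refine (runs_select hP hE₃ (((hB.agree ha rfl rfl rfl).agree ha₂ rfl rfl rfl).agree ha₃
        rfl rfl rfl) hS₁ ((h₂.trans h₃).mono (n' := P.L + 1) (by simp)
        fun g x y => Iff.rfl) hE₃.cells ?_ (by omega) ?_).mono le_rfl
        fun s₄ _ ⟨h4, h5, h6⟩ => ?_
      · rintro g x y (⟨a, ha, rfl, -⟩ | ⟨rfl, -⟩) <;> omega
      · have := hP.samples_lt; omega
      · have hI : ∀ z, Itv s₄ z → Itv s z := fun z hz => (itv_agree ha rfl rfl rfl z).1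
          ((itv_agree ha₂ rfl rfl rfl z).1 ((itv_agree ha₃ rfl rfl rfl z).1 (h5 z hz)))
        refine ⟨h4, hI, h6.optimal ?_ ?_⟩
        · rintro g x y (⟨a, ha, rfl, hl⟩ | ⟨rfl, hl⟩)
          · obtain ⟨l, hl, h⟩ := hO.sound _ ((cell_lt ha ha).trans (Nat.lt_succ_self _)) _ _ hl
            exact ⟨l, ⟨rfl, .inl ⟨a, ha, (SampleRel.of_cell ha ha).1 hl⟩⟩, h⟩
          · obtain ⟨l, hl, h⟩ := hO.sound _ (Nat.lt_succ_self _) x y hl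
            exact ⟨l, ⟨rfl, .inr ((SampleRel.of_last rfl).1 hl)⟩, h⟩
        · rintro g l ⟨rfl, ⟨a, ha, hl⟩ | hl⟩
          · obtain ⟨x, y, hxy, hle⟩ := hO.complete _ l (.inl ⟨a, ha, a, ha, rfl, hl⟩)
            exact ⟨x, y, .inl ⟨a, ha, rfl, hxy⟩, fun z hz => hle z (hI z hz)⟩
          · obtain ⟨x, y, hxy, hle⟩ := hO.complete _ l (.inr ⟨rfl, hl⟩)
            exact ⟨x, y, .inr ⟨rfl, hxy⟩, fun z hz => hle z (hI z hz)⟩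
  · refine le_trans ?_ (Nat.mul_le_mul_right _ (Nat.mul_le_mul_right _ (show 3 * groupConst +
      ((pushCell (.const 0) (cell 58 wL (.var 58))).sz + (pushCell (.const 0) (.var wLL)).sz) + 100 ≤
      stageConst by unfold stageConst; omega)))
    generalize (pushCell (.const 0) (cell 58 wL (.var 58))).sz = c₁
    generalize (pushCell (.const 0) (.var wLL)).sz = c₂
    ring_nf; omega

/-- The time of the stages without the constant factor. -/
def stagesTime (G : Net) (P : Params) : ℕ :=
  (P.h + 1) * (G.N * G.N + G.N * G.m + G.N + G.m + P.lgB + 1) +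
    (P.lg + 2) * (P.L * P.L * P.L + P.L * P.L + P.L + G.N * G.m + G.N + G.m + P.lgB + 1)

/-- The interval only shrinks, so that what is minimal on an earlier interval remains minimal. -/
theorem runs_stages (hP : P.Ok W G) (hE : Env G P s) (hB : Bracket G s) :
    Runs W stages s (30 * stageConst * (P.lgB + 1) * stagesTime G P) fun s' =>
      Bracket G s' ∧ (∀ z, Itv s' z → Itv s z) ∧ Optimal G (P.L * P.L + 1) (CloseRel G P) s' := by
  set A := stageConst * (P.lgB + 1) * (G.N * G.N + G.N * G.m + G.N + G.m + P.lgB + 1) with hA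
  set B := stageConst * (P.lgB + 1) * (P.L * P.L * P.L + P.L * P.L + P.L +
        G.N * G.m + G.N + G.m + P.lgB + 1) with hB'
  refine Runs.mono (T := A + (P.h * (A + 8) + 8 + (B + (P.lg * (B + 8) + 8 + B))))
    (Runs.seq ((runs_startStage hP hE hB).mono le_rfl fun s₁ ha₁ ⟨hB₁, hI₁, hO₁⟩ _ =>
      Runs.seq (Runs.forUp (fun k s' => Bracket G s' ∧ (∀ z, Itv s' z → Itv s z) ∧
        Optimal G (G.N * G.N) (WalkRel G k) s') rfl rfl (hE.agree ha₁ rfl).h hP.h_lt ?_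
        (fun k s' hk ha' hk' ⟨hB', hI', hO'⟩ => ?_) fun s₂ ha₂ ⟨hB₂, hI₂, hO₂⟩ _ => ?_))) ?_
    fun _ _ h => h
  · exact ⟨⟨by simpa using hB₁.lo, by simpa using hB₁.hi⟩, fun z hz => hI₁ z (by simpa [Itv] using hz),
      hO₁.agree rfl fun z hz => by simpa [Itv] using hz⟩
  · exact (runs_extendStage hP ((hE.agree ha₁ rfl).agree ha' rfl) hB' hO').mono le_rfl
      fun s'' _ ⟨h1, h2, h3⟩ => ⟨⟨by simpa using h1.lo, by simpa using h1.hi⟩,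
        fun z hz => hI' z (h2 z (by simpa [Itv] using hz)),
        h3.agree rfl fun z hz => by simpa [Itv] using hz⟩
  · have hE₂ := (hE.agree ha₁ rfl).agree ha₂ rfl
    refine Runs.seq ((runs_restrictStage hP hE₂ hB₂ hO₂).mono le_rfl
      fun s₃ ha₃ ⟨hB₃, hI₃, hO₃⟩ _ => ?_)
    have hE₃ := hE₂.agree ha₃ rfl
    refine Runs.seq (Runs.forUp (fun k s' => Bracket G s' ∧ (∀ z, Itv s' z → Itv s z) ∧
        Optimal G (P.L * P.L + 1) (SampleRel G P k) s') rfl rfl hE₃.lg hP.lg_lt ?_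
        (fun k s' hk ha' hk' ⟨hB', hI', hO'⟩ => ?_) fun s₄ ha₄ ⟨hB₄, hI₄, hO₄⟩ _ => ?_)
    · exact ⟨⟨by simpa using hB₃.lo, by simpa using hB₃.hi⟩,
        fun z hz => hI₂ z (hI₃ z (by simpa [Itv] using hz)),
        hO₃.agree rfl fun z hz => by simpa [Itv] using hz⟩
    · exact (runs_squareStage hP (hE₃.agree ha' rfl) hB' hO').mono le_rfl
        fun s'' _ ⟨h1, h2, h3⟩ => ⟨⟨by simpa using h1.lo, by simpa using h1.hi⟩,
          fun z hz => hI' z (h2 z (by simpa [Itv] using hz)),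
          h3.agree rfl fun z hz => by simpa [Itv] using hz⟩
    · exact (runs_closeStage hP (hE₃.agree ha₄ rfl) hB₄ hO₄).mono le_rfl
        fun s₅ _ ⟨h1, h2, h3⟩ => ⟨h1, fun z hz => hI₄ z (h2 z hz), h3⟩
  · have e : 30 * stageConst * (P.lgB + 1) * stagesTime G P =
        30 * ((P.h + 1) * A + (P.lg + 2) * B) := by
      rw [hA, hB', stagesTime]; ring
    rw [e]
    have h1 : 1 ≤ A := Nat.mul_pos (Nat.mul_pos (by unfold stageConst; omega) (by omega)) (by omega)
    have h2 : 1 ≤ B := Nat.mul_pos (Nat.mul_pos (by unfold stageConst; omega) (by omega)) (by omega)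
    clear_value A B
    nlinarith

end

end RealRAM

/-! ### The second phase -/

namespace Net

variable {G : Net}

/-- Cost-to-time ratio. -/
noncomputable def ratio (G : Net) (l : List ℕ) : ℝ := G.costSum l / G.timeSum l

theorem wt_ratio {l : List ℕ} (h : 0 < G.timeSum l) (x : ℝ) :
    G.wt x l = G.timeSum l * (G.ratio l - x) := by
  rw [wt, ratio]
  field_simp

theorem wt_neg_iff {l : List ℕ} (h : 0 < G.timeSum l) {x : ℝ} : G.wt x l < 0 ↔ G.ratio l < x := by
  rw [wt_ratio h, mul_neg_iff]
  constructor
  · rintro (h' | h') <;> linarith [h'.1, h'.2]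
  · intro h'
    exact .inl ⟨h, by linarith⟩

/-- There is a negative cycle if and only if the parameter exceeds the minimum ratio. -/
theorem neg_iff (ht : ∀ l, G.Cyc l → 0 < G.timeSum l) {l₀ : List ℕ} (h₀ : G.Cyc l₀)
    (hmin : ∀ l, G.Cyc l → G.ratio l₀ ≤ G.ratio l) {x : ℝ} : G.Neg x ↔ G.ratio l₀ < x := by
  constructor
  · rintro ⟨l, hl, h⟩
    exact (hmin l hl).trans_lt ((wt_neg_iff (ht l hl)).1 h)
  · intro h
    exact ⟨l₀, h₀, (wt_neg_iff (ht _ h₀)).2 h⟩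

end Net

namespace RealRAM

open Prog

theorem CloseRel.walk {G : Net} {P : Params} {g : ℕ} {l : List ℕ} (h : CloseRel G P g l) :
    ∃ v, G.Walk v l v := by
  obtain ⟨-, ⟨a, -, h⟩ | ⟨v, -, h, -⟩⟩ := h
  exacts [⟨_, h.walk⟩, ⟨v, h⟩]

/-- Some permutation of the list is one of the closed walks that are considered in the last stage. For
a cycle this will be a rotation. -/
def Covered (G : Net) (P : Params) (l : List ℕ) : Prop :=
  ∃ l', l'.Perm l ∧ CloseRel G P 0 l'

section

variable {W : ℕ} {G : Net} {P : Params} {s s' : State}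

/-- At the end of the search the left end point of the interval is the minimum ratio: the stored
line of a closed walk `l` is not above zero on the interval because the empty walk is also closed,
and it is not below zero at parameters without negative cycles; hence it vanishes at all parameters in
the interval up to the minimum ratio. Since it is negative at the right end point, it is not constant,
and there is only one such parameter. -/
theorem lo_eq_ratio (hN : 0 < G.N) (ht : ∀ l, G.Cyc l → 0 < G.timeSum l) {l₀ : List ℕ}
    (h₀ : G.Cyc l₀) (hmin : ∀ l, G.Cyc l → G.ratio l₀ ≤ G.ratio l) (hcov : Covered G P l₀)
    (hB : Bracket G s) (hO : Optimal G (P.L * P.L + 1) (CloseRel G P) s) :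
    s.rvar rLo = G.ratio l₀ := by
  obtain ⟨l', hperm, hl'⟩ := hcov
  obtain ⟨x, y, hxy, hle⟩ := hO.complete 0 l' hl'
  obtain ⟨x₀, y₀, hxy₀, hle₀⟩ := hO.complete 0 [] ⟨rfl, .inr ⟨0, hN, Net.walk_nil.2 rfl, by simp⟩⟩
  obtain ⟨rfl, rfl⟩ : x₀ = x ∧ y₀ = y :=
    ⟨hxy₀.2.1.trans hxy.2.1.symm, hxy₀.2.2.trans hxy.2.2.symm⟩
  obtain ⟨l, hl, rfl, rfl⟩ := hO.sound 0 (Nat.succ_pos _) _ _ hxy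
  obtain ⟨v, hv⟩ := hl.walk
  have hwt : ∀ z, G.wt z l' = G.wt z l₀ := fun z => by
    simp only [Net.wt, Net.costSum, Net.timeSum, (hperm.map _).sum_eq]
  have neg := fun {z} => Net.neg_iff ht h₀ hmin (x := z)
  set r := G.ratio l₀ with hr
  have hhi : r < s.rvar rHi := neg.1 hB.hi
  -- the line vanishes at every point of the interval up to the minimum ratio
  have hzero : ∀ z, Itv s z → z ≤ r → G.costSum l - z * G.timeSum l = 0 := fun z hz hzr => by
    have h1 := hle₀ z hz
    have h2 := hv.wt_nonneg (x := z) (fun h => absurd (neg.1 h) (not_lt.2 hzr))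
    rw [Net.wt_nil] at h1
    rw [Net.wt] at h2
    linarith
  have hlt : G.costSum l - s.rvar rHi * G.timeSum l < 0 := by
    refine (hle _ ⟨fun h => (hB.lo h).2.le, le_rfl⟩).trans_lt ?_
    rw [hwt]
    exact (Net.wt_neg_iff (ht _ h₀)).2 hhi
  have hr0 : G.costSum l - r * G.timeSum l = 0 :=
    hzero r ⟨fun h => not_lt.1 fun h' => (hB.lo h).1 (neg.2 h'), hhi.le⟩ le_rfl
  by_cases hh : s.wvar wHas = 0
  · have h1 := hzero (r - 1) ⟨fun h => absurd hh h, by linarith⟩ (by linarith)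
    nlinarith
  · have h1 : s.rvar rLo ≤ r := not_lt.1 fun h' => (hB.lo hh).1 (neg.2 h')
    have h2 := hzero _ ⟨fun _ => le_rfl, (hB.lo hh).2.le⟩ h1
    have h3 : (r - s.rvar rLo) * G.timeSum l = 0 := by linarith
    rcases mul_eq_zero.1 h3 with h | h
    · linarith
    · rw [h] at hr0 hlt
      linarith

theorem runs_fullMask (hP : P.Ok W G) (hE : Env G P s) :
    Runs W fullMask s (G.m * (3 + 8) + 8) fun s' => ∀ e < G.m, s'.warr aMask e ≠ 0 := by
  refine Runs.forUp (fun k s' => ∀ e < k, s'.warr aMask e ≠ 0) rfl rfl hE.m hP.m_lt (by simp)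
    (fun k s' hk ha hk' hI => Runs.flat rfl fun e he => ?_) fun _ _ h => h
  simp only [Cmd.den, WExp.eval, State.putW_warr, State.setW_warr, hk', if_true,
    Function.update_apply, hP.one_mod]
  split_ifs with h
  · simp
  · exact hI e (by omega)

/-- The cycle that has been found is negative at the right end point, which is its ratio plus one. -/
theorem runs_initInterval (hP : P.Ok W G) (hE : Env G P s) (hlen : s.wvar wLen ≤ G.N)
    (hc : G.Cyc s.output) (ht : 0 < G.timeSum s.output) :
    Runs W initInterval s (G.N * (ratioBody.sz + 8) + 20) fun s' => Bracket G s' := by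
  have hN := hP.N_lt
  refine Runs.mono (T := 2 + (2 + ((s.wvar wLen * (ratioBody.sz + 8) + 8) + (6 + 2))))
    (Runs.seq (Runs.flat rfl fun ha => Runs.seq (Runs.flat rfl fun ha₁ => ?_))) ?_ fun _ _ h => h
  · set s₁ := (Cmd.rset rY (.const 0)).den W ((Cmd.rset rX (.const 0)).den W s) with hs₁
    refine Runs.seq (Runs.forUp (fun k s' =>
      s'.rvar rX = G.costSum ((List.range k).map (s.warr aOut)) ∧
      s'.rvar rY = G.timeSum ((List.range k).map (s.warr aOut))) rfl rfl rfl (by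
        show s.wvar wLen < W
        omega) (by simp [hs₁, Cmd.den, RExp.eval])
      (fun k s' hk ha' hk' hI => Runs.flat rfl ?_) fun s₂ ha₂ h₂ _ => ?_)
    · have hE' : Env G P s' := ((hE.agree ha rfl).agree ha₁ rfl).agree ha' rfl
      have e1 : s'.warr aOut = s.warr aOut := by rw [ha'.wa _ rfl, ha₁.wa _ rfl, ha.wa _ rfl]
      simp [ratioBody, Cmd.den, RExp.eval, WExp.eval, hI, hk', e1, hE'.c, hE'.t,
        List.range_succ]
    · have hout : (List.range (s.wvar wLen)).map (s.warr aOut) = s.output := rfl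
      rw [hout] at h₂
      refine Runs.flat rfl ?_
      simp only [block, Cmd.den, RExp.eval, WExp.eval, h₂]
      refine ⟨fun h => ?_, ?_⟩
      · exact absurd (by simp) h
      · simp only [State.setW_rvar, State.setR_rvar, if_true]
        refine ⟨_, hc, (Net.wt_neg_iff ht).2 ?_⟩
        rw [Net.ratio]
        norm_num
  · have := Nat.mul_le_mul_right (ratioBody.sz + 8) hlen
    omega

/-- A constant for the running time of `finish`. -/
def finishConst : ℕ := relaxBody.sz + negBody.sz + tightBody.sz + 2 * cycleConst + 200

/-- If the left end point is the minimum ratio, then a minimum ratio cycle consists of tight edges, and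
every cycle of tight edges has weight zero and hence minimum ratio. In any case the output is a
cycle. -/
theorem runs_finish (hP : P.Ok W G) (hE : Env G P s) (ht : ∀ l, G.Cyc l → 0 < G.timeSum l)
    {l₀ : List ℕ} (h₀ : G.Cyc l₀) :
    Runs W finish s (finishConst * (G.N * G.m + G.N * G.N + G.N + G.m + 1)) fun s' =>
      G.Cyc s'.output ∧ ((∀ l, G.Cyc l → G.ratio l₀ ≤ G.ratio l) → s.rvar rLo = G.ratio l₀ →
        G.ratio s'.output = G.ratio l₀) := by
  set Z := G.N * G.m + G.N * G.N + G.N + G.m + 1 with hZ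
  refine Runs.mono (T := 2 + ((relaxBody.sz + negBody.sz + 100) * (G.N * G.m + G.N + G.m + 1) +
    ((G.m * (tightBody.sz + 8) + 8) + (cycleConst * Z + (3 + ((G.m * (3 + 8) + 8) +
      cycleConst * Z))))))
    (Runs.seq (Runs.flat rfl fun ha => Runs.seq ((runs_bellmanFord hP (hE.agree ha rfl)).mono le_rfl
      fun s₂ ha₂ h₂ _ => ?_))) ?_ fun _ _ h => h
  · have hE₂ : Env G P s₂ := (hE.agree ha rfl).agree ha₂ rfl
    have hq : s₂.rvar rQ = s.rvar rLo := by
      rw [ha₂.r _ rfl]; simp [Cmd.den, RExp.eval]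
    have hq' : ((Cmd.rset rQ (.var rLo)).den W s).rvar rQ = s.rvar rLo := by
      simp [Cmd.den, RExp.eval]
    rw [hq'] at h₂
    refine Runs.seq (Runs.forUp (fun k s' => ∀ e < k, s'.warr aMask e ≠ 0 ↔
      s₂.rarr fP (G.src e) + G.w (s.rvar rLo) e ≤ s₂.rarr fP (G.dst e)) rfl rfl hE₂.m hP.m_lt
      (by simp) (fun k s' hk ha' hk' hI => Runs.flat rfl ?_) fun s₃ ha₃ h₃ _ => ?_)
    · have hE' := hE₂.agree ha' rfl
      have e1 : s'.rarr fP = s₂.rarr fP := ha'.ra _ rfl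
      have hcond : BExp.Holds W s' (.rlt (.get fP (.get aDst (.var 43))) relaxed) ↔
          s₂.rarr fP (G.dst k) < s₂.rarr fP (G.src k) + G.w (s.rvar rLo) k := by
        rw [BExp.Holds, eval_relaxed hE']
        simp [RExp.eval, WExp.eval, hk', hE'.dst, e1, ha'.r _ rfl, hq]
      rw [tightBody, Cmd.den]
      intro e he
      split_ifs with hb
      · rw [hcond] at hb
        simp only [Cmd.den, WExp.eval, State.putW_warr, State.setW_warr, hk', if_true,
          Function.update_apply, Nat.zero_mod]
        split_ifs with h
        · subst h; simpa using hb
        · exact hI e (by omega)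
      · rw [hcond] at hb
        simp only [Cmd.den, WExp.eval, State.putW_warr, State.setW_warr, hk', if_true,
          Function.update_apply, hP.one_mod]
        split_ifs with h
        · subst h; simpa using hb
        · exact hI e (by omega)
    · have hE₃ := hE₂.agree ha₃ rfl
      -- if the left end point is the minimum ratio, the edges of `l₀` are tight
      have key : (∀ l, G.Cyc l → G.ratio l₀ ≤ G.ratio l) → s.rvar rLo = G.ratio l₀ →
          G.Feasible (s.rvar rLo) (s₂.rarr fP) ∧ ∀ e ∈ l₀, s₃.warr aMask e ≠ 0 := by
        intro hmin hlo
        have hn : ¬ G.Neg (s.rvar rLo) := by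
          rw [Net.neg_iff ht h₀ hmin, hlo]; exact lt_irrefl _
        have hf : G.Feasible (s.rvar rLo) (s₂.rarr fP) := by
          rcases h₂ with h | h
          · exact absurd h.2 hn
          · exact h.2
        refine ⟨hf, fun e he => (h₃ e (h₀.lt e he)).2 ?_⟩
        obtain ⟨u, hu⟩ := h₀.2.1
        refine (Net.tight_of_feasible hf hu ?_ e he).ge
        rw [hlo, Net.wt_ratio (ht _ h₀)]
        simp
      refine Runs.seq ((runs_findCycle hP hE₃ rfl).mono le_rfl fun s₄ ha₄ ⟨_, h₄⟩ _ => ?_)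
      have hE₄ := hE₃.agree ha₄ rfl
      refine Runs.ite (fun hb => ?_) fun hb => ?_
      · have hb : s₄.wvar wLen = 0 := by
          simpa [BExp.Holds, WExp.eval, hP.one_mod] using hb
        refine Runs.seq ((runs_fullMask hP hE₄).mono le_rfl fun s₅ ha₅ h₅ _ => ?_)
        refine (runs_findCycle hP (hE₄.agree ha₅ rfl) rfl).mono le_rfl fun s₆ ha₆ ⟨_, h₆⟩ => ?_
        have hc : G.Cyc s₆.output := by
          rcases h₆ with h | h
          · exact h.2.1
          · obtain ⟨e, he, he0⟩ := h.2 l₀ h₀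
            exact absurd he0 (h₅ e (h₀.lt e he))
        refine ⟨hc, fun hmin hlo => ?_⟩
        rcases h₄ with h | h
        · exact absurd hb h.1
        · obtain ⟨e, he, he0⟩ := h.2 l₀ h₀
          exact absurd he0 ((key hmin hlo).2 e he)
      · have hb : s₄.wvar wLen ≠ 0 := by
          simpa [BExp.Holds, WExp.eval, hP.one_mod] using hb
        refine Runs.mono (Runs.flat rfl (Q := fun s' => s' = s₄) rfl)
          (show 1 ≤ _ by omega) ?_
        rintro s' - rfl
        rcases h₄ with h | h
        · refine ⟨h.2.1, fun hmin hlo => ?_⟩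
          obtain ⟨u, hu⟩ := h.2.1.2.1
          have hf := (key hmin hlo).1
          have hwt : G.wt (s.rvar rLo) s'.output = 0 := by
            rw [Net.wt_of_tight hu fun e he => le_antisymm (hf e (h.2.1.lt e he))
              ((h₃ e (h.2.1.lt e he)).1 (h.2.2 e he))]
            simp
          rw [Net.wt_ratio (ht _ h.2.1), hlo] at hwt
          have := (mul_eq_zero.1 hwt).resolve_left (ht _ h.2.1).ne'
          linarith
        · exact absurd h.1 hb
  · have h1 : G.N * G.m + G.N + G.m + 1 ≤ Z := by omega
    have h2 := Nat.mul_le_mul_left (relaxBody.sz + negBody.sz + 100) h1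
    have h3 : G.m ≤ Z := by omega
    have h4 := Nat.mul_le_mul_right (tightBody.sz + 19) h3
    have h5 : 1 ≤ Z := by omega
    unfold finishConst
    clear_value Z
    ring_nf at h2 h4 ⊢
    omega

/-- A constant for the running time of the second phase. -/
def searchConst : ℕ := 30 * stageConst + finishConst + ratioBody.sz + cycleConst + 100

/-- The output is a cycle whenever there is one; it has minimum ratio if some minimum ratio cycle is
covered by the samples. -/
theorem runs_search (hP : P.Ok W G) (hE : Env G P s) (ht : ∀ l, G.Cyc l → 0 < G.timeSum l) :
    Runs W search s (searchConst * (P.lgB + 1) * stagesTime G P) fun s' =>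
      (s'.output = [] ∧ ∀ l, ¬ G.Cyc l) ∨ (G.Cyc s'.output ∧ ∀ l₀, G.Cyc l₀ →
        (∀ l, G.Cyc l → G.ratio l₀ ≤ G.ratio l) → Covered G P l₀ →
          G.ratio s'.output = G.ratio l₀) := by
  set Z := G.N * G.m + G.N * G.N + G.N + G.m + 1 with hZ
  set Y := 30 * stageConst * (P.lgB + 1) * stagesTime G P with hY
  refine Runs.mono (T := 3 + ((G.m * (3 + 8) + 8) + (cycleConst * Z + (3 +
    ((G.N * (ratioBody.sz + 8) + 20) + (Y + finishConst * Z))))))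
    (Runs.ite (fun _ => Runs.seq ((runs_fullMask hP hE).mono le_rfl fun s₁ ha₁ h₁ _ =>
      Runs.seq ((runs_findCycle hP (hE.agree ha₁ rfl) rfl).mono le_rfl
        fun s₂ ha₂ ⟨hlen, h₂⟩ _ => Runs.ite (fun hb => ?_) fun hb => ?_)))
      fun hb => absurd (by simpa [BExp.Holds, WExp.eval, hE.m] using hP.m_pos) hb)
    ?_ fun _ _ h => h
  · have hb : s₂.wvar wLen ≠ 0 := by
      simpa [BExp.Holds, WExp.eval, Nat.pos_iff_ne_zero] using hb
    have hE₂ := (hE.agree ha₁ rfl).agree ha₂ rfl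
    rcases h₂ with h₂ | h₂
    swap
    · exact absurd h₂.1 hb
    refine Runs.seq ((runs_initInterval hP hE₂ hlen h₂.2.1 (ht _ h₂.2.1)).mono le_rfl
      fun s₃ ha₃ hB₃ _ => ?_)
    have hE₃ := hE₂.agree ha₃ rfl
    refine Runs.seq ((runs_stages hP hE₃ hB₃).mono le_rfl fun s₄ ha₄ ⟨hB₄, _, hO₄⟩ _ => ?_)
    have hE₄ := hE₃.agree ha₄ rfl
    -- `runs_finish` is applied to a minimum ratio cycle if there is one, otherwise to any cycle
    obtain ⟨l₁, hl₁, hmin₁⟩ : ∃ l₁, G.Cyc l₁ ∧ ((∃ l₀, G.Cyc l₀ ∧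
        ∀ l, G.Cyc l → G.ratio l₀ ≤ G.ratio l) → ∀ l, G.Cyc l → G.ratio l₁ ≤ G.ratio l) := by
      by_cases h : ∃ l₀, G.Cyc l₀ ∧ ∀ l, G.Cyc l → G.ratio l₀ ≤ G.ratio l
      · obtain ⟨l₀, h, h'⟩ := h
        exact ⟨l₀, h, fun _ => h'⟩
      · exact ⟨_, h₂.2.1, fun h' => absurd h' h⟩
    refine (runs_finish hP hE₄ ht hl₁).mono le_rfl fun s₅ _ ⟨h1, h2⟩ =>
      Or.inr ⟨h1, fun l₀ h₀ hmin hcov => ?_⟩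
    have hmin' := hmin₁ ⟨l₀, h₀, hmin⟩
    have e : G.ratio l₁ = G.ratio l₀ := le_antisymm (hmin' l₀ h₀) (hmin l₁ hl₁)
    rw [← e]
    exact h2 hmin' (by rw [e]; exact lo_eq_ratio hP.N_pos ht h₀ hmin hcov hB₄ hO₄)
  · have hb : s₂.wvar wLen = 0 := by
      simpa [BExp.Holds, WExp.eval] using hb
    refine Runs.mono (Runs.flat rfl (Q := fun s' => s' = s₂) rfl)
      (show 1 ≤ _ by omega) ?_
    rintro s' - rfl
    rcases h₂ with h₂ | h₂
    · exact absurd hb h₂.1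
    · refine .inl ⟨by simp [State.output, hb], fun l hl => ?_⟩
      obtain ⟨e, he, he0⟩ := h₂.2 l hl
      exact h₁ e (hl.lt e he) he0
  · have hZt : Z ≤ stagesTime G P := by
      have : 1 * (G.N * G.N + G.N * G.m + G.N + G.m + P.lgB + 1) ≤
        (P.h + 1) * (G.N * G.N + G.N * G.m + G.N + G.m + P.lgB + 1) :=
        Nat.mul_le_mul_right _ (by omega)
      unfold stagesTime
      omega
    have h1 : Z ≤ (P.lgB + 1) * stagesTime G P :=
      hZt.trans (Nat.le_mul_of_pos_left _ (by omega))
    have e : searchConst * (P.lgB + 1) * stagesTime G P = Y + (finishConst + ratioBody.sz +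
        cycleConst + 100) * ((P.lgB + 1) * stagesTime G P) := by
      rw [hY, searchConst]; ring
    rw [e]
    have h2 := Nat.mul_le_mul_left (finishConst + ratioBody.sz + cycleConst + 100) h1
    have h3 : G.N ≤ Z := by omega
    have h4 : G.m ≤ Z := by omega
    have h5 : 1 ≤ Z := by omega
    have h6 := Nat.mul_le_mul_right (ratioBody.sz + 8) h3
    clear_value Z Y
    ring_nf at h2 h6 ⊢
    omega

end

end RealRAM

/-! ### Covering a cycle by walks between sampled vertices -/

namespace RealRAM

section

variable {G : Net} {P : Params}

/-- The list `l` is a walk from the sample `a` to the sample `b` that consists of `n` segments with at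
most `h` edges between sampled vertices. -/
def Chain (G : Net) (P : Params) : ℕ → ℕ → List ℕ → ℕ → Prop
  | 0, a, l, b => l = [] ∧ a = b ∧ a < P.L
  | n + 1, a, l, b => a < P.L ∧ ∃ k l₁ l₂, l = l₁ ++ l₂ ∧
      (G.Walk (P.C a) l₁ (P.C k) ∧ l₁.length ≤ P.h) ∧ Chain G P n k l₂ b

theorem Chain.lt {n a b : ℕ} {l : List ℕ} (h : Chain G P n a l b) : a < P.L ∧ b < P.L := by
  induction n generalizing a l with
  | zero => exact ⟨h.2.2, h.2.1 ▸ h.2.2⟩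
  | succ n ih =>
    obtain ⟨ha, k, l₁, l₂, -, -, h⟩ := h
    exact ⟨ha, (ih h).2⟩

/-- Segments may be empty. -/
theorem Chain.pad {n n' a b : ℕ} {l : List ℕ} (h : Chain G P n a l b) (hn : n ≤ n') :
    Chain G P n' a l b := by
  induction n', hn using Nat.le_induction with
  | base => exact h
  | succ n' _ ih => exact ⟨ih.lt.1, a, [], l, rfl, ⟨Net.walk_nil.2 rfl, Nat.zero_le _⟩, ih⟩

theorem Chain.split {n n' a b : ℕ} {l : List ℕ} (h : Chain G P (n + n') a l b) :
    ∃ k l₁ l₂, l = l₁ ++ l₂ ∧ Chain G P n a l₁ k ∧ Chain G P n' k l₂ b := by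
  induction n generalizing a l with
  | zero =>
    rw [Nat.zero_add] at h
    exact ⟨a, [], l, rfl, ⟨rfl, rfl, h.lt.1⟩, h⟩
  | succ n ih =>
    rw [Nat.succ_add] at h
    obtain ⟨ha, k, l₁, l₂, rfl, h₁, h₂⟩ := h
    obtain ⟨k', l₃, l₄, rfl, h₃, h₄⟩ := ih h₂
    exact ⟨k', l₁ ++ l₃, l₄, by simp, ⟨ha, k, l₁, l₃, rfl, h₁, h₃⟩, h₄⟩

/-- Repeated squaring produces all chains with `2 ^ r` segments. -/
theorem Chain.cov {r a b : ℕ} {l : List ℕ} (h : Chain G P (2 ^ r) a l b) : Cov G P r a l b := by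
  induction r generalizing a b l with
  | zero =>
    obtain ⟨-, k, l₁, l₂, rfl, h₁, rfl, rfl, -⟩ := h
    simpa [Cov] using h₁
  | succ r ih =>
    rw [pow_succ, mul_two] at h
    obtain ⟨k, l₁, l₂, rfl, h₁, h₂⟩ := h.split
    exact ⟨k, h₁.lt.2, l₁, l₂, rfl, ih h₁, ih h₂⟩

/-- The edges of a cycle, repeated periodically. -/
def periodic (l : List ℕ) (i : ℕ) : ℕ := l.getD (i % l.length) 0

theorem periodic_eq {l : List ℕ} {i j : ℕ} (hj : j < l.length) (h : i % l.length = j) :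
    periodic l i = l[j] := by
  subst h
  rw [periodic, List.getD_eq_getElem _ _ hj]

theorem dst_periodic {l : List ℕ} (hl : G.Cyc l) (i : ℕ) :
    G.dst (periodic l i) = G.src (periodic l (i + 1)) := by
  obtain ⟨hne, ⟨u, -, hu⟩, -⟩ := hl
  have hk : 0 < l.length := List.length_pos_iff.2 hne
  have hi := Nat.mod_lt i hk
  have h0 : u = G.src l[0] := by
    have := congrArg (fun l' => l'[0]?) hu
    simpa [List.getElem?_append, hk] using this
  have h1 : G.dst l[i % l.length] = (l.map G.src ++ [u])[i % l.length + 1]'(by simpa using hi) := by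
    rw [List.getElem_of_eq hu.symm]
    simp
  rw [periodic_eq hi rfl, h1]
  rcases Nat.lt_or_ge (i % l.length + 1) l.length with h | h
  · have e2 : (i + 1) % l.length = i % l.length + 1 := by
      rw [Nat.add_mod, Nat.mod_eq_of_lt (by omega : 1 < l.length), Nat.mod_eq_of_lt h]
    rw [List.getElem_append_left (by simpa using h), periodic_eq h e2]
    simp
  · have e2 : (i + 1) % l.length = 0 := by
      have : i % l.length + 1 = l.length := by omega
      rw [← Nat.mod_add_mod, this, Nat.mod_self]
    rw [List.getElem_append_right (by simpa using h), periodic_eq hk e2]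
    simp [h0]

theorem walk_periodic {l : List ℕ} (hl : G.Cyc l) (p d : ℕ) :
    G.Walk (G.src (periodic l p)) ((List.range d).map fun i => periodic l (p + i))
      (G.src (periodic l (p + d))) := by
  have hk : 0 < l.length := List.length_pos_iff.2 hl.1
  induction d with
  | zero => simp [Net.walk_nil]
  | succ d ih =>
    rw [List.range_succ, List.map_append, List.map_singleton, Net.walk_concat]
    refine ⟨hl.lt _ ?_, (dst_periodic hl _).symm, ih⟩
    rw [periodic_eq (Nat.mod_lt _ hk) rfl]
    exact List.getElem_mem _

theorem periodic_perm {l : List ℕ} (hne : l ≠ []) (p : ℕ) :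
    ((List.range l.length).map fun i => periodic l (p + i)).Perm l := by
  have : (List.range l.length).map (fun i => periodic l (p + i)) = l.rotate p := by
    refine List.ext_getElem (by simp) fun i h1 h2 => ?_
    have hk : 0 < l.length := List.length_pos_iff.2 hne
    simp [periodic_eq (Nat.mod_lt _ hk) rfl, List.getElem_rotate, add_comm]
  rw [this]
  exact List.rotate_perm l p

/-- If every `h` consecutive vertices of a cycle contain a sampled vertex, then one can go from one
sampled vertex to the next one. Every segment has at least one edge, hence `d` segments are sufficient
for `d` edges; the induction is on `d`. -/
theorem exists_chain {l : List ℕ} (hl : G.Cyc l)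
    (hit : ∀ i, ∃ j < P.h, ∃ a < P.L, P.C a = G.src (periodic l (i + j)))
    {a₀ : ℕ} (ha₀ : a₀ < P.L) (d : ℕ) (hd : 0 < d) (p a : ℕ) (ha : a < P.L)
    (hp : P.C a = G.src (periodic l p)) (hpd : P.C a₀ = G.src (periodic l (p + d))) :
    Chain G P d a ((List.range d).map fun i => periodic l (p + i)) a₀ := by
  induction d using Nat.strong_induction_on generalizing p a with
  | _ d ih =>
    rcases le_or_gt d P.h with h | h
    · refine Chain.pad (n := 1) ⟨ha, a₀, _, [], (List.append_nil _).symm, ⟨?_, by simpa using h⟩,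
        rfl, rfl, ha₀⟩ hd
      rw [hp, hpd]
      exact walk_periodic hl p d
    · -- the window that begins after the vertex at `p`
      obtain ⟨j, hj, b, hb, hbj⟩ := hit (p + 1)
      have e : p + (1 + j) + (d - (1 + j)) = p + d := by omega
      have h1 := ih (d - (1 + j)) (by omega) (by omega) (p + (1 + j)) b hb
        (by rw [hbj]; congr 2; omega) (by rw [e]; exact hpd)
      refine Chain.pad (n := (d - (1 + j)) + 1) ⟨ha, b,
        (List.range (1 + j)).map fun i => periodic l (p + i), _, ?_, ⟨?_, by simp; omega⟩, h1⟩
        (by omega)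
      · conv_lhs => rw [show d = (1 + j) + (d - (1 + j)) by omega, List.range_add, List.map_append]
        simp [Function.comp_def, add_assoc]
      · rw [hp, hbj, add_assoc]
        exact walk_periodic hl p (1 + j)

/-- A cycle with at most `h` edges is covered without any samples. A longer one is rotated so that it
begins at a sampled vertex. -/
theorem covered_of_hits {l : List ℕ} (hl : G.Cyc l) (hlg : G.N ≤ 2 ^ P.lg)
    (hit : P.h < l.length → ∀ i, ∃ j < P.h, ∃ a < P.L, P.C a = G.src (periodic l (i + j))) :
    Covered G P l := by
  have hk : 0 < l.length := List.length_pos_iff.2 hl.1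
  rcases le_or_gt l.length P.h with h | h
  · obtain ⟨u, hu⟩ := hl.2.1
    refine ⟨l, List.Perm.refl l, rfl, .inr ⟨u, ?_, hu, h⟩⟩
    obtain ⟨e, l', rfl⟩ := List.exists_cons_of_ne_nil hl.1
    rw [(Net.walk_cons.1 hu).2.1]
    exact G.src_lt _ (hl.lt e (by simp))
  · obtain ⟨j, -, a, ha, haj⟩ := hit h 0
    have hper : periodic l (0 + j + l.length) = periodic l (0 + j) := by simp [periodic]
    refine ⟨_, periodic_perm hl.1 (0 + j), rfl, .inl ⟨a, ha, Chain.cov (Chain.pad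
      (exists_chain hl (hit h) ha l.length hk (0 + j) a ha haj ?_) (hl.length_le.trans hlg))⟩⟩
    rw [hper, haj]

end

end RealRAM

/-! ### The parameters -/

namespace RealRAM

open Prog

section

variable {W : ℕ} {s s' : State}

/-- The vertices `x < n` with `f x ≠ 0` are numbered `1, …, N` by `f`. -/
structure Numbering (n : ℕ) (f : ℕ → ℕ) (N : ℕ) : Prop where
  inj : ∀ x y, f x ≠ 0 → f x = f y → x = y
  le : ∀ x, f x ≤ N
  card : ((Finset.range n).filter fun x => f x ≠ 0).card = N

theorem Numbering.update {n N x : ℕ} {f : ℕ → ℕ} (h : Numbering n f N) (hx : x < n) (h0 : f x = 0) :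
    Numbering n (Function.update f x (N + 1)) (N + 1) := by
  refine ⟨fun y z hy hyz => ?_, fun y => ?_, ?_⟩
  · simp only [Function.update_apply] at hy hyz
    have h1 := h.le y
    have h2 := h.le z
    split_ifs at hy hyz with e1 e2 e2
    · rw [e1, e2]
    · omega
    · omega
    · exact h.inj y z hy hyz
  · simp only [Function.update_apply]
    split_ifs
    · omega
    · have := h.le y; omega
  · have : (Finset.range n).filter (fun y => Function.update f x (N + 1) y ≠ 0) =
        insert x ((Finset.range n).filter fun y => f y ≠ 0) := by
      ext y
      simp only [Finset.mem_filter, Finset.mem_range, Finset.mem_insert, Function.update_apply]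
      by_cases e : y = x
      · subst e; simp [hx]
      · simp [e]
    rw [this, Finset.card_insert_of_notMem (by simp [h0]), h.card]

theorem Numbering.card_le {n N : ℕ} {f : ℕ → ℕ} (h : Numbering n f N) : N ≤ n := by
  have := Finset.card_filter_le (Finset.range n) fun x => f x ≠ 0
  rwa [h.card, Finset.card_range] at this

/-- Gives a number to the vertex in the cell `20` of the array `a`. -/
def touch (a : ℕ) : Cmd :=
  .ite (.wlt (.get aId (.get a (.var 20))) (.const 1))
    (.seq (.inc wN) (.wput aId (.get a (.var 20)) (.var wN))) .skip

theorem runs_touch {a x n : ℕ} (hx : s.warr a (s.wvar 20) = x) (hxn : x < n)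
    (hn : n + 1 < W) (h : Numbering n (s.warr aId) (s.wvar wN)) :
    Runs W (touch a) s (touch a).sz fun s' => Numbering n (s'.warr aId) (s'.wvar wN) ∧
      s'.wvar wN ≤ s.wvar wN + 1 ∧ s'.warr aId x ≠ 0 ∧
      ∀ y, s.warr aId y ≠ 0 → s'.warr aId y = s.warr aId y := by
  have one : 1 % W = 1 := Nat.mod_eq_of_lt (by omega)
  have hN : s.wvar wN + 1 < W := by have := h.card_le; omega
  have hmod := Nat.mod_eq_of_lt hN
  refine Runs.flat rfl ?_
  have hcond : BExp.Holds W s (.wlt (.get aId (.get a (.var 20))) (.const 1)) ↔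
      s.warr aId x = 0 := by
    simp [BExp.Holds, WExp.eval, hx, one]
  rw [touch, Cmd.den]
  split_ifs with hb
  · rw [hcond] at hb
    simp only [Cmd.den, Cmd.inc, WExp.eval, one, State.setW_wvar, State.setW_warr,
      State.putW_wvar, State.putW_warr, if_true, hmod, hx, Nat.reduceEqDiff, if_false]
    refine ⟨h.update hxn hb, le_rfl, by simp, fun y hy => ?_⟩
    rw [Function.update_of_ne]
    rintro rfl
    exact hy hb
  · rw [hcond] at hb
    exact ⟨h, Nat.le_succ _, hb, fun _ _ => rfl⟩

/-- An edge that has been renumbered remains correct because numbers are never changed. -/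
theorem runs_relabel {n m : ℕ} (hn : s.wvar wn = n) (hm : s.wvar wm = m) (hnW : n + 1 < W)
    (hmW : m < W) (hN : s.wvar wN = 0) (hid : s.warr aId = fun _ => 0)
    (hsrc : ∀ e < m, s.warr aSrc₀ e < n) (hdst : ∀ e < m, s.warr aDst₀ e < n) :
    Runs W relabel s ((relabelBody.sz + 16) * (m + 1)) fun s' =>
      Numbering n (s'.warr aId) (s'.wvar wN) ∧ s'.wvar wN ≤ 2 * m ∧ ∀ e < m,
        s'.warr aId (s.warr aSrc₀ e) = s'.warr aSrc e + 1 ∧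
        s'.warr aId (s.warr aDst₀ e) = s'.warr aDst e + 1 := by
  refine Runs.mono (T := m * (relabelBody.sz + 8) + 8) (Runs.forUp (fun k s' =>
    Numbering n (s'.warr aId) (s'.wvar wN) ∧ s'.wvar wN ≤ 2 * k ∧ ∀ e < k,
        s'.warr aId (s.warr aSrc₀ e) = s'.warr aSrc e + 1 ∧
        s'.warr aId (s.warr aDst₀ e) = s'.warr aDst e + 1) rfl rfl hm hmW ?_ ?_ fun _ _ h => h)
    (by ring_nf; omega) fun _ _ h => h
  · refine ⟨⟨by simp [hid], by simp [hid], by simp [hid, hN]⟩, by simp [hN], by simp⟩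
  · rintro k s' hk ha hk' ⟨h1, h2, h3⟩
    have e1 : s'.warr aSrc₀ = s.warr aSrc₀ := ha.wa _ rfl
    have e2 : s'.warr aDst₀ = s.warr aDst₀ := ha.wa _ rfl
    refine Runs.seq (T₁ := (touch 0).sz) (T₂ := (touch 1).sz + (7 + 7))
      ((runs_touch (n := n) (x := s.warr aSrc₀ k) (by rw [e1, hk']) (hsrc k hk) hnW
        h1).mono le_rfl fun s₁ ha₁ ⟨p1, p2, p3, p4⟩ _ => ?_)
    refine Runs.seq ((runs_touch (n := n) (x := s.warr aDst₀ k)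
      (by rw [ha₁.wa 1 rfl, e2, ha₁.w 20 rfl, hk']) (hdst k hk) hnW p1).mono le_rfl
      fun s₂ ha₂ ⟨q1, q2, q3, q4⟩ _ => ?_)
    refine Runs.flat rfl ?_
    have one : 1 % W = 1 := Nat.mod_eq_of_lt (by omega)
    have f1 : s₂.warr aSrc₀ = s.warr aSrc₀ := by rw [ha₂.wa 0 rfl, ha₁.wa 0 rfl, e1]
    have f2 : s₂.warr aDst₀ = s.warr aDst₀ := by rw [ha₂.wa 1 rfl, ha₁.wa 1 rfl, e2]
    have f3 : s₂.wvar 20 = k := by rw [ha₂.w 20 rfl, ha₁.w 20 rfl, hk']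
    have f4 : s₂.warr aSrc = s'.warr aSrc := by rw [ha₂.wa _ rfl, ha₁.wa _ rfl]
    have f5 : s₂.warr aDst = s'.warr aDst := by rw [ha₂.wa _ rfl, ha₁.wa _ rfl]
    have hle : ∀ x, (s₂.warr aId x - 1) % W = s₂.warr aId x - 1 := fun x =>
      Nat.mod_eq_of_lt (by have := q1.le x; have := q1.card_le; omega)
    simp only [block, Cmd.den, WExp.eval, State.putW_wvar, State.putW_warr, State.setW_warr,
      State.setW_wvar, Nat.reduceEqDiff, if_true, if_false, f1, f2, f3, f4, f5, one, hle]
    refine ⟨q1, by omega, fun e he => ?_⟩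
    have g1 : s₂.warr aId (s.warr aSrc₀ k) ≠ 0 := by rw [q4 _ p3]; exact p3
    rcases Nat.lt_succ_iff_lt_or_eq.1 he with he | rfl
    · obtain ⟨r1, r2⟩ := h3 e he
      have hne := he.ne
      have r1' : s₁.warr aId (s.warr aSrc₀ e) = s'.warr aSrc e + 1 := by
        rw [p4 _ (by omega), r1]
      have r2' : s₁.warr aId (s.warr aDst₀ e) = s'.warr aDst e + 1 := by
        rw [p4 _ (by omega), r2]
      simp only [Function.update_of_ne hne]
      exact ⟨by rw [q4 _ (by omega), r1'], by rw [q4 _ (by omega), r2']⟩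
    · simp only [Function.update_self]
      omega

/-- Loops of a fixed length suffice for searching a number: once it has been found, the body has no
effect. -/
theorem runs_logLoop {x : ℕ} (hx : s.wvar 21 = x) (hx0 : 0 < x) (hW : 2 * x < W) :
    Runs W logLoop s ((logBody.sz + 20) * (x + 1)) fun s' =>
      x ≤ 2 ^ s'.wvar 24 ∧ 2 ^ s'.wvar 24 ≤ 2 * x := by
  have one : 1 % W = 1 := Nat.mod_eq_of_lt (by omega)
  have two : 2 % W = 2 := Nat.mod_eq_of_lt (by omega)
  refine Runs.mono (T := 2 + (2 + (x * (logBody.sz + 8) + 8))) (Runs.seq (Runs.flat rfl fun ha =>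
    Runs.seq (Runs.flat rfl fun ha₁ => Runs.forUp (fun k s' => s'.wvar 23 = 2 ^ s'.wvar 24 ∧
      2 ^ s'.wvar 24 ≤ 2 * x ∧ (x ≤ 2 ^ s'.wvar 24 ∨ s'.wvar 24 = k)) rfl rfl
      (show _ = x by simpa [Cmd.den] using hx) (by omega) ?_ ?_ ?_))) (by ring_nf; omega)
    fun _ _ h => h
  · simp [Cmd.den, WExp.eval, one]
    omega
  · rintro k s' hk ha' hk' ⟨h1, h2, h3⟩
    refine Runs.flat rfl ?_
    have e21 : s'.wvar 21 = x := by
      rw [ha'.w 21 rfl]; simpa [Cmd.den] using hx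
    have hcond : BExp.Holds W s' (.wlt (.var 23) (.var 21)) ↔ 2 ^ s'.wvar 24 < x := by
      simp [BExp.Holds, WExp.eval, h1, e21]
    rw [logBody, Cmd.den]
    split_ifs with hb
    · rw [hcond] at hb
      have hlt : s'.wvar 24 < 2 ^ s'.wvar 24 := Nat.lt_two_pow_self
      have m1 : 2 * 2 ^ s'.wvar 24 % W = 2 * 2 ^ s'.wvar 24 := Nat.mod_eq_of_lt (by omega)
      have m2 : (s'.wvar 24 + 1) % W = s'.wvar 24 + 1 := Nat.mod_eq_of_lt (by omega)
      simp only [Cmd.den, Cmd.inc, WExp.eval, State.setW_wvar, Nat.reduceEqDiff, if_true, if_false,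
        one, two, h1, m1, m2, pow_succ]
      omega
    · rw [hcond] at hb
      simp only [Cmd.den, State.setW_wvar, Nat.reduceEqDiff, if_false]
      omega
  · rintro s' - ⟨h1, h2, h3⟩
    refine ⟨?_, h2⟩
    rcases h3 with h | h
    · exact h
    · rw [h]; exact Nat.lt_two_pow_self.le

theorem runs_rootLoop {N m : ℕ} (hN : s.wvar wN = N) (hm : s.wvar wm = m) (hN0 : 0 < N)
    (hm0 : 0 < m) (hW : (N + 1) * (N + 1) * ((N + 1) * (N + 1)) * m < W) :
    Runs W rootLoop s ((rootBody.sz + 20) * (N + 1)) fun s' =>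
      0 < s'.wvar 25 ∧ s'.wvar 25 ≤ N + 1 ∧
      N * N ≤ s'.wvar 25 * s'.wvar 25 * (s'.wvar 25 * s'.wvar 25) * m ∧
      (s'.wvar 25 = 1 ∨ (s'.wvar 25 - 1) ^ 4 * m < N * N) := by
  have hN1 : (N + 1) * (N + 1) < W := by
    refine lt_of_le_of_lt ?_ hW
    calc (N + 1) * (N + 1) = (N + 1) * (N + 1) * 1 * 1 := by ring
      _ ≤ _ := by gcongr; nlinarith; omega
  have hNW : N + 1 < W := by nlinarith
  have one : 1 % W = 1 := Nat.mod_eq_of_lt (by omega)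
  refine Runs.mono (T := 2 + (N * (rootBody.sz + 8) + 8)) (Runs.seq (Runs.flat rfl fun ha =>
    Runs.forUp (fun k s' => 0 < s'.wvar 25 ∧ s'.wvar 25 ≤ k + 1 ∧
      (N * N ≤ s'.wvar 25 * s'.wvar 25 * (s'.wvar 25 * s'.wvar 25) * m ∨ s'.wvar 25 = k + 1) ∧
      (s'.wvar 25 = 1 ∨ (s'.wvar 25 - 1) ^ 4 * m < N * N)) rfl rfl
      (show _ = N by simpa [Cmd.den] using hN) (by omega) ?_ ?_ ?_)) (by ring_nf; omega)
    fun _ _ h => h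
  · simp [Cmd.den, WExp.eval, one]
  · rintro k s' hk ha' hk' ⟨h1, h2, h3, h4⟩
    refine Runs.flat rfl ?_
    have eN : s'.wvar wN = N := by
      rw [ha'.w _ rfl]; simpa [Cmd.den] using hN
    have em : s'.wvar wm = m := by
      rw [ha'.w _ rfl]; simpa [Cmd.den] using hm
    set y := s'.wvar 25 with hy
    have hyN : y ≤ N + 1 := by omega
    have b1 : y * y ≤ (N + 1) * (N + 1) := Nat.mul_le_mul hyN hyN
    have b2 : y * y * (y * y) ≤ (N + 1) * (N + 1) * ((N + 1) * (N + 1)) := Nat.mul_le_mul b1 b1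
    have b3 : y * y * (y * y) * m < W := (Nat.mul_le_mul_right m b2).trans_lt hW
    have m1 : y * y % W = y * y := Nat.mod_eq_of_lt (by omega)
    have m2 : y * y * (y * y) % W = y * y * (y * y) :=
      Nat.mod_eq_of_lt ((Nat.le_mul_of_pos_right _ hm0).trans_lt b3)
    have m3 := Nat.mod_eq_of_lt b3
    have m4 : N * N % W = N * N := Nat.mod_eq_of_lt (by nlinarith)
    have hcond : BExp.Holds W s' (.wlt (.mul (.mul (.mul (.var 25) (.var 25))
        (.mul (.var 25) (.var 25))) (.var wm)) (.mul (.var wN) (.var wN))) ↔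
        y * y * (y * y) * m < N * N := by
      simp only [BExp.Holds, WExp.eval, eN, em, ← hy, m1, m2, m3, m4]
    rw [rootBody, Cmd.den]
    split_ifs with hb
    · rw [hcond] at hb
      have m5 : (y + 1) % W = y + 1 := Nat.mod_eq_of_lt (by omega)
      simp only [Cmd.den, Cmd.inc, WExp.eval, State.setW_wvar, Nat.reduceEqDiff, if_true, if_false,
        one, ← hy, m5]
      refine ⟨by omega, by omega, .inr (by omega), .inr ?_⟩
      rw [Nat.add_sub_cancel]
      calc y ^ 4 * m = y * y * (y * y) * m := by ring
        _ < _ := hb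
    · rw [hcond] at hb
      simp only [Cmd.den, State.setW_wvar, Nat.reduceEqDiff, if_false, ← hy]
      exact ⟨h1, by omega, .inl (by omega), h4⟩
  · rintro s' - ⟨h1, h2, h3, h4⟩
    refine ⟨h1, h2, ?_, h4⟩
    rcases h3 with h | h
    · exact h
    · rw [h]
      calc N * N = N * N * (1 * 1) * 1 := by ring
        _ ≤ (N + 1) * (N + 1) * ((N + 1) * (N + 1)) * m := by gcongr <;> omega

end

end RealRAM

namespace RealRAM

open Prog

/-- The graph `H` is the graph `G` with its vertices renumbered, and `P` are parameters suitable for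
it: `h₀` is about `√N / m ^ (1 / 4)`, and a random number with `b` bits is often below `N`. -/
structure Setup (q : ℕ) {n m : ℕ} (G : RatioGraph n m) (H : Net) (P : Params) (b h₀ : ℕ) :
    Prop where
  m_eq : H.m = m
  m_pos : 0 < m
  c : ∀ e : Fin m, H.c e = G.cost e
  t : ∀ e : Fin m, H.t e = G.time e
  src_eq : ∀ e f : Fin m, H.src e = H.src f ↔ G.src e = G.src f
  dst_eq : ∀ e f : Fin m, H.dst e = H.src f ↔ G.dst e = G.src f
  N_pos : 0 < H.N
  N_le : H.N ≤ n
  N_le' : H.N ≤ 2 * m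
  le_lg : 2 * n ≤ 2 ^ P.lg
  lg_le : 2 ^ P.lg ≤ 4 * n
  le_b : H.N ≤ 2 ^ b
  b_le : 2 ^ b ≤ 2 * H.N
  h₀_pos : 0 < h₀
  h₀_le : h₀ ≤ H.N + 1
  le_h₀ : H.N * H.N ≤ h₀ * h₀ * (h₀ * h₀) * m
  h₀_lt : h₀ = 1 ∨ (h₀ - 1) ^ 4 * m < H.N * H.N
  h : P.h = h₀ * P.lg
  L : P.L = q * (H.N / h₀ + 1)
  lgB : P.lgB = 3 * P.lg + (3 * q + 5)

section

variable {n m q b h₀ : ℕ} {G : RatioGraph n m} {H : Net} {P : Params}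

theorem _root_.RatioGraph.le_square (G : RatioGraph n m) : m ≤ n * n := by
  simpa using Fintype.card_le_of_injective _ G.simple

/-- Words with `O(log (n + m))` bits are large enough for the numbers of candidates, which are less than
`2 ^ lgB`. -/
theorem word_bound (hn : 0 < n) (q : ℕ) :
    4 * (64 * (n * n * n) * 2 ^ (3 * q + 5)) ≤ (n + m + 2) ^ (3 * q + 16) := by
  have h1 : 4 * (64 * (n * n * n) * 2 ^ (3 * q + 5)) = n ^ 3 * 2 ^ (3 * q + 13) := by
    rw [show 3 * q + 13 = 3 * q + 5 + 8 by ring, pow_add _ (3 * q + 5)]; ring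
  rw [h1, show 3 * q + 16 = 3 + (3 * q + 13) by ring, pow_add _ 3]
  gcongr <;> omega

theorem Setup.lgB_le (hS : Setup q G H P b h₀) :
    2 ^ P.lgB ≤ 64 * (n * n * n) * 2 ^ (3 * q + 5) := by
  rw [hS.lgB, pow_add]
  gcongr
  calc 2 ^ (3 * P.lg) = (2 ^ P.lg) ^ 3 := by rw [mul_comm, pow_mul]
    _ ≤ (4 * n) ^ 3 := by gcongr; exact hS.lg_le
    _ = _ := by ring

theorem Setup.le_lgB (hS : Setup q G H P b h₀) :
    8 * (n * n * n) * (32 * 2 ^ (3 * q)) ≤ 2 ^ P.lgB := by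
  rw [hS.lgB, pow_add, pow_add 2 (3 * q) 5]
  have : 8 * (n * n * n) ≤ 2 ^ (3 * P.lg) := by
    calc 8 * (n * n * n) = (2 * n) ^ 3 := by ring
      _ ≤ (2 ^ P.lg) ^ 3 := by gcongr; exact hS.le_lg
      _ = 2 ^ (3 * P.lg) := by rw [mul_comm, pow_mul]
  calc _ ≤ 2 ^ (3 * P.lg) * (32 * 2 ^ (3 * q)) := by gcongr
    _ = _ := by norm_num; ring

theorem Setup.pow_le (hS : Setup q G H P b h₀) :
    4 * 2 ^ P.lgB ≤ (n + m + 2) ^ (3 * q + 16) := by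
  refine le_trans ?_ (word_bound (hS.N_pos.trans_le hS.N_le) q)
  have := hS.lgB_le
  omega

theorem Setup.L_le (hS : Setup q G H P b h₀) : P.L ≤ 2 ^ q * (2 * n) := by
  rw [hS.L]
  have h1 : H.N / h₀ ≤ H.N := Nat.div_le_self _ _
  have h2 := hS.N_le
  have h3 := hS.N_pos
  exact Nat.mul_le_mul Nat.lt_two_pow_self.le (by omega)

theorem Setup.ok (hS : Setup q G H P b h₀) (hq : 0 < q) (hC : ∀ a < P.L, P.C a < H.N) :
    P.Ok ((n + m + 2) ^ (3 * q + 16)) H := by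
  have hn : 0 < n := hS.N_pos.trans_le hS.N_le
  have hpow := hS.pow_le
  have hle := hS.le_lgB
  have h2q : 1 ≤ 2 ^ (3 * q) := Nat.one_le_two_pow
  have hcube : 256 * (n * n * n) ≤ 2 ^ P.lgB := by
    refine le_trans ?_ hle
    calc 256 * (n * n * n) = 8 * (n * n * n) * (32 * 1) := by ring
      _ ≤ _ := by gcongr
  have hn1 : n ≤ n * n := Nat.le_mul_of_pos_right _ hn
  have hn2 : n * n ≤ n * n * n := Nat.le_mul_of_pos_right _ hn
  have hlgB : P.lgB < 2 ^ P.lgB := Nat.lt_two_pow_self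
  have hNn := hS.N_le
  have hlg : P.lg < 2 ^ P.lg := Nat.lt_two_pow_self
  have hlg' := hS.lg_le
  have hh := hS.h₀_le
  refine ⟨hS.N_pos, by rw [hS.m_eq]; exact hS.m_pos, hC, ?_, ?_, by omega, ?_, ?_, hpow⟩
  · have := hS.lgB
    omega
  · rw [hS.h]
    calc h₀ * P.lg ≤ (n + 1) * (4 * n) := Nat.mul_le_mul (by omega) (by omega)
      _ = 4 * (n * n) + 4 * n := by ring
      _ < _ := by omega
  · rw [hS.m_eq]
    have := G.le_square
    calc (H.N + 1) * (H.N + m) ≤ (n + 1) * (n + n * n) := Nat.mul_le_mul (by omega) (by omega)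
      _ = n * n * n + 2 * (n * n) + n := by ring
      _ < _ := by omega
  · have hL0 : 0 < P.L := by rw [hS.L]; positivity
    have hL := hS.L_le
    have h3 : P.L * P.L * P.L ≤ 8 * (n * n * n) * 2 ^ (3 * q) := by
      calc P.L * P.L * P.L ≤ 2 ^ q * (2 * n) * (2 ^ q * (2 * n)) * (2 ^ q * (2 * n)) := by gcongr
        _ = 8 * (n * n * n) * (2 ^ q) ^ 3 := by ring
        _ = _ := by rw [← pow_mul, mul_comm q 3]
    have h4 : P.L ≤ P.L * P.L := Nat.le_mul_of_pos_right _ hL0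
    have h5 : P.L * P.L ≤ P.L * P.L * P.L := Nat.le_mul_of_pos_right _ hL0
    have h6 : 8 * (n * n * n) * (32 * 2 ^ (3 * q)) = 32 * (8 * (n * n * n) * 2 ^ (3 * q)) := by ring
    omega

theorem runs_logs {W N : ℕ} {s : State} (hwn : s.wvar wn = n) (hwN : s.wvar wN = N) (hn : 0 < n)
    (hN : 0 < N) (hNn : N ≤ n) (hW : 4 * n < W) :
    Runs W logs s (2 + ((logBody.sz + 20) * (n + 1) + (4 + (2 + ((logBody.sz + 20) * (n + 1) + 2)))))
      fun s' => n ≤ 2 ^ (s'.wvar wLg - 1) ∧ 2 ^ (s'.wvar wLg - 1) ≤ 2 * n ∧ 0 < s'.wvar wLg ∧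
        N ≤ 2 ^ s'.wvar wB ∧ 2 ^ s'.wvar wB ≤ 2 * N := by
  have one : 1 % W = 1 := Nat.mod_eq_of_lt (by omega)
  refine Runs.seq (Runs.flat rfl fun ha => Runs.seq ((runs_logLoop (x := n) ?_ hn
    (by omega)).mono le_rfl fun s₂ ha₂ h₂ _ => Runs.seq (Runs.flat rfl fun ha₃ =>
    Runs.seq (Runs.flat rfl fun ha₄ => Runs.seq (T₁ := (logBody.sz + 20) * (n + 1))
    ((runs_logLoop (x := N) ?_ hN (by omega)).mono (by gcongr) fun s₅ ha₅ h₅ _ =>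
    Runs.flat rfl ?_)))))
  · simpa [Cmd.den, WExp.eval] using hwn
  · have e : s₂.wvar wN = N := by rw [ha₂.w _ rfl, ha.w _ rfl, hwN]
    simpa [Cmd.den, WExp.eval] using e
  · have hl : s₂.wvar 24 < 2 ^ s₂.wvar 24 := Nat.lt_two_pow_self
    have e : (s₂.wvar 24 + 1) % W = s₂.wvar 24 + 1 := Nat.mod_eq_of_lt (by omega)
    have e4 : s₅.wvar wLg = s₂.wvar 24 + 1 := by
      rw [ha₅.w _ rfl, ha₄.w _ rfl]
      simp [Cmd.den, WExp.eval, one, e]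
    simp only [block, Cmd.den, WExp.eval, State.setW_wvar, Nat.reduceEqDiff, if_true, if_false, e4]
    exact ⟨by simpa using h₂.1, by simpa using h₂.2, by omega, h₅⟩

theorem runs_setParams {W N lg h₀ : ℕ} {s : State} (t1 : s.wvar wLg = lg) (t2 : s.wvar wN = N)
    (t3 : s.wvar 25 = h₀) (o1 : h₀ * lg < W) (o2 : 3 * (3 * lg + (3 * q + 5)) < W)
    (o3 : 4 * (q * (N / h₀ + 1) * (q * (N / h₀ + 1)) * (q * (N / h₀ + 1)) +
      q * (N / h₀ + 1) * (q * (N / h₀ + 1)) + q * (N / h₀ + 1) + 1) < W)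
    (o6 : (N + 1) * N < W) (o7 : N * N < W) (o8 : N + 1 < W) :
    Runs W (setParams q) s (setParams q).sz fun s' => s'.wvar wH = h₀ * lg ∧
      s'.wvar wL = q * (N / h₀ + 1) ∧ s'.wvar wLgB = 3 * lg + (3 * q + 5) ∧
      s'.wvar wJ = 3 * (3 * lg + (3 * q + 5)) ∧ s'.wvar wNN = N * N ∧
      s'.wvar wLL = q * (N / h₀ + 1) * (q * (N / h₀ + 1)) ∧
      s'.wvar wG = q * (N / h₀ + 1) * (q * (N / h₀ + 1)) + 1 ∧ s'.wvar wN1 = N + 1 ∧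
      s'.wvar wNN1 = (N + 1) * N := by
  have o5 : N / h₀ ≤ N := Nat.div_le_self _ _
  have one : 1 % W = 1 := Nat.mod_eq_of_lt (by omega)
  have e1 := Nat.mod_eq_of_lt o1
  have e2 : q % W = q := Nat.mod_eq_of_lt (by omega)
  have e3 : N / h₀ % W = N / h₀ := Nat.mod_eq_of_lt (by omega)
  have e4 : (N / h₀ + 1) % W = N / h₀ + 1 := Nat.mod_eq_of_lt (by omega)
  have e5 : q * (N / h₀ + 1) % W = q * (N / h₀ + 1) := Nat.mod_eq_of_lt (by omega)
  have e6 : 3 % W = 3 := Nat.mod_eq_of_lt (by omega)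
  have e7 : 3 * lg % W = 3 * lg := Nat.mod_eq_of_lt (by omega)
  have e8 : (3 * q + 5) % W = 3 * q + 5 := Nat.mod_eq_of_lt (by omega)
  have e9 : (3 * lg + (3 * q + 5)) % W = 3 * lg + (3 * q + 5) := Nat.mod_eq_of_lt (by omega)
  have e10 := Nat.mod_eq_of_lt o2
  have e11 := Nat.mod_eq_of_lt o7
  have e12 : q * (N / h₀ + 1) * (q * (N / h₀ + 1)) % W =
    q * (N / h₀ + 1) * (q * (N / h₀ + 1)) := Nat.mod_eq_of_lt (by omega)
  have e13 : (q * (N / h₀ + 1) * (q * (N / h₀ + 1)) + 1) % W =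
    q * (N / h₀ + 1) * (q * (N / h₀ + 1)) + 1 := Nat.mod_eq_of_lt (by omega)
  have e14 : (N + 1) % W = N + 1 := Nat.mod_eq_of_lt (by omega)
  have e15 := Nat.mod_eq_of_lt o6
  refine Runs.flat rfl ?_
  simp only [setParams, block, Cmd.den, WExp.eval, State.setW_wvar, Nat.reduceEqDiff, if_true,
    if_false, t1, t2, t3, one, e1, e2, e3, e4, e5, e6, e7, e8, e9, e10, e11, e12, e13, e14, e15,
    and_self]

/-- A constant for the running time of the deterministic part of the first phase. -/
def prepConst (q : ℕ) : ℕ := relabelBody.sz + 2 * logBody.sz + rootBody.sz + (setParams q).sz + 200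

/-- The parameters are computed from the input and not from the coins; the samples in `P` are what the
array `aC` contains before any samples have been drawn. -/
theorem runs_prepare (G : RatioGraph n m) (hm : 0 < m) (hq : 0 < q) (ω : ℕ → Bool) :
    Runs ((n + m + 2) ^ (3 * q + 16)) (prepare q) (G.init ω) (prepConst q * (n + m + 1))
      fun s => ∃ H P b h₀, Setup q G H P b h₀ ∧ Env H P s ∧ s.wvar wB = b := by
  have hn : 0 < n := (Nat.zero_le _).trans_lt (G.src ⟨0, hm⟩).2
  have hm2 := G.le_square
  have hW := word_bound (m := m) hn q
  set W := (n + m + 2) ^ (3 * q + 16) with hWdef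
  have h32 : 32 ≤ 2 ^ (3 * q + 5) := by
    rw [pow_add]; have : 1 ≤ 2 ^ (3 * q) := Nat.one_le_two_pow; omega
  have hW' : 8192 * (n * n * n) ≤ W := by
    refine le_trans ?_ hW
    calc 8192 * (n * n * n) = 4 * (64 * (n * n * n) * 32) := by ring
      _ ≤ _ := by gcongr
  have hn1 : n ≤ n * n := Nat.le_mul_of_pos_right _ hn
  have hn2 : n * n ≤ n * n * n := Nat.le_mul_of_pos_right _ hn
  have one : 1 % W = 1 := Nat.mod_eq_of_lt (by omega)
  refine Runs.mono (T := (relabelBody.sz + 16) * (m + 1) + ((2 + ((logBody.sz + 20) * (n + 1) + (4 +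
    (2 + ((logBody.sz + 20) * (n + 1) + 2))))) + ((rootBody.sz + 20) * (n + 1) +
      (setParams q).sz))) (Runs.seq ((runs_relabel (n := n) (m := m) (by simp [RatioGraph.init])
      (by simp [RatioGraph.init]) (by omega) (by omega) (by simp [RatioGraph.init])
      (by funext i; simp [RatioGraph.init]) (fun e he => by simp [RatioGraph.init, he])
      (fun e he => by simp [RatioGraph.init, he])).mono le_rfl fun s₁ ha₁ ⟨hnum, hN2, hlab⟩ _ => ?_))
    ?_ fun _ _ h => h
  · set N := s₁.wvar wN with hN
    have hNn : N ≤ n := hnum.card_le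
    have hN0 : 0 < N := by
      have h1 := (hlab 0 hm).1
      have h2 := hnum.le ((G.init ω).warr aSrc₀ 0)
      omega
    have w₁ : s₁.wvar wn = n := by rw [ha₁.w _ rfl]; simp [RatioGraph.init]
    have m₁ : s₁.wvar wm = m := by rw [ha₁.w _ rfl]; simp [RatioGraph.init]
    refine Runs.seq ((runs_logs (N := N) w₁ rfl hn hN0 hNn (by omega)).mono le_rfl
      fun s₆ ha₆ ⟨g1, g2, g3, g4, g5⟩ _ => ?_)
    have N₆ : s₆.wvar wN = N := ha₆.w _ rfl
    have m₆ : s₆.wvar wm = m := (ha₆.w _ rfl).trans m₁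
    have hroot : (N + 1) * (N + 1) * ((N + 1) * (N + 1)) * m < W := by
      calc (N + 1) * (N + 1) * ((N + 1) * (N + 1)) * m
          ≤ (2 * n) * (2 * n) * ((2 * n) * (2 * n)) * (n + m + 2) := by gcongr <;> omega
        _ < (n + m + 2) ^ 4 * 2 ^ 4 * (n + m + 2) * 2 := by
          have h : 0 < (n + m + 2) ^ 4 * 2 ^ 4 * (n + m + 2) := by positivity
          have : (2 * n) * (2 * n) * ((2 * n) * (2 * n)) ≤ (n + m + 2) ^ 4 * 2 ^ 4 := by
            calc (2 * n) * (2 * n) * ((2 * n) * (2 * n)) = n ^ 4 * 2 ^ 4 := by ring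
              _ ≤ _ := by gcongr; omega
          have := Nat.mul_le_mul_right (n + m + 2) this
          omega
        _ ≤ (n + m + 2) ^ 4 * (n + m + 2) ^ 4 * (n + m + 2) * (n + m + 2) := by
          gcongr <;> omega
        _ = (n + m + 2) ^ 10 := by ring
        _ ≤ W := Nat.pow_le_pow_right (by omega) (by omega)
    refine Runs.seq ((runs_rootLoop N₆ m₆ hN0 hm hroot).mono (by gcongr) fun s₇ ha₇
      ⟨r1, r2, r3, r4⟩ _ => ?_)
    set lg := s₆.wvar wLg with hlg
    set h₀ := s₇.wvar 25 with hh₀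
    set P : Params := ⟨lg, h₀ * lg, q * (N / h₀ + 1), 3 * lg + (3 * q + 5), s₇.warr aC⟩ with hP
    have r5 : (G.init ω).warr aSrc₀ = fun i => if h : i < m then (G.src ⟨i, h⟩ : ℕ) else 0 := by
      funext i; simp [RatioGraph.init]
    have r6 : (G.init ω).warr aDst₀ = fun i => if h : i < m then (G.dst ⟨i, h⟩ : ℕ) else 0 := by
      funext i; simp [RatioGraph.init]
    rw [r5, r6] at hlab
    set H : Net := ⟨N, m, s₁.warr aSrc, s₁.warr aDst, s₁.rarr fC, s₁.rarr fT,
      fun e he => by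
        have := hnum.le (if h : e < m then (G.src ⟨e, h⟩ : ℕ) else 0)
        have h1 : s₁.warr aId (if h : e < m then (G.src ⟨e, h⟩ : ℕ) else 0) =
          s₁.warr aSrc e + 1 := (hlab e he).1
        omega,
      fun e he => by
        have := hnum.le (if h : e < m then (G.dst ⟨e, h⟩ : ℕ) else 0)
        have h1 : s₁.warr aId (if h : e < m then (G.dst ⟨e, h⟩ : ℕ) else 0) =
          s₁.warr aDst e + 1 := (hlab e he).2
        omega⟩ with hH
    have hsrc : ∀ e : Fin m, s₁.warr aId (G.src e) = s₁.warr aSrc e + 1 := fun e => by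
      simpa using (hlab e e.2).1
    have hdst : ∀ e : Fin m, s₁.warr aId (G.dst e) = s₁.warr aDst e + 1 := fun e => by
      simpa using (hlab e e.2).2
    have lgp : 2 ^ lg = 2 * 2 ^ (lg - 1) := by
      rw [← pow_succ', Nat.sub_add_cancel g3]
    have hS : Setup q G H P (s₆.wvar wB) h₀ := by
      refine ⟨rfl, hm, fun e => ?_, fun e => ?_, fun e f => ?_, fun e f => ?_, hN0, hNn, hN2,
        ?_, ?_, g4, g5, r1, r2, r3, r4, rfl, rfl, rfl⟩
      · show s₁.rarr fC e = _
        rw [ha₁.ra _ rfl]; simp [RatioGraph.init]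
      · show s₁.rarr fT e = _
        rw [ha₁.ra _ rfl]; simp [RatioGraph.init]
      · show s₁.warr aSrc e = s₁.warr aSrc f ↔ _
        rw [← Nat.add_right_cancel_iff (n := 1), ← hsrc e, ← hsrc f]
        exact ⟨fun h => Fin.ext (hnum.inj _ _ (by rw [hsrc e]; omega) h), fun h => by rw [h]⟩
      · show s₁.warr aDst e = s₁.warr aSrc f ↔ _
        rw [← Nat.add_right_cancel_iff (n := 1), ← hdst e, ← hsrc f]
        exact ⟨fun h => Fin.ext (hnum.inj _ _ (by rw [hdst e]; omega) h), fun h => by rw [h]⟩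
      · show 2 * n ≤ 2 ^ lg
        omega
      · show 2 ^ lg ≤ 4 * n
        omega
    have hOk := (Setup.ok (P := { P with C := fun _ => 0 }) ⟨hS.m_eq, hS.m_pos, hS.c, hS.t,
      hS.src_eq, hS.dst_eq, hS.N_pos, hS.N_le, hS.N_le', hS.le_lg, hS.lg_le, hS.le_b, hS.b_le,
      hS.h₀_pos, hS.h₀_le, hS.le_h₀, hS.h₀_lt, hS.h, hS.L, hS.lgB⟩ hq fun _ _ => hN0)
    have o1 : h₀ * lg < W := hOk.h_lt
    have o2 : 3 * (3 * lg + (3 * q + 5)) < W := hOk.J_lt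
    have o3 := hOk.samples_lt'
    have o4 := hOk.cells_lt
    change 4 * (q * (N / h₀ + 1) * (q * (N / h₀ + 1)) * (q * (N / h₀ + 1)) +
      q * (N / h₀ + 1) * (q * (N / h₀ + 1)) + q * (N / h₀ + 1) + 1) < W at o3
    change 4 * ((N + 1) * (N + m)) + 3 < W at o4
    have o6 : (N + 1) * N < W := by
      have : (N + 1) * N ≤ (N + 1) * (N + m) := Nat.mul_le_mul_left _ (Nat.le_add_right _ _)
      omega
    have o7 : N * N < W := (Nat.mul_le_mul_right N (Nat.le_succ N)).trans_lt o6
    have o8 : N + 1 < W := (Nat.le_mul_of_pos_right _ hN0).trans_lt o6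
    have t1 : s₇.wvar wLg = lg := ha₇.w _ rfl
    have t2 : s₇.wvar wN = N := (ha₇.w _ rfl).trans N₆
    refine (runs_setParams t1 t2 rfl o1 o2 o3 o6 o7 o8).mono le_rfl
      fun s₈ ha₈ ⟨p1, p2, p3, p4, p5, p6, p7, p8, p9⟩ => ⟨H, P, s₆.wvar wB, h₀, hS, ?_, ?_⟩
    · exact ⟨(ha₈.w _ rfl).trans t2, (ha₈.w _ rfl).trans ((ha₇.w _ rfl).trans m₆),
        (ha₈.wa _ rfl).trans ((ha₇.wa _ rfl).trans (ha₆.wa _ rfl)),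
        (ha₈.wa _ rfl).trans ((ha₇.wa _ rfl).trans (ha₆.wa _ rfl)),
        (ha₈.ra _ rfl).trans ((ha₇.ra _ rfl).trans (ha₆.ra _ rfl)),
        (ha₈.ra _ rfl).trans ((ha₇.ra _ rfl).trans (ha₆.ra _ rfl)),
        ha₈.wa _ rfl, (ha₈.w _ rfl).trans t1, p1, p2, p3, p4, p5, p7, p8, p9, p6⟩
    · rw [ha₈.w _ rfl, ha₇.w _ rfl]
  · unfold prepConst
    generalize (setParams q).sz = x
    generalize relabelBody.sz = y
    generalize logBody.sz = z
    generalize rootBody.sz = u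
    ring_nf
    omega

end

end RealRAM

/-! ### Random samples -/

namespace RealRAM

open Prog

/-- The number with the first `k` binary digits given by `f`. -/
def bitsValue (f : ℕ → Bool) : ℕ → ℕ
  | 0 => 0
  | k + 1 => 2 * bitsValue f k + (f k).toNat

theorem bitsValue_lt (f : ℕ → Bool) (k : ℕ) : bitsValue f k < 2 ^ k := by
  induction k with
  | zero => simp [bitsValue]
  | succ k ih =>
    have := Bool.toNat_le (f k)
    rw [bitsValue, pow_succ]
    omega

/-- The number determines its digits. -/
theorem bitsValue_inj {f g : ℕ → Bool} {k : ℕ} (h : bitsValue f k = bitsValue g k) :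
    ∀ i < k, f i = g i := by
  induction k with
  | zero => simp
  | succ k ih =>
    have h1 := Bool.toNat_le (f k)
    have h2 := Bool.toNat_le (g k)
    rw [bitsValue, bitsValue] at h
    intro i hi
    rcases Nat.lt_succ_iff_lt_or_eq.1 hi with hi | rfl
    · exact ih (by omega) i hi
    · have h3 : (f i).toNat = (g i).toNat := by omega
      revert h3
      cases f i <;> cases g i <;> simp

/-- The `a`-th random vertex, if the random numbers have `b` bits. -/
def drawn (b N : ℕ) (ω : ℕ → Bool) (a : ℕ) : ℕ :=
  if bitsValue (fun i => ω (a * b + i)) b < N then bitsValue (fun i => ω (a * b + i)) b else 0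

theorem drawn_lt {b N : ℕ} (hN : 0 < N) (ω : ℕ → Bool) (a : ℕ) : drawn b N ω a < N := by
  unfold drawn
  split_ifs with h
  exacts [h, hN]

section

variable {W : ℕ} {s s' : State}

theorem runs_bits {b : ℕ} (hb : s.wvar wB = b) (h28 : s.wvar 28 = 0) (hW : 2 ^ (b + 1) < W) :
    Runs W (.forUp 29 wB bitBody) s (b * (bitBody.sz + 8) + 8) fun s' =>
      s'.wvar 28 = bitsValue s.coins b ∧ s'.coins = fun j => s.coins (b + j) := by
  have hbW : b < W := Nat.lt_two_pow_self.trans ((Nat.pow_lt_pow_right (by omega) (by omega)).trans hW)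
  refine Runs.forUp (fun k s' => s'.wvar 28 = bitsValue s.coins k ∧
    s'.coins = fun j => s.coins (k + j)) rfl rfl hb hbW (by simp [h28, bitsValue])
    (fun k s' hk ha hk' hI => Runs.flat rfl ?_) fun _ _ h => h
  have two : 2 % W = 2 := Nat.mod_eq_of_lt (by
    have : 1 ≤ 2 ^ b := Nat.one_le_two_pow
    rw [pow_succ] at hW
    have := Nat.pow_le_pow_right (n := 2) (by omega) (show 1 ≤ b by omega)
    omega)
  have h1 := bitsValue_lt s.coins (k + 1)
  have h2 : 2 ^ (k + 1) ≤ 2 ^ (b + 1) := Nat.pow_le_pow_right (by omega) (by omega)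
  rw [bitsValue] at h1
  have m1 : 2 * bitsValue s.coins k % W = 2 * bitsValue s.coins k := Nat.mod_eq_of_lt (by omega)
  have m2 : (2 * bitsValue s.coins k + (s.coins k).toNat) % W =
    2 * bitsValue s.coins k + (s.coins k).toNat := Nat.mod_eq_of_lt (by omega)
  simp only [bitBody, Cmd.den, WExp.eval, State.setW_wvar, State.toss_wvar, State.setW_coins,
    State.toss_coins, hI, if_true, Nat.reduceEqDiff, if_false, two, m1, Nat.add_zero, m2, bitsValue,
    true_and]
  funext j
  congr 1
  omega

theorem runs_draw {b N L : ℕ} (hb : s.wvar wB = b) (hN : s.wvar wN = N) (hL : s.wvar wL = L)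
    (hLW : L < W) (hW : 2 ^ (b + 1) < W) :
    Runs W draw s ((bitBody.sz + drawBody.sz + 50) * (L * (b + 1) + 1)) fun s' =>
      ∀ a < L, s'.warr aC a = drawn b N s.coins a := by
  refine Runs.mono (T := L * (2 + (b * (bitBody.sz + 8) + 8 + (3 + (3 + 3))) + 8) + 8)
    (Runs.forUp (fun k s' => (∀ a < k, s'.warr aC a = drawn b N s.coins a) ∧
      s'.coins = fun j => s.coins (k * b + j)) rfl rfl hL hLW (by simp)
      (fun k s' hk ha hk' ⟨hI, hc⟩ => ?_) fun _ _ h => h.1) (by ring_nf; omega) fun _ _ h => h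
  refine Runs.seq (Runs.flat rfl fun ha₁ => Runs.seq ((runs_bits
    (s := (Cmd.wset 28 (.const 0)).den W s') ((ha.w wB rfl).trans hb)
    (by simp [Cmd.den, WExp.eval]) hW).mono le_rfl fun s₂ ha₂ ⟨h28, hc₂⟩ _ => ?_))
  have hc₁ : ((Cmd.wset 28 (.const 0)).den W s').coins = s'.coins := rfl
  rw [hc₁, hc] at h28 hc₂
  have k₂ : s₂.wvar 27 = k := by rw [ha₂.w _ rfl, ha₁.w _ rfl, hk']
  have N₂ : s₂.wvar wN = N := by rw [ha₂.w _ rfl, ha₁.w _ rfl, ha.w _ rfl, hN]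
  have C₂ : s₂.warr aC = s'.warr aC := by rw [ha₂.wa _ rfl, ha₁.wa _ rfl]
  have key : Runs W (.ite (.wlt (.var 28) (.var wN)) (.wput aC (.var 27) (.var 28))
      (.wput aC (.var 27) (.const 0))) s₂ (3 + (3 + 3)) fun s₃ =>
      (∀ a < k + 1, s₃.warr aC a = drawn b N s.coins a) ∧
        s₃.coins = fun j => s.coins ((k + 1) * b + j) := by
    refine Runs.mono (Runs.flat rfl ?_) (by simp [Cmd.sz, BExp.cost, WExp.cost]) fun _ _ h => h
    have hcond : BExp.Holds W s₂ (.wlt (.var 28) (.var wN)) ↔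
        bitsValue (fun i => s.coins (k * b + i)) b < N := by
      simp [BExp.Holds, WExp.eval, h28, N₂]
    have hcoins : s₂.coins = fun j => s.coins ((k + 1) * b + j) := by
      rw [hc₂]; funext j; rw [Nat.succ_mul, add_assoc]
    rw [Cmd.den]
    split_ifs with h
    · rw [hcond] at h
      refine ⟨fun a ha => ?_, hcoins⟩
      simp only [Cmd.den, WExp.eval, State.putW_warr, if_true, C₂, k₂, h28, Function.update_apply]
      split_ifs with e
      · rw [e, drawn, if_pos h]
      · exact hI a (by omega)
    · rw [hcond] at h
      refine ⟨fun a ha => ?_, hcoins⟩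
      simp only [Cmd.den, WExp.eval, State.putW_warr, if_true, C₂, k₂, Function.update_apply,
        Nat.zero_mod]
      split_ifs with e
      · rw [e, drawn, if_neg h]
      · exact hI a (by omega)
  exact key.mono le_rfl fun s₃ _ h => ⟨by simpa using h.1, by simpa using h.2⟩

end

/-! ### The probability of failure -/

open MeasureTheory

/-- Any particular outcome of the first `M` coins. -/
theorem coinMeasure_cylinder (M : ℕ) (ω₀ : ℕ → Bool) :
    coinMeasure {ω | ∀ i < M, ω i = ω₀ i} = (2 ^ M)⁻¹ := by
  have : {ω : ℕ → Bool | ∀ i < M, ω i = ω₀ i} =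
      Set.pi (Finset.range M : Set ℕ) fun i => {ω₀ i} := by
    ext ω; simp [Set.mem_pi]
  rw [this, coinMeasure, Measure.infinitePi_pi _ fun _ _ => measurableSet_singleton _]
  simp [ENNReal.inv_pow]

/-- The samples are independent, and each of them avoids a set of `k` vertices with probability at
most `1 - k / 2 ^ b`. The event is the union over all sequences `y` of `L` numbers outside of the set,
each of which fixes the first `L * b` coins. -/
theorem coinMeasure_avoid (b L : ℕ) {S : Finset ℕ} (hS : S ⊆ Finset.range (2 ^ b)) :
    coinMeasure {ω | ∀ a < L, bitsValue (fun i => ω (a * b + i)) b ∉ S} ≤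
      (2 ^ b - S.card : ℕ) ^ L * (2 ^ (L * b))⁻¹ := by
  set T := Finset.range (2 ^ b) \ S with hT
  have hcard : T.card = 2 ^ b - S.card := by
    rw [hT, Finset.card_sdiff_of_subset hS, Finset.card_range]
  have hsub : {ω : ℕ → Bool | ∀ a < L, bitsValue (fun i => ω (a * b + i)) b ∉ S} ⊆
      ⋃ y ∈ Fintype.piFinset fun _ : Fin L => T,
        {ω | ∀ a : Fin L, bitsValue (fun i => ω (a * b + i)) b = y a} := by
    intro ω hω
    simp only [Set.mem_iUnion]
    exact ⟨fun a => bitsValue (fun i => ω (a * b + i)) b, Fintype.mem_piFinset.2 fun a =>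
      Finset.mem_sdiff.2 ⟨Finset.mem_range.2 (bitsValue_lt _ _), hω a a.2⟩, fun a => rfl⟩
  calc _ ≤ ∑ y ∈ Fintype.piFinset fun _ : Fin L => T, coinMeasure
        {ω : ℕ → Bool | ∀ a : Fin L, bitsValue (fun i => ω (a * b + i)) b = y a} :=
      (measure_mono hsub).trans (measure_biUnion_finset_le _ _)
    _ ≤ ∑ y ∈ Fintype.piFinset fun _ : Fin L => T, ((2 : ENNReal) ^ (L * b))⁻¹ := by
      refine Finset.sum_le_sum fun y _ => ?_
      rcases Set.eq_empty_or_nonempty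
        {ω : ℕ → Bool | ∀ a : Fin L, bitsValue (fun i => ω (a * b + i)) b = y a} with h | ⟨ω₀, h₀⟩
      · rw [h]; simp
      · rw [← coinMeasure_cylinder (L * b) ω₀]
        refine measure_mono fun ω hω i hi => ?_
        have hb : 0 < b := Nat.pos_of_ne_zero fun h => by simp [h] at hi
        have ha : i / b < L := Nat.div_lt_of_lt_mul (by rwa [mul_comm])
        have := bitsValue_inj ((hω ⟨i / b, ha⟩).trans (h₀ ⟨i / b, ha⟩).symm) (i % b)
          (Nat.mod_lt _ hb)
        simpa [mul_comm _ b, Nat.div_add_mod] using this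
    _ = _ := by
      rw [Finset.sum_const, Fintype.card_piFinset_const, hcard]
      simp

end RealRAM

namespace RealRAM

open Prog MeasureTheory

section

variable {n m q b h₀ : ℕ} {G : RatioGraph n m} {H : Net} {P : Params}

/-- The number of bit patterns for which all samples avoid a set of `h` vertices is small enough:
`h * L` is at least `2 * (c + 1) * lg * N`, hence at least `(c + 1) * lg * 2 ^ b`, and
`1 - h / 2 ^ b ≤ exp (-h / 2 ^ b)`. -/
theorem Setup.avoid_le {c : ℕ} (hS : Setup (2 * (c + 1)) G H P b h₀) (hh : P.h ≤ H.N) :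
    (2 ^ b - P.h) ^ P.L * n ^ (c + 1) ≤ 2 ^ (P.L * b) := by
  have hN := hS.N_pos
  have hle : P.h ≤ 2 ^ b := hh.trans hS.le_b
  have hB : (0 : ℝ) < 2 ^ b := by positivity
  have h1 : H.N ≤ h₀ * (H.N / h₀ + 1) := by
    have := Nat.lt_mul_div_succ H.N hS.h₀_pos
    omega
  have h2 : (c + 1) * P.lg * 2 ^ b ≤ P.h * P.L := by
    rw [hS.h, hS.L]
    calc (c + 1) * P.lg * 2 ^ b ≤ (c + 1) * P.lg * (2 * (h₀ * (H.N / h₀ + 1))) := by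
          gcongr; exact hS.b_le.trans (by omega)
      _ = _ := by ring
  have h3 : ((c + 1 : ℕ) : ℝ) * P.lg ≤ P.L * (P.h / 2 ^ b : ℝ) := by
    rw [← mul_div_assoc, le_div_iff₀ hB]
    have : (((c + 1) * P.lg * 2 ^ b : ℕ) : ℝ) ≤ (P.h * P.L : ℕ) := by exact_mod_cast h2
    push_cast at this ⊢
    linarith
  have h4 : (n : ℝ) ≤ Real.exp P.lg := by
    have : (n : ℝ) ≤ 2 ^ P.lg := by
      exact_mod_cast (show n ≤ 2 ^ P.lg by have := hS.le_lg; omega)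
    refine this.trans ?_
    rw [← mul_one (P.lg : ℝ), Real.exp_nat_mul]
    have := Real.add_one_le_exp (1 : ℝ)
    gcongr
    linarith
  have h5 : ((2 ^ b - P.h : ℕ) : ℝ) ≤ 2 ^ b * Real.exp (-(P.h / 2 ^ b)) := by
    rw [Nat.cast_sub hle]
    push_cast
    have := Real.add_one_le_exp (-(P.h / 2 ^ b : ℝ))
    calc (2 ^ b - P.h : ℝ) = 2 ^ b * (-(P.h / 2 ^ b) + 1) := by field_simp; ring
      _ ≤ _ := by gcongr
  have h6 : ((2 ^ b - P.h : ℕ) : ℝ) ^ P.L * (n : ℝ) ^ (c + 1) ≤ (2 : ℝ) ^ (P.L * b) := by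
    calc ((2 ^ b - P.h : ℕ) : ℝ) ^ P.L * (n : ℝ) ^ (c + 1)
        ≤ (2 ^ b * Real.exp (-(P.h / 2 ^ b))) ^ P.L * (Real.exp P.lg) ^ (c + 1) := by gcongr
      _ = (2 ^ b) ^ P.L * Real.exp (P.L * -(P.h / 2 ^ b) + (c + 1 : ℕ) * P.lg) := by
        rw [mul_pow, ← Real.exp_nat_mul, ← Real.exp_nat_mul, Real.exp_add, mul_assoc]
      _ ≤ (2 ^ b) ^ P.L * 1 := by
        gcongr
        rw [Real.exp_le_one_iff]
        linarith
      _ = _ := by rw [mul_one, ← pow_mul, mul_comm]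
  exact_mod_cast h6

/-- Vertices that are consecutive on a simple cycle are different. -/
theorem card_window {l : List ℕ} (hl : H.Cyc l) {h : ℕ} (hh : h ≤ l.length) (i : ℕ) :
    ((Finset.range h).image fun j => H.src (periodic l (i + j))).card = h := by
  have hk : 0 < l.length := List.length_pos_iff.2 hl.1
  rw [Finset.card_image_of_injOn, Finset.card_range]
  intro j hj j' hj' e
  simp only [Finset.coe_range, Set.mem_Iio] at hj hj'
  simp only [periodic_eq (Nat.mod_lt _ hk) rfl] at e
  have h1 : (i + j) % l.length = (i + j') % l.length := by
    have := hl.2.2.getElem_inj_iff (i := (i + j) % l.length) (j := (i + j') % l.length)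
      (hi := by simpa using Nat.mod_lt _ hk) (hj := by simpa using Nat.mod_lt _ hk)
    exact this.1 (by simpa using e)
  have h2 : j ≡ j' [MOD l.length] := Nat.ModEq.add_left_cancel' i h1
  exact Nat.ModEq.eq_of_lt_of_lt h2 (by omega) (by omega)

/-- The union bound over the windows of `h` consecutive vertices of a cycle: there are at most `n`
windows, and each of them is avoided by all samples with probability at most `n⁻¹ ^ (c + 1)`. -/
theorem coinMeasure_not_covered {c : ℕ} (hS : Setup (2 * (c + 1)) G H P b h₀) {l : List ℕ}
    (hl : H.Cyc l) :
    coinMeasure {ω | ∃ C, (∀ a < P.L, C a = drawn b H.N ω a) ∧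
      ¬ Covered H { P with C := C } l} ≤ ((n : ENNReal) ^ c)⁻¹ := by
  have hlg : H.N ≤ 2 ^ P.lg := by have := hS.le_lg; have := hS.N_le; omega
  have hk : 0 < l.length := List.length_pos_iff.2 hl.1
  rcases le_or_gt l.length P.h with hh | hh
  · have : {ω | ∃ C, (∀ a < P.L, C a = drawn b H.N ω a) ∧
        ¬ Covered H { P with C := C } l} = ∅ := by
      ext ω
      simp only [Set.mem_ofPred_eq, Set.mem_empty_iff_false, iff_false]
      rintro ⟨C, -, h⟩
      exact h (covered_of_hits hl hlg fun h' => absurd h' (not_lt.2 hh))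
    rw [this]; simp
  set S : ℕ → Finset ℕ := fun i => (Finset.range P.h).image fun j => H.src (periodic l (i + j))
    with hSdef
  have hlt : ∀ i, H.src (periodic l i) < H.N := fun i => H.src_lt _ (hl.lt _ (by
    rw [periodic_eq (Nat.mod_lt _ hk) rfl]; exact List.getElem_mem _))
  have hhN : P.h ≤ H.N := hh.le.trans hl.length_le
  have hsub : {ω | ∃ C, (∀ a < P.L, C a = drawn b H.N ω a) ∧ ¬ Covered H { P with C := C } l} ⊆
      ⋃ i ∈ Finset.range l.length,
        {ω | ∀ a < P.L, bitsValue (fun i => ω (a * b + i)) b ∉ S i} := by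
    rintro ω ⟨C, hC, hcov⟩
    by_contra hcon
    simp only [Set.mem_iUnion, not_exists, Set.mem_ofPred_eq, not_forall, not_not,
      Finset.mem_range] at hcon
    refine hcov (covered_of_hits hl hlg fun _ i => ?_)
    obtain ⟨a, ha, hmem⟩ := hcon (i % l.length) (Nat.mod_lt _ hk)
    simp only [hSdef, Finset.mem_image, Finset.mem_range] at hmem
    obtain ⟨j, hj, hja⟩ := hmem
    refine ⟨j, hj, a, ha, ?_⟩
    have hper : periodic l (i % l.length + j) = periodic l (i + j) := by simp [periodic]
    show C a = _
    rw [hC a ha, drawn, if_pos (by rw [← hja]; exact hlt _), ← hja, hper]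
  have hone : ∀ i, coinMeasure {ω | ∀ a < P.L, bitsValue (fun i => ω (a * b + i)) b ∉ S i} ≤
      ((n : ENNReal) ^ (c + 1))⁻¹ := fun i => by
    refine (coinMeasure_avoid b P.L (S := S i) ?_).trans ?_
    · intro x hx
      obtain ⟨j, -, rfl⟩ := Finset.mem_image.1 hx
      exact Finset.mem_range.2 ((hlt _).trans_le hS.le_b)
    · rw [card_window hl hh.le, ENNReal.le_inv_iff_mul_le]
      calc ((2 ^ b - P.h : ℕ) : ENNReal) ^ P.L * (2 ^ (P.L * b))⁻¹ * (n : ENNReal) ^ (c + 1)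
          = (((2 ^ b - P.h) ^ P.L * n ^ (c + 1) : ℕ) : ENNReal) * (2 ^ (P.L * b))⁻¹ := by
            push_cast; ring
        _ ≤ ((2 ^ (P.L * b) : ℕ) : ENNReal) * (2 ^ (P.L * b))⁻¹ := by
            gcongr; exact hS.avoid_le hhN
        _ ≤ 1 := by push_cast; exact ENNReal.mul_inv_le_one _
  have hn : 0 < n := hS.N_pos.trans_le hS.N_le
  calc _ ≤ ∑ i ∈ Finset.range l.length,
        coinMeasure {ω | ∀ a < P.L, bitsValue (fun i => ω (a * b + i)) b ∉ S i} :=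
        (measure_mono hsub).trans (measure_biUnion_finset_le _ _)
    _ ≤ ∑ i ∈ Finset.range l.length, ((n : ENNReal) ^ (c + 1))⁻¹ :=
        Finset.sum_le_sum fun i _ => hone i
    _ = l.length * ((n : ENNReal) ^ (c + 1))⁻¹ := by simp
    _ ≤ n * ((n : ENNReal) ^ (c + 1))⁻¹ := by
        gcongr; exact hl.length_le.trans hS.N_le
    _ = ((n : ENNReal) ^ c)⁻¹ := by
        have h0 : (n : ENNReal) ≠ 0 := by exact_mod_cast hn.ne'
        rw [pow_succ, ENNReal.mul_inv (.inr (ENNReal.natCast_ne_top n)) (.inr h0), mul_comm,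
          mul_assoc, ENNReal.inv_mul_cancel h0 (ENNReal.natCast_ne_top n), mul_one]

/-! ### Cycles after renumbering -/

/-- The numbers of the vertices are irrelevant for the comparison of heads with tails. -/
theorem Setup.map_eq (hS : Setup q G H P b h₀) (k l : List (Fin m)) :
    (k.map Fin.val).map H.dst = (l.map Fin.val).map H.src ↔ k.map G.dst = l.map G.src := by
  induction k generalizing l with
  | nil => cases l <;> simp
  | cons e k ih =>
    cases l with
    | nil => simp
    | cons f l =>
      have := hS.dst_eq e f
      simp only [List.map_cons, List.cons.injEq, ih, this]

theorem Setup.cyc_iff (hS : Setup q G H P b h₀) (l : List (Fin m)) :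
    H.Cyc (l.map Fin.val) ↔ G.IsCycle l := by
  cases l with
  | nil => simp [Net.Cyc, RatioGraph.IsCycle]
  | cons e l =>
    have hnd : (((e :: l).map Fin.val).map H.src).Nodup ↔ ((e :: l).map G.src).Nodup := by
      simp only [List.Nodup, List.pairwise_map, ne_eq, hS.src_eq]
    have hwalk : (∃ u, H.Walk u ((e :: l).map Fin.val) u) ↔
        (e :: l).map G.dst = ((e :: l).map G.src).rotate 1 := by
      have h1 := hS.map_eq (e :: l) (l ++ [e])
      have h2 : ∀ f ∈ (e :: l).map Fin.val, f < H.m := fun f hf => by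
        obtain ⟨f, -, rfl⟩ := List.mem_map.1 hf
        rw [hS.m_eq]; exact f.2
      rw [List.map_cons (f := G.src), List.rotate_cons_succ, List.rotate_zero,
        ← List.map_singleton (f := G.src), ← List.map_append, ← h1]
      constructor
      · rintro ⟨u, -, hu⟩
        simp only [List.map_cons, List.cons_append, List.cons.injEq] at hu
        obtain ⟨rfl, hu⟩ := hu
        simpa using hu
      · intro h
        refine ⟨H.src e, h2, ?_⟩
        rw [h]
        simp
    rw [Net.Cyc, RatioGraph.IsCycle, hnd, hwalk]
    simp

theorem Setup.exists_list (hS : Setup q G H P b h₀) {l : List ℕ} (hl : ∀ e ∈ l, e < H.m) :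
    ∃ l' : List (Fin m), l'.map Fin.val = l := by
  rw [hS.m_eq] at hl
  exact ⟨l.pmap (fun e he => ⟨e, he⟩) hl, by simp [List.map_pmap]⟩

theorem Setup.timeSum_eq (hS : Setup q G H P b h₀) (l : List (Fin m)) :
    H.timeSum (l.map Fin.val) = G.totalTime l := by
  rw [Net.timeSum, RatioGraph.totalTime, List.map_map]
  congr 1
  exact List.map_congr_left fun e _ => hS.t e

theorem Setup.ratio_eq (hS : Setup q G H P b h₀) (l : List (Fin m)) :
    H.ratio (l.map Fin.val) = G.ratio l := by
  rw [Net.ratio, RatioGraph.ratio, hS.timeSum_eq, Net.costSum, List.map_map]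
  congr 2
  exact List.map_congr_left fun e _ => hS.c e

end

/-! ### The first phase does not depend on the coins before they are tossed -/

section

variable {W : ℕ} {s s' : State}

theorem WExp.eval_coins (e : WExp) (ω : ℕ → Bool) :
    e.eval W { s with coins := ω } = e.eval W s := by
  induction e <;> simp [WExp.eval, *]

theorem RExp.eval_coins (e : RExp) (ω : ℕ → Bool) :
    e.eval W { s with coins := ω } = e.eval W s := by
  induction e <;> simp [RExp.eval, WExp.eval_coins, *]

theorem BExp.holds_coins (b : BExp) (ω : ℕ → Bool) :
    b.Holds W { s with coins := ω } ↔ b.Holds W s := by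
  induction b <;> simp [BExp.Holds, RExp.eval_coins, WExp.eval_coins, *]

/-- A program without coin tosses runs in the same way for all outcomes of the coins. -/
theorem Exec.coins {p : Cmd} {T : ℕ} (h : Exec W p s T s') (hp : p.tosses = false)
    (ω : ℕ → Bool) : Exec W p { s with coins := ω } T { s' with coins := ω } := by
  induction h with
  | skip s => exact .skip _
  | wset s x e => simpa only [WExp.eval_coins] using Exec.wset (W := W) { s with coins := ω } x e
  | wput s a i e => simpa only [WExp.eval_coins] using Exec.wput (W := W) { s with coins := ω } a i e
  | rset s x e => simpa only [RExp.eval_coins] using Exec.rset (W := W) { s with coins := ω } x e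
  | rput s a i e =>
    simpa only [WExp.eval_coins, RExp.eval_coins] using
      Exec.rput (W := W) { s with coins := ω } a i e
  | flip s x => simp [Cmd.tosses] at hp
  | seq _ _ ih₁ ih₂ =>
    simp only [Cmd.tosses, Bool.or_eq_false_iff] at hp
    exact .seq (ih₁ hp.1) (ih₂ hp.2)
  | iteTrue hb _ ih =>
    simp only [Cmd.tosses, Bool.or_eq_false_iff] at hp
    exact .iteTrue ((BExp.holds_coins _ _).2 hb) (ih hp.1)
  | iteFalse hb _ ih =>
    simp only [Cmd.tosses, Bool.or_eq_false_iff] at hp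
    exact .iteFalse (mt (BExp.holds_coins _ _).1 hb) (ih hp.2)
  | loopDone hb => exact .loopDone (mt (BExp.holds_coins _ _).1 hb)
  | loopStep hb _ _ ih₁ ih₂ =>
    exact .loopStep ((BExp.holds_coins _ _).2 hb) (ih₁ hp) (ih₂ hp)

theorem Cmd.coinFree_of_tosses {p : Cmd} (h : p.tosses = false) : p.CoinFree := by
  induction p <;> simp_all [Cmd.tosses, Cmd.CoinFree]

end

end RealRAM

/-! ### The running time -/

namespace RealRAM

open Prog

section

variable {n m q b h₀ : ℕ} {G : RatioGraph n m} {H : Net} {P : Params}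

/-- A constant for the time needed to draw the samples. -/
def drawConst : ℕ := bitBody.sz + drawBody.sz + 50

/-- A constant for the running time of the whole program. -/
def timeConst (q : ℕ) : ℕ := 8 + 3 * prepConst q + (3 * q + 1) * drawConst +
  searchConst * (3 * q + 9) * (60 * q + 205 + 9 * q ^ 3)

/-- The `h` short stages take time `h₀ * lg * n * m`, the `lg` squarings `lg * L ^ 3`, up to constants. -/
theorem Setup.stagesTime_le (hS : Setup q G H P b h₀) (hq : 0 < q) :
    stagesTime H P ≤ P.lg * ((60 * q + 205 + 9 * q ^ 3) *
      (h₀ * (n * m) + (H.N / h₀ + 1) ^ 3)) := by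
  have hn : 0 < n := hS.N_pos.trans_le hS.N_le
  have hm := hS.m_pos
  have hlg0 : 0 < P.lg := Nat.pos_of_ne_zero fun h => by
    have := hS.le_lg; rw [h] at this; omega
  have hlg : P.lg < 2 ^ P.lg := Nat.lt_two_pow_self
  have hlg' := hS.lg_le
  have hh := hS.h₀_pos
  set M := H.N / h₀ + 1 with hM
  have e1 : H.N * H.N ≤ 2 * (n * m) := by
    calc H.N * H.N ≤ n * (2 * m) := Nat.mul_le_mul hS.N_le hS.N_le'
      _ = _ := by ring
  have e2 : H.N * m ≤ n * m := Nat.mul_le_mul_right _ hS.N_le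
  have e3 : H.N ≤ n * m := hS.N_le.trans (Nat.le_mul_of_pos_right _ hm)
  have e4 : m ≤ n * m := Nat.le_mul_of_pos_left _ hn
  have e5 : P.lgB + 1 ≤ (12 * q + 36) * (n * m) := by
    rw [hS.lgB]
    have h1 : n ≤ n * m := Nat.le_mul_of_pos_right _ hm
    nlinarith
  have e6 : P.h + 1 ≤ 2 * (h₀ * P.lg) := by
    rw [hS.h]
    have := Nat.mul_pos hh hlg0
    omega
  have e7 : P.L * P.L * P.L + P.L * P.L + P.L ≤ 3 * (q ^ 3 * M ^ 3) := by
    have hL : P.L = q * M := hS.L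
    have hL0 : 0 < P.L := by rw [hL]; positivity
    have h4 : P.L ≤ P.L * P.L := Nat.le_mul_of_pos_right _ hL0
    have h5 : P.L * P.L ≤ P.L * P.L * P.L := Nat.le_mul_of_pos_right _ hL0
    have h6 : P.L * P.L * P.L = q ^ 3 * M ^ 3 := by rw [hL]; ring
    omega
  have e8 : n * m ≤ h₀ * (n * m) := Nat.le_mul_of_pos_left _ hh
  unfold stagesTime
  rw [hS.m_eq]
  calc (P.h + 1) * (H.N * H.N + H.N * m + H.N + m + P.lgB + 1) +
        (P.lg + 2) * (P.L * P.L * P.L + P.L * P.L + P.L + H.N * m + H.N + m + P.lgB + 1)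
      ≤ 2 * (h₀ * P.lg) * ((12 * q + 41) * (n * m)) +
        3 * P.lg * (3 * (q ^ 3 * M ^ 3) + (12 * q + 41) * (h₀ * (n * m))) := by
        gcongr ?_ * ?_ + ?_ * ?_
        · linarith
        · omega
        · nlinarith
    _ ≤ _ := by
        have h1 : 0 ≤ P.lg * (h₀ * (n * m)) * q ^ 3 := Nat.zero_le _
        have h2 : 0 ≤ P.lg * M ^ 3 * (60 * q + 205) := Nat.zero_le _
        nlinarith

/-- The other parts of the program are faster than the stages, apart from the term for drawing the
samples. The two logarithmic factors come from the number of stages and from `groupMin`. -/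
theorem Setup.time_le (hS : Setup q G H P b h₀) (hq : 0 < q) :
    8 + prepConst q * (n + m + 1) + drawConst * (P.L * (b + 1) + 1) +
      searchConst * (P.lgB + 1) * stagesTime H P ≤
    timeConst q * (P.lg ^ 2 * (h₀ * (n * m) + (H.N / h₀ + 1) ^ 3 + (H.N / h₀ + 1) * n)) := by
  have hn : 0 < n := hS.N_pos.trans_le hS.N_le
  have hm := hS.m_pos
  have hlg0 : 0 < P.lg := Nat.pos_of_ne_zero fun h => by
    have := hS.le_lg; rw [h] at this; omega
  have hst := hS.stagesTime_le hq
  set M := H.N / h₀ + 1 with hM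
  set Y := h₀ * (n * m) + M ^ 3 + M * n with hY
  have hY0 : n * m ≤ Y := by
    have := Nat.le_mul_of_pos_left (n * m) hS.h₀_pos
    omega
  have hlY : Y ≤ P.lg ^ 2 * Y := Nat.le_mul_of_pos_left _ (by positivity)
  have h1 : n + m + 1 ≤ 3 * Y := by
    have h1 : n ≤ n * m := Nat.le_mul_of_pos_right _ hm
    have h2 : m ≤ n * m := Nat.le_mul_of_pos_left _ hn
    omega
  have h2 : P.L * (b + 1) + 1 ≤ (3 * q + 1) * Y := by
    have hb : b < 2 ^ b := Nat.lt_two_pow_self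
    have hb' := hS.b_le
    have hN := hS.N_le
    have hYM : M * n ≤ Y := Nat.le_add_left _ _
    have hY1 : 1 ≤ Y := le_trans (Nat.mul_pos hn hm) hY0
    calc P.L * (b + 1) + 1 ≤ q * M * (3 * n) + 1 := by rw [hS.L]; gcongr; omega
      _ = 3 * q * (M * n) + 1 := by ring
      _ ≤ 3 * q * Y + Y := by gcongr
      _ = _ := by ring
  have h3 : (P.lgB + 1) * stagesTime H P ≤
      (3 * q + 9) * (60 * q + 205 + 9 * q ^ 3) * (P.lg ^ 2 * Y) := by
    calc (P.lgB + 1) * stagesTime H P ≤ ((3 * q + 9) * P.lg) *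
        (P.lg * ((60 * q + 205 + 9 * q ^ 3) * (h₀ * (n * m) + M ^ 3))) := by
          gcongr
          rw [hS.lgB]; nlinarith
      _ ≤ ((3 * q + 9) * P.lg) * (P.lg * ((60 * q + 205 + 9 * q ^ 3) * Y)) := by
          gcongr; omega
      _ = _ := by ring
  have hY1 : 1 ≤ Y := le_trans (Nat.mul_pos hn hm) hY0
  calc _ ≤ 8 * (P.lg ^ 2 * Y) + prepConst q * (3 * (P.lg ^ 2 * Y)) +
        drawConst * ((3 * q + 1) * (P.lg ^ 2 * Y)) +
        searchConst * ((3 * q + 9) * (60 * q + 205 + 9 * q ^ 3) * (P.lg ^ 2 * Y)) := by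
        rw [mul_assoc searchConst]
        refine Nat.add_le_add (Nat.add_le_add (Nat.add_le_add (by omega)
          (Nat.mul_le_mul_left _ (by omega))) (Nat.mul_le_mul_left _ (h2.trans ?_)))
          (Nat.mul_le_mul_left _ h3)
        exact Nat.mul_le_mul_left _ hlY
    _ = _ := by rw [timeConst]; ring

/-- With `h₀` about `√n / m ^ (1 / 4)` the time spent on short walks and the time spent on the
samples are balanced. -/
theorem Setup.balance_le (hS : Setup q G H P b h₀) :
    ((h₀ * (n * m) + (H.N / h₀ + 1) ^ 3 + (H.N / h₀ + 1) * n : ℕ) : ℝ) ≤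
      12 * ((n : ℝ) ^ (3 / 2 : ℝ) * (m : ℝ) ^ (3 / 4 : ℝ)) := by
  have hn : 0 < n := hS.N_pos.trans_le hS.N_le
  have hm := hS.m_pos
  set r : ℝ := (n : ℝ) ^ (1 / 2 : ℝ) with hr
  set s : ℝ := (m : ℝ) ^ (1 / 4 : ℝ) with hs
  have r1 : 1 ≤ r := Real.one_le_rpow (by exact_mod_cast hn) (by norm_num)
  have s1 : 1 ≤ s := Real.one_le_rpow (by exact_mod_cast hm) (by norm_num)
  have hn2 : (n : ℝ) = r ^ 2 := by
    rw [hr, ← Real.rpow_natCast, ← Real.rpow_mul (Nat.cast_nonneg n)]; norm_num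
  have hm4 : (m : ℝ) = s ^ 4 := by
    rw [hs, ← Real.rpow_natCast, ← Real.rpow_mul (Nat.cast_nonneg m)]; norm_num
  have hn3 : (n : ℝ) ^ (3 / 2 : ℝ) = r ^ 3 := by
    rw [hr, ← Real.rpow_natCast, ← Real.rpow_mul (Nat.cast_nonneg n)]; norm_num
  have hm3 : (m : ℝ) ^ (3 / 4 : ℝ) = s ^ 3 := by
    rw [hs, ← Real.rpow_natCast, ← Real.rpow_mul (Nat.cast_nonneg m)]; norm_num
  have hsr : s ≤ r := by
    have : (m : ℝ) ≤ n * n := by exact_mod_cast G.le_square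
    rw [hn2, hm4] at this
    exact le_of_pow_le_pow_left₀ (by norm_num : 4 ≠ 0) (by linarith) (by nlinarith)
  have hN : (H.N : ℝ) ≤ r ^ 2 := by rw [← hn2]; exact_mod_cast hS.N_le
  have hN0 : (0 : ℝ) ≤ H.N := Nat.cast_nonneg _
  have hh0 : (1 : ℝ) ≤ h₀ := by exact_mod_cast hS.h₀_pos
  -- upper bound for `h₀`
  have hup : (h₀ : ℝ) * s ≤ s + r := by
    rcases hS.h₀_lt with h | h
    · rw [h]; push_cast; linarith
    · have h1 : (((h₀ - 1) ^ 4 * m : ℕ) : ℝ) < (H.N * H.N : ℕ) := by exact_mod_cast h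
      rw [Nat.cast_mul, Nat.cast_pow, Nat.cast_sub hS.h₀_pos, Nat.cast_mul, hm4] at h1
      push_cast at h1
      have h2 : ((h₀ - 1 : ℝ) * s) ^ 4 ≤ r ^ 4 := by
        rw [mul_pow]
        nlinarith
      have h3 := le_of_pow_le_pow_left₀ (by norm_num : 4 ≠ 0) (by linarith) h2
      linarith
  -- lower bound for `h₀`
  have hlow : (H.N : ℝ) ≤ h₀ ^ 2 * s ^ 2 := by
    have h1 : ((H.N * H.N : ℕ) : ℝ) ≤ (h₀ * h₀ * (h₀ * h₀) * m : ℕ) := by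
      exact_mod_cast hS.le_h₀
    push_cast at h1
    rw [hm4] at h1
    refine le_of_pow_le_pow_left₀ (by norm_num : 2 ≠ 0) (by positivity) ?_
    nlinarith
  have hdiv : ((H.N / h₀ : ℕ) : ℝ) ≤ r * s := by
    refine Nat.cast_div_le.trans ?_
    rw [div_le_iff₀ (by linarith)]
    refine le_of_pow_le_pow_left₀ (by norm_num : 2 ≠ 0) (by positivity) ?_
    calc (H.N : ℝ) ^ 2 = H.N * H.N := by ring
      _ ≤ r ^ 2 * (h₀ ^ 2 * s ^ 2) := by gcongr
      _ = _ := by ring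
  have hrs : 1 ≤ r * s := by nlinarith
  have hM : ((H.N / h₀ : ℕ) : ℝ) + 1 ≤ 2 * (r * s) := by linarith
  have hM0 : (0 : ℝ) ≤ ((H.N / h₀ : ℕ) : ℝ) + 1 := by positivity
  push_cast
  rw [hn3, hm3, hn2, hm4]
  have t1 : (h₀ : ℝ) * (r ^ 2 * s ^ 4) ≤ 2 * (r ^ 3 * s ^ 3) := by
    calc (h₀ : ℝ) * (r ^ 2 * s ^ 4) = h₀ * s * (r ^ 2 * s ^ 3) := by ring
      _ ≤ (s + r) * (r ^ 2 * s ^ 3) := by gcongr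
      _ ≤ (r + r) * (r ^ 2 * s ^ 3) := by gcongr
      _ = _ := by ring
  have t2 : (((H.N / h₀ : ℕ) : ℝ) + 1) ^ 3 ≤ 8 * (r ^ 3 * s ^ 3) := by
    calc (((H.N / h₀ : ℕ) : ℝ) + 1) ^ 3 ≤ (2 * (r * s)) ^ 3 := by gcongr
      _ = _ := by ring
  have t3 : (((H.N / h₀ : ℕ) : ℝ) + 1) * r ^ 2 ≤ 2 * (r ^ 3 * s ^ 3) := by
    calc (((H.N / h₀ : ℕ) : ℝ) + 1) * r ^ 2 ≤ 2 * (r * s) * r ^ 2 := by gcongr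
      _ = 2 * (r ^ 3 * (s * 1)) := by ring
      _ ≤ 2 * (r ^ 3 * (s * s ^ 2)) := by gcongr; nlinarith
      _ = _ := by ring
  linarith

/-- `lg` is at most a constant times `log n`, except for `n = 1`, where the additive constant of the
running time is needed. -/
theorem Setup.log_le (hS : Setup q G H P b h₀) :
    ((P.lg : ℝ) ^ 2) * ((n : ℝ) ^ (3 / 2 : ℝ) * (m : ℝ) ^ (3 / 4 : ℝ)) ≤
      25 * ((n : ℝ) ^ (3 / 2 : ℝ) * (m : ℝ) ^ (3 / 4 : ℝ) * Real.log n ^ 2 + 1) := by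
  have hn : 0 < n := hS.N_pos.trans_le hS.N_le
  rcases Nat.eq_or_lt_of_le (Nat.succ_le_of_lt hn) with h | h
  · -- a graph with one vertex
    obtain rfl : n = 1 := h.symm
    have hm : m = 1 := le_antisymm (by simpa using G.le_square) hS.m_pos
    have hlg : P.lg ≤ 2 := by
      have h4 : 2 ^ P.lg ≤ 2 ^ 2 := by simpa using hS.lg_le
      exact (Nat.pow_le_pow_iff_right (by norm_num)).1 h4
    have hlg' : (P.lg : ℝ) ≤ 2 := by exact_mod_cast hlg
    subst hm
    simp only [Nat.cast_one, Real.one_rpow, Real.log_one]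
    have : (0 : ℝ) ≤ P.lg := Nat.cast_nonneg _
    nlinarith
  · have hlog2 : (0.69 : ℝ) < Real.log 2 := by have := Real.log_two_gt_d9; linarith
    have hn2 : (2 : ℝ) ≤ n := by exact_mod_cast h
    have hlogn : Real.log 2 ≤ Real.log n := Real.log_le_log (by norm_num) hn2
    have h1 : (P.lg : ℝ) * Real.log 2 ≤ 2 * Real.log 2 + Real.log n := by
      have h2 : ((2 ^ P.lg : ℕ) : ℝ) ≤ (4 * n : ℕ) := by exact_mod_cast hS.lg_le
      push_cast at h2
      have h3 := Real.log_le_log (by positivity) h2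
      rw [Real.log_pow, Real.log_mul (by norm_num) (by positivity),
        show (4 : ℝ) = 2 ^ 2 by norm_num, Real.log_pow] at h3
      simpa using h3
    have h2 : (P.lg : ℝ) ≤ 5 * Real.log n := by
      have h3 : (P.lg : ℝ) * 0.69 ≤ P.lg * Real.log 2 := by gcongr
      linarith
    have h3 : (P.lg : ℝ) ^ 2 ≤ 25 * Real.log n ^ 2 := by
      calc (P.lg : ℝ) ^ 2 ≤ (5 * Real.log n) ^ 2 := by gcongr
        _ = _ := by ring
    have hX : (0 : ℝ) ≤ (n : ℝ) ^ (3 / 2 : ℝ) * (m : ℝ) ^ (3 / 4 : ℝ) := by positivity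
    have := mul_le_mul_of_nonneg_right h3 hX
    linarith

end

end RealRAM

/-! ### The whole algorithm -/

namespace RealRAM

open Prog

section

variable {n m q b h₀ : ℕ} {G : RatioGraph n m} {H : Net} {P : Params}

theorem Setup.with_samples (hS : Setup q G H P b h₀) (C : ℕ → ℕ) :
    Setup q G H { P with C := C } b h₀ :=
  ⟨hS.m_eq, hS.m_pos, hS.c, hS.t, hS.src_eq, hS.dst_eq, hS.N_pos, hS.N_le, hS.N_le', hS.le_lg,
    hS.lg_le, hS.le_b, hS.b_le, hS.h₀_pos, hS.h₀_le, hS.le_h₀, hS.h₀_lt, hS.h, hS.L, hS.lgB⟩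

/-- Every cycle of the graph has positive transit time also after the renumbering. -/
theorem Setup.timeSum_pos (hS : Setup q G H P b h₀) (ht : ∀ l, G.IsCycle l → 0 < G.totalTime l)
    (l : List ℕ) (hl : H.Cyc l) : 0 < H.timeSum l := by
  obtain ⟨l, rfl⟩ := hS.exists_list hl.lt
  rw [hS.timeSum_eq]
  exact ht l ((hS.cyc_iff l).1 hl)

/-- The renumbered graph and the parameters depend only on the input, the samples only on the
coins. -/
theorem exists_setup_runs (G : RatioGraph n m) (hm : 0 < m) (hq : 0 < q)
    (ht : ∀ l, G.IsCycle l → 0 < G.totalTime l) :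
    ∃ H P b h₀, Setup q G H P b h₀ ∧ ∀ ω,
      Runs ((n + m + 2) ^ (3 * q + 16)) ((sample q).seq search) (G.init ω)
        (8 + prepConst q * (n + m + 1) + drawConst * (P.L * (b + 1) + 1) +
          searchConst * (P.lgB + 1) * stagesTime H P) fun s =>
        ∃ C, (∀ a < P.L, C a = drawn b H.N ω a) ∧
          ((s.output = [] ∧ ∀ l, ¬ H.Cyc l) ∨ (H.Cyc s.output ∧ ∀ l₀, H.Cyc l₀ →
            (∀ l, H.Cyc l → H.ratio l₀ ≤ H.ratio l) → Covered H { P with C := C } l₀ →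
              H.ratio s.output = H.ratio l₀)) := by
  -- a run for some outcome of the coins determines the parameters for all of them
  obtain ⟨t, s₁, hex, htT, H, P, b, h₀, hS, hE, hb⟩ :=
    runs_prepare G hm hq fun _ => false
  refine ⟨H, P, b, h₀, hS, fun ω => ?_⟩
  have hcells := ((hS.with_samples fun _ => 0).ok hq fun _ _ => hS.N_pos).cells_lt
  have hsamp := ((hS.with_samples fun _ => 0).ok hq fun _ _ => hS.N_pos).samples_lt'
  set W := (n + m + 2) ^ (3 * q + 16) with hW
  have hprep : Runs W (prepare q) (G.init ω) (prepConst q * (n + m + 1))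
      fun s => s = { s₁ with coins := ω } := ⟨t, _, hex.coins rfl ω, htT, rfl⟩
  have hLW : P.L < W := by
    change 4 * (P.L * P.L * P.L + P.L * P.L + P.L + 1) < W at hsamp
    omega
  have hbW : 2 ^ (b + 1) < W := by
    have h1 : H.N ≤ (H.N + 1) * (H.N + H.m) :=
      (Nat.le_add_right _ H.m).trans (Nat.le_mul_of_pos_left _ (Nat.succ_pos _))
    have := hS.b_le
    rw [pow_succ]
    omega
  have hsample : Runs W (sample q) (G.init ω) (4 + (prepConst q * (n + m + 1) +
      drawConst * (P.L * (b + 1) + 1))) fun s =>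
        ∃ C, (∀ a < P.L, C a = drawn b H.N ω a) ∧ Env H { P with C := C } s := by
    refine Runs.mono (T := 3 + (prepConst q * (n + m + 1) + drawConst * (P.L * (b + 1) + 1)))
      (Runs.ite (fun _ => Runs.seq (hprep.mono le_rfl fun s _ hs _ => ?_))
        fun h => absurd (by simpa [BExp.Holds, WExp.eval, RatioGraph.init] using hm) h)
      (by omega) fun _ _ h => h
    subst hs
    refine (runs_draw (s := { s₁ with coins := ω }) hb hE.N hE.L hLW hbW).mono le_rfl
      fun s' ha hs' => ⟨s'.warr aC, hs', ?_⟩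
    exact ⟨(ha.w _ rfl).trans hE.N, (ha.w _ rfl).trans hE.m, (ha.wa _ rfl).trans hE.src,
      (ha.wa _ rfl).trans hE.dst, (ha.ra _ rfl).trans hE.c, (ha.ra _ rfl).trans hE.t, rfl,
      (ha.w _ rfl).trans hE.lg, (ha.w _ rfl).trans hE.h, (ha.w _ rfl).trans hE.L,
      (ha.w _ rfl).trans hE.lgB, (ha.w _ rfl).trans hE.J, (ha.w _ rfl).trans hE.NN,
      (ha.w _ rfl).trans hE.cells, (ha.w _ rfl).trans hE.N1, (ha.w _ rfl).trans hE.NN1,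
      (ha.w _ rfl).trans hE.LL⟩
  refine Runs.mono (T := (4 + (prepConst q * (n + m + 1) + drawConst * (P.L * (b + 1) + 1))) +
      searchConst * (P.lgB + 1) * stagesTime H P)
    (Runs.seq (hsample.mono le_rfl fun s _ ⟨C, hC, hEs⟩ _ => ?_)) (by omega) fun _ _ h => h
  have hOk : ({ P with C := C } : Params).Ok W H :=
    (hS.with_samples C).ok hq fun a ha => by
      show C a < _
      rw [hC a ha]; exact drawn_lt hS.N_pos ω a
  exact (runs_search hOk hEs (hS.timeSum_pos ht)).mono le_rfl fun s' _ h => ⟨C, hC, h⟩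

end

/-- On a graph without edges the program stops immediately. -/
theorem exec_no_edges {n q W : ℕ} (G : RatioGraph n 0) (ω : ℕ → Bool) :
    Exec W ((sample q).seq search) (G.init ω) 8 (G.init ω) := by
  have h : ¬ BExp.Holds W (G.init ω) (.wlt (.const 0) (.var wm)) := by
    simp [BExp.Holds, WExp.eval, RatioGraph.init]
  exact .seq (.iteFalse h (.skip _)) (.iteFalse h (.skip _))

end RealRAM

theorem RatioGraph.IsCycle.length_le {n m : ℕ} {G : RatioGraph n m} {l : List (Fin m)}
    (h : G.IsCycle l) : l.length ≤ n := by
  simpa using h.2.2.length_le_card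

/-- There are finitely many simple cycles. -/
theorem RatioGraph.exists_isMinRatioCycle {n m : ℕ} (G : RatioGraph n m) {l : List (Fin m)}
    (hl : G.IsCycle l) : ∃ l₀, G.IsMinRatioCycle l₀ :=
  Set.exists_min_image {l | G.IsCycle l} G.ratio
    ((List.finite_length_le (Fin m) n).subset fun _ h => h.length_le) ⟨l, hl⟩

theorem mainTheorem2 (c : ℕ) :
    ∃ (sample search : RealRAM.Cmd) (κ : ℕ) (K : ℝ),
      sample.RealFree ∧ search.CoinFree ∧ 0 < κ ∧
      ∀ (n m : ℕ) (G : RatioGraph n m), (∀ l, G.IsCycle l → 0 < G.totalTime l) →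
        ∃ out : (ℕ → Bool) → List (Fin m),
          (∀ ω, ∃ T : ℕ,
            (T : ℝ) ≤ K * ((n : ℝ) ^ (3 / 2 : ℝ) * (m : ℝ) ^ (3 / 4 : ℝ) * Real.log n ^ 2 + 1) ∧
            G.Computes κ (sample.seq search) ω T (out ω)) ∧
          (∀ ω, G.IsCycle (out ω) ∨ (out ω = [] ∧ ∀ l, ¬ G.IsCycle l)) ∧
          RealRAM.coinMeasure {ω | (∃ l, G.IsCycle l) ∧ ¬ G.IsMinRatioCycle (out ω)} ≤
            ((n : ENNReal) ^ c)⁻¹ := by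
  set q := 2 * (c + 1) with hq
  refine ⟨RealRAM.Prog.sample q, RealRAM.Prog.search, 3 * q + 16, RealRAM.timeConst q * 300 + 8, ?_,
    RealRAM.Cmd.coinFree_of_tosses rfl, by omega, fun n m G ht => ?_⟩
  · simp only [RealRAM.Prog.sample, RealRAM.Prog.prepare]
    repeat' constructor
  rcases Nat.eq_zero_or_pos m with rfl | hm
  · -- without edges there is no cycle
    have hno : ∀ l, ¬ G.IsCycle l := fun l hl => hl.1 (List.eq_nil_of_length_eq_zero (by
      cases l with
      | nil => rfl
      | cons e l => exact e.elim0))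
    refine ⟨fun _ => [], fun ω => ⟨8, ?_, G.init ω, RealRAM.exec_no_edges G ω, ?_⟩,
      fun ω => .inr ⟨rfl, hno⟩, ?_⟩
    · simp only [Nat.cast_zero, Real.zero_rpow (by norm_num : (3 / 4 : ℝ) ≠ 0)]
      have : (0 : ℝ) ≤ RealRAM.timeConst q := Nat.cast_nonneg _
      push_cast
      linarith
    · simp [RatioGraph.init]
    · simp [hno]
  obtain ⟨H, P, b, h₀, hS, hrun⟩ := RealRAM.exists_setup_runs (q := q) G hm (by omega) ht
  choose T s hex hT C hC hs using hrun
  have hlt : ∀ ω, ∀ e ∈ (s ω).output, e < H.m := fun ω => by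
    rcases hs ω with ⟨h, -⟩ | ⟨h, -⟩
    · simp [h]
    · exact h.lt
  choose out hout using fun ω => hS.exists_list (hlt ω)
  -- the claims on time, output and probability
  refine ⟨out, fun ω => ⟨T ω, ?_, s ω, hex ω, (hout ω).symm⟩, fun ω => ?_, ?_⟩
  · have h1 := (hT ω).trans (hS.time_le (by omega))
    have h2 : (T ω : ℝ) ≤ RealRAM.timeConst q * ((P.lg : ℝ) ^ 2 *
        ((h₀ * (n * m) + (H.N / h₀ + 1) ^ 3 + (H.N / h₀ + 1) * n : ℕ) : ℝ)) := by
      exact_mod_cast h1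
    have h3 := hS.balance_le
    have h4 := hS.log_le
    set X : ℝ := (n : ℝ) ^ (3 / 2 : ℝ) * (m : ℝ) ^ (3 / 4 : ℝ)
    have hX : 0 ≤ X * Real.log n ^ 2 := by positivity
    calc (T ω : ℝ) ≤ RealRAM.timeConst q * ((P.lg : ℝ) ^ 2 * (12 * X)) := h2.trans (by gcongr)
      _ = RealRAM.timeConst q * (12 * ((P.lg : ℝ) ^ 2 * X)) := by ring
      _ ≤ RealRAM.timeConst q * (12 * (25 * (X * Real.log n ^ 2 + 1))) := by gcongr
      _ ≤ _ := by linarith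
  · rcases hs ω with ⟨h, hno⟩ | ⟨h, -⟩
    · refine .inr ⟨?_, fun l hl => hno _ ((hS.cyc_iff l).2 hl)⟩
      have := hout ω
      rw [h] at this
      simpa using this
    · rw [← hout ω] at h
      exact .inl ((hS.cyc_iff _).1 h)
  by_cases hcyc : ∃ l, G.IsCycle l
  swap
  · simp [hcyc]
  obtain ⟨l₀, hl₀, hmin⟩ := G.exists_isMinRatioCycle hcyc.choose_spec
  have hl₀' := (hS.cyc_iff l₀).2 hl₀
  refine (MeasureTheory.measure_mono ?_).trans (RealRAM.coinMeasure_not_covered hS hl₀')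
  rintro ω ⟨-, hω⟩
  refine ⟨C ω, hC ω, fun hcov => hω ?_⟩
  rcases hs ω with ⟨-, hno⟩ | ⟨h, hopt⟩
  · exact absurd hl₀' (hno _)
  · have hr := hopt _ hl₀' (fun l hl => by
      obtain ⟨l, rfl⟩ := hS.exists_list hl.lt
      rw [hS.ratio_eq, hS.ratio_eq]
      exact hmin l ((hS.cyc_iff l).1 hl)) hcov
    rw [← hout ω] at h hr
    rw [hS.ratio_eq, hS.ratio_eq] at hr
    exact ⟨(hS.cyc_iff _).1 h, fun l hl => hr ▸ hmin l hl⟩
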